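/- **Theorem ($D_N$ stabilization).** For $N\ge 4$ let $$\Lambda_{D_N}=\frac{x^{N-1}}{N-1}+xy^2+\sum_{k=1}^{N-1}v_kx^{k-1}+v_Ny$$ be the unfolding of the $D_N$ singularity. Let $c_{ab}^k(v)\in\mathbb C[v_1,\dots,v_N]$ be the structure constants of $\mathbb C[v][x,y]/(\partial_x\Lambda_{D_N},\partial_y\Lambda_{D_N})$ in the basis $[\partial\Lambda_{D_N}/\partial v_1],\dots,[\partial\Lambda_{D_N}/\partial v_N]$. They define the product $\frac{\partial}{\partial v_a}\circ\frac{\partial}{\partial v_b}=\sum_k c_{ab}^k\frac{\partial}{\partial v_k}$ and the pairing $\eta(\frac{\partial}{\partial v_a},\frac{\partial}{\partial v_b})=c_{ab}^{N-1}$. Let $t_1,\dots,t_N\in\mathbb C[v_1,\dots,v_N]$ be flat coordinates in which $\eta$ has the constant matrix $\eta_{NN}=1$ and $\eta_{\alpha\beta}=\delta_{\alpha+\beta,N}$ otherwise, normalized by $t_\alpha(0)=0$ and $t_\alpha=v_\alpha+(\text{terms of degree}\ge 2)$ for $\alpha<N$, and $t_N=r\,v_N$ with a constant $r\in\mathbb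 C$. Let $F_{D_N}\in\mathbb C[t_1,\dots,t_N]$ be the Frobenius manifold potential in these coordinates, that is, $$\frac{\partial}{\partial t_\alpha}\circ\frac{\partial}{\partial t_\beta}=\sum_{\gamma,\delta=1}^N\frac{\partial^3F_{D_N}}{\partial t_\alpha\partial t_\beta\partial t_\gamma}\,\eta^{\gamma\delta}\,\frac{\partial}{\partial t_\delta}$$ and $$\sum_{\alpha=1}^{N-1}\frac{N-\alpha}{N-1}\,t_\alpha\frac{\partial F_{D_N}}{\partial t_\alpha}+\frac{N}{2(N-1)}\,t_N\frac{\partial F_{D_N}}{\partial t_N}=\Bigl(3-\frac{N-2}{N-1}\Bigr)F_{D_N}.$$ Then the coordinate $v_1$ is a polynomial $v_1^{(N)}(t_1,\dots,t_{N-1})$ with rational coefficients, and there are $\mathcal A_\gamma^{(N)},\mathcal B_\gamma^{(N)}\in\mathbb Q[t_1,\dots,t_{N-1}]$ with $$\frac{\partial F_{D_N}}{\partial t_\gamma}=\mathcal A_\gamma^{(N)}+\mathcal B_\gamma^{(N)}t_N^2\quad(1\le\gamma\le N-1),\qquad \frac{\partial F_{D_N}}{\partial t_N}=v_1^{(N)}\,t_N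 .$$ Moreover, for all $N_2>N_1\ge 4$, as equalities of polynomials in $s_1,s_2,\dots$, $$\left.\frac{\partial v_1^{(N_1)}}{\partial t_\beta}\right|_{t_\gamma=s_{N_1-\gamma}\,\forall\gamma}=\left.\frac{\partial v_1^{(N_2)}}{\partial t_\beta}\right|_{t_\gamma=s_{N_2-\gamma}\,\forall\gamma}\qquad\text{for all }1\le\beta<N_1,$$ $$\left.\frac{\partial \mathcal A_\alpha^{(N_1)}}{\partial t_\beta}\right|_{t_\gamma=s_{N_1-\gamma}\,\forall\gamma}=\left.\frac{\partial \mathcal A_\alpha^{(N_2)}}{\partial t_\beta}\right|_{t_\gamma=s_{N_2-\gamma}\,\forall\gamma}\qquad\text{for all }\alpha,\beta\ge 1,\ \alpha+\beta<N_1.$$ -/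

import Mathlib

open MvPolynomial

noncomputable section

/-! Polynomials in the unfolding variables `v_1, …, v_N` and in the flat variables `t_1, …, t_N`
are elements of `MvPolynomial ℕ ℂ`; the variable with index `k` is `X k`, and only the indices
`1 ≤ k ≤ N` are used. Elements of `ℂ[v][x, y]` are polynomials in two variables, `x = X 0` and
`y = X 1`, over `MvPolynomial ℕ ℂ`. -/

/-- The unfolding
`Λ = x ^ (N - 1) / (N - 1) + x y ^ 2 + ∑_{k=1}^{N-1} v_k x ^ (k - 1) + v_N y`
of the `D_N` singularity. -/
def dUnfolding (N : ℕ) : MvPolynomial (Fin 2) (MvPolynomial ℕ ℂ) :=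
  C (C (1 / ((N : ℂ) - 1))) * X 0 ^ (N - 1) + X 0 * X 1 ^ 2
    + ∑ k ∈ Finset.Icc 1 (N - 1), C (X k) * X 0 ^ (k - 1) + C (X N) * X 1

/-- The derivative `∂Λ/∂v_k` for `1 ≤ k ≤ N`: `x ^ (k - 1)` for `k < N`, and `y` for `k = N`. -/
def dBasis (N k : ℕ) : MvPolynomial (Fin 2) (MvPolynomial ℕ ℂ) :=
  if k = N then X 1 else X 0 ^ (k - 1)

/-- The ideal `(∂Λ/∂x, ∂Λ/∂y)` of `ℂ[v][x, y]`. -/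
def dJacobianIdeal (N : ℕ) : Ideal (MvPolynomial (Fin 2) (MvPolynomial ℕ ℂ)) :=
  Ideal.span {pderiv 0 (dUnfolding N), pderiv 1 (dUnfolding N)}

/-- `c a b k` is the structure constant `c_{ab}^k(v)` of `ℂ[v][x, y] / (∂Λ/∂x, ∂Λ/∂y)` in the
basis `[∂Λ/∂v_1], …, [∂Λ/∂v_N]`; it gives the product
`∂/∂v_a ∘ ∂/∂v_b = ∑_k c_{ab}^k ∂/∂v_k`, and the pairing `η(∂/∂v_a, ∂/∂v_b) = c_{ab}^{N-1}`. -/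
def IsDStructureConstants (N : ℕ) (c : ℕ → ℕ → ℕ → MvPolynomial ℕ ℂ) : Prop :=
  ∀ a ∈ Finset.Icc 1 N, ∀ b ∈ Finset.Icc 1 N,
    dBasis N a * dBasis N b - ∑ k ∈ Finset.Icc 1 N, C (c a b k) * dBasis N k ∈ dJacobianIdeal N

/-- The constant matrix `η_{αβ}`, `1 ≤ α, β ≤ N`, of the pairing in flat coordinates. -/
def dEta (N α β : ℕ) : ℂ :=
  if α = N ∧ β = N then 1 else if α + β = N then 1 else 0

/-- The matrix `dEta N` is its own inverse. -/
theorem dEta_mul_dEta (N α β : ℕ) (hα : α ∈ Finset.Icc 1 N) (hβ : β ∈ Finset.Icc 1 N) :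
    ∑ γ ∈ Finset.Icc 1 N, dEta N α γ * dEta N γ β = if α = β then 1 else 0 := by
  simp only [Finset.mem_Icc] at hα hβ
  by_cases h : α = N
  · rw [Finset.sum_eq_single N]
    · unfold dEta
      split_ifs <;> first | (exfalso; omega) | simp
    · intro γ hγ hne
      simp only [Finset.mem_Icc] at hγ
      unfold dEta
      split_ifs <;> first | (exfalso; omega) | simp
    · intro hN
      exact absurd (Finset.mem_Icc.2 ⟨by omega, le_rfl⟩) hN
  · rw [Finset.sum_eq_single (N - α)]
    · unfold dEta
      split_ifs <;> first | (exfalso; omega) | simp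
    · intro γ hγ hne
      simp only [Finset.mem_Icc] at hγ
      unfold dEta
      split_ifs <;> first | (exfalso; omega) | simp
    · intro hN
      exact absurd (Finset.mem_Icc.2 ⟨by omega, by omega⟩) hN

/-- `t_α = t_α(v)`, `1 ≤ α ≤ N`, are the flat coordinates of the pairing `η` that agree with `v_α`
to first order at the origin for `α < N`, with `t_N` a constant multiple of `v_N`. -/
structure IsDFlatCoordinates (N : ℕ) (c : ℕ → ℕ → ℕ → MvPolynomial ℕ ℂ)
    (t : ℕ → MvPolynomial ℕ ℂ) : Prop where
  vars_subset : ∀ α ∈ Finset.Icc 1 N, (t α).vars ⊆ Finset.Icc 1 N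
  constantCoeff_eq : ∀ α ∈ Finset.Icc 1 (N - 1), constantCoeff (t α) = 0
  linear_coeff_eq : ∀ α ∈ Finset.Icc 1 (N - 1), ∀ a ∈ Finset.Icc 1 N,
    coeff (Finsupp.single a 1) (t α) = if a = α then 1 else 0
  last_eq : ∃ r : ℂ, t N = C r * X N
  pairing_eq : ∀ a ∈ Finset.Icc 1 N, ∀ b ∈ Finset.Icc 1 N,
    ∑ α ∈ Finset.Icc 1 N, ∑ β ∈ Finset.Icc 1 N,
      C (dEta N α β) * pderiv a (t α) * pderiv b (t β) = c a b (N - 1)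

/-- `F` is the Frobenius manifold potential `F_{D_N}(t_1, …, t_N)`, and `t_α = t_α(v)` are the flat
coordinates in which it is written. The field `product_eq` compares the coefficients of `∂/∂t_δ` on
the two sides of `∂/∂t_α ∘ ∂/∂t_β = ∑_{γ,δ} F_{αβγ} η^{γδ} ∂/∂t_δ`, evaluated on the vector
fields `∂/∂v_a = ∑_α (∂t_α/∂v_a) ∂/∂t_α` and `∂/∂v_b`; the inverse matrix `η^{γδ}` is `dEta N γ δ`
by `dEta_mul_dEta`. -/
structure IsDPotentialWith (N : ℕ) (c : ℕ → ℕ → ℕ → MvPolynomial ℕ ℂ)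
    (t : ℕ → MvPolynomial ℕ ℂ) (F : MvPolynomial ℕ ℂ) : Prop where
  structureConstants : IsDStructureConstants N c
  flat : IsDFlatCoordinates N c t
  vars_subset : F.vars ⊆ Finset.Icc 1 N
  product_eq : ∀ a ∈ Finset.Icc 1 N, ∀ b ∈ Finset.Icc 1 N, ∀ δ ∈ Finset.Icc 1 N,
    ∑ k ∈ Finset.Icc 1 N, c a b k * pderiv k (t δ) =
      ∑ α ∈ Finset.Icc 1 N, ∑ β ∈ Finset.Icc 1 N, ∑ γ ∈ Finset.Icc 1 N,
        pderiv a (t α) * pderiv b (t β) * aeval t (pderiv α (pderiv β (pderiv γ F)))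
          * C (dEta N γ δ)
  /-- Quasi-homogeneity `E F = (3 - (N - 2) / (N - 1)) F`. -/
  euler_eq :
    ∑ α ∈ Finset.Icc 1 (N - 1), C (((N : ℂ) - α) / ((N : ℂ) - 1)) * X α * pderiv α F
        + C ((N : ℂ) / (2 * ((N : ℂ) - 1))) * X N * pderiv N F
      = C (3 - ((N : ℂ) - 2) / ((N : ℂ) - 1)) * F

/-- `F` is the potential of the `D_N` Frobenius manifold in the flat coordinates `t = t(v)`. -/
def IsDPotential (N : ℕ) (t : ℕ → MvPolynomial ℕ ℂ) (F : MvPolynomial ℕ ℂ) : Prop :=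
  ∃ c : ℕ → ℕ → ℕ → MvPolynomial ℕ ℂ, IsDPotentialWith N c t F

/-- `v₁` expresses the unfolding coordinate `v_1` through `t_1, …, t_{N-1}`, and, with
`A γ, B γ ∈ ℚ[t_1, …, t_{N-1}]`,
`∂F/∂t_γ = A_γ + B_γ t_N ^ 2` for `1 ≤ γ ≤ N - 1` and `∂F/∂t_N = v_1 t_N`. -/
structure IsDDecomposition (N : ℕ) (t : ℕ → MvPolynomial ℕ ℂ) (F : MvPolynomial ℕ ℂ)
    (v₁ : MvPolynomial ℕ ℚ) (A B : ℕ → MvPolynomial ℕ ℚ) : Prop where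
  v₁_vars : v₁.vars ⊆ Finset.Icc 1 (N - 1)
  A_vars : ∀ γ ∈ Finset.Icc 1 (N - 1), (A γ).vars ⊆ Finset.Icc 1 (N - 1)
  B_vars : ∀ γ ∈ Finset.Icc 1 (N - 1), (B γ).vars ⊆ Finset.Icc 1 (N - 1)
  v₁_eq : aeval t v₁ = (X 1 : MvPolynomial ℕ ℂ)
  pderiv_eq : ∀ γ ∈ Finset.Icc 1 (N - 1),
    pderiv γ F = map (algebraMap ℚ ℂ) (A γ) + map (algebraMap ℚ ℂ) (B γ) * X N ^ 2
  pderiv_last_eq : pderiv N F = map (algebraMap ℚ ℂ) v₁ * X N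

/-- The substitution `t_γ = s_{N-γ}`. -/
def toS (N : ℕ) (p : MvPolynomial ℕ ℚ) : MvPolynomial ℕ ℚ :=
  rename (fun γ => N - γ) p

end

/-! Write `∂Λ/∂y = 2xy + v_N` and `∂Λ/∂x = ψ(x) + y²`, with `ψ` monic of degree `N - 2` in `x`. Once
`v_N` is invertible, `y = 2xψ / v_N` can be eliminated, and the Jacobian ring maps to `K[x] / (x²ψ +
v_N²/4)`. On the basis `1, x, …, x^(N-2), y` the functional sending `P` to the coefficient of
`x^(N-1)` in the remainder of `xP` is the coordinate of index `N - 1`. Hence it computes both the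
pairing (on products of two basis elements) and the third derivatives of the potential (on products
of three). This is `dRes_basisPoly_mul_basisPoly` and `dRes_flatBasis_triple`.

The flat coordinates come from one series. Put `s_j = t_{N-j}`, `f(z) = 1 - (1/2) ∑ s_j z^j`, and
let `φ_n`, `ψ_n` be the coefficients of `w^n` in `f(w) / (f(w)² - xw)` and `1 / (f(w)² - xw)`. Then
`v` is an explicit polynomial in `t` with `ψ = ψ_{N-2}` and `∂Λ/∂t_i = φ_{i-1}` (`C_mul_vFlat`,
`pderiv_vFlat`). Under `x = f(z)²/z` near infinity, `φ_n` is `z^(-n) f/u` and `ψ_n` is `z^(-n)/u` up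
to higher order, where `u = g - zg'`, `g = f²` and `dx = -u z^(-2) dz`. The residue of `φ_a φ_b dx /
(xψ)` at infinity therefore vanishes unless `a + b = N - 2`, which is the required antidiagonal
metric (`coeff_resPoly_mul_modByMonic`). An isometry between constant metrics is affine
(`pderiv_pderiv_eq_zero_of_isometry`), so the normalization forces the given flat coordinates to be
these; since `y²` pairs to `-1`, moreover `t_N = r v_N` with `r² = -1`.

Modulo the relations `xy` is `-v_N/2` and `y²` is `-ψ`. This gives `F_{kNN} = ∂v_1/∂t_k` and
`F_{NNN} = 0`, and shows that `F_{ijN}` vanishes on `t_N = 0`, where the remaining third derivatives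
are rational. First and second derivatives of `F` have nonzero weight, hence no constant terms, so
integrating these third derivatives yields the stated form of the gradient.

For stabilization, `∂v_1/∂t_β = φ_{β-1}(0)` is the coefficient of `z^(β-1)` in `1/f`, a polynomial
in the `s_j` that does not involve `N`. Likewise `φ_{β-1} φ_{α-1} = ∑ D_l φ_l` with `D_l`
independent of `N`. If `α + β < N`, all `φ_l` that occur lie in the range of the duality, and
pairing with `φ_{N-m-1}` shows that the derivative of `∂A_α/∂t_β` in `s_m` is `D_{m-1}`. -/

namespace DSingularity

/-! ### Asymptotics at infinity of the coefficients of `h / (g - xw)` -/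

section Residue

variable {A : Type*} [CommRing A]

/-- The terms of order greater than `m` of a power series. -/
noncomputable def seriesTail (g : PowerSeries A) (m : ℕ) : PowerSeries A :=
  PowerSeries.mk fun k => if m < k then PowerSeries.coeff k g else 0

theorem X_pow_dvd_seriesTail (g : PowerSeries A) (m : ℕ) :
    (PowerSeries.X : PowerSeries A) ^ (m + 1) ∣ seriesTail g m := by
  rw [PowerSeries.X_pow_dvd_iff]
  intro k hk
  rw [seriesTail, PowerSeries.coeff_mk, if_neg (by omega)]

theorem seriesTail_zero {g : PowerSeries A} (hg : PowerSeries.coeff 0 g = 1) :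
    seriesTail g 0 = g - 1 := by
  ext k
  rw [seriesTail, PowerSeries.coeff_mk, map_sub, PowerSeries.coeff_one]
  rcases Nat.eq_zero_or_pos k with rfl | hk
  · simp [hg]
  · rw [if_pos hk, if_neg hk.ne', sub_zero]

theorem seriesTail_sub_succ (g : PowerSeries A) (m : ℕ) :
    seriesTail g m - seriesTail g (m + 1)
      = PowerSeries.C (PowerSeries.coeff (m + 1) g) * PowerSeries.X ^ (m + 1) := by
  ext k
  rw [map_sub, seriesTail, seriesTail, PowerSeries.coeff_mk, PowerSeries.coeff_mk,
    PowerSeries.coeff_C_mul_X_pow]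
  by_cases h : k = m + 1
  · subst h; simp
  · by_cases h2 : m < k
    · rw [if_pos h2, if_pos (by omega), if_neg h, sub_self]
    · rw [if_neg h2, if_neg (by omega), if_neg h, sub_self]

/-- The coefficient of `z^k` in `g` belongs to exactly the `k` tails with index `m < k`, which
reproduces the factor `k` in `z g'`. -/
theorem X_pow_dvd_sum_seriesTail (g : PowerSeries A) (n : ℕ) :
    (PowerSeries.X : PowerSeries A) ^ (n + 1) ∣
      ∑ m ∈ Finset.range (n + 1), seriesTail g m
        - PowerSeries.X * PowerSeries.derivative A g := by
  rw [PowerSeries.X_pow_dvd_iff]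
  intro k hk
  rw [map_sub, map_sum]
  simp only [seriesTail, PowerSeries.coeff_mk]
  rcases k with _ | k
  · simp
  · rw [PowerSeries.coeff_succ_X_mul, PowerSeries.coeff_derivative, ← Finset.sum_filter,
      Finset.sum_const]
    have : (Finset.range (n + 1)).filter (fun m => m < k + 1) = Finset.range (k + 1) := by
      ext m; simp only [Finset.mem_filter, Finset.mem_range]; omega
    rw [this, Finset.card_range, nsmul_eq_mul]
    push_cast; ring

/-- The recursion satisfied by `n ↦ z ^ n P_n(g(z) / z)`, where `∑ P_n(x) w ^ n = h / (g - x w)`. -/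
def IsResidueSequence (g h : PowerSeries A) (p : ℕ → PowerSeries A) : Prop :=
  p 0 = PowerSeries.C (PowerSeries.coeff 0 h) ∧
  ∀ n, ∑ k ∈ Finset.range (n + 2), PowerSeries.C (PowerSeries.coeff k g) * PowerSeries.X ^ k
      * p (n + 1 - k)
    = g * p n + PowerSeries.C (PowerSeries.coeff (n + 1) h) * PowerSeries.X ^ (n + 1)

namespace IsResidueSequence

variable {g h : PowerSeries A} {p : ℕ → PowerSeries A}

/-- Each term `g_k z^k` with `k ≥ 1` is a difference of consecutive tails, and the term `k = 0` is
`p (n + 1)` because `g_0 = 1`. In this form the recursion telescopes. -/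
theorem step (hp : IsResidueSequence g h p) (hg : PowerSeries.coeff 0 g = 1) (n : ℕ) :
    g * p n + PowerSeries.C (PowerSeries.coeff (n + 1) h) * PowerSeries.X ^ (n + 1)
      = p (n + 1) + ∑ j ∈ Finset.range (n + 1),
        p j * (seriesTail g (n - j) - seriesTail g (n + 1 - j)) := by
  rw [← hp.2 n, Finset.sum_range_succ', ← Finset.sum_range_reflect]
  rw [hg, add_comm]
  congr 1
  · simp
  · refine Finset.sum_congr rfl fun j hj => ?_
    have hj' := Finset.mem_range.1 hj
    have e : n + 1 - j = n - j + 1 := by omega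
    rw [e, seriesTail_sub_succ]
    have e1 : n + 1 - 1 - j = n - j := by omega
    have e2 : n + 1 - (n - j + 1) = j := by omega
    rw [e1, e2]; ring

/-- By `step`, the left side grows by `h_{n+1} z^(n+1)` when `n` increases by one. -/
theorem mul_sub_sum (hp : IsResidueSequence g h p) (hg : PowerSeries.coeff 0 g = 1) (n : ℕ) :
    g * p n - ∑ j ∈ Finset.range (n + 1), p j * seriesTail g (n - j) = h - seriesTail h n := by
  induction n with
  | zero =>
    have : h - seriesTail h 0 = PowerSeries.C (PowerSeries.coeff 0 h) := by
      ext k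
      rw [map_sub, seriesTail, PowerSeries.coeff_mk, PowerSeries.coeff_C]
      rcases k with _ | k <;> simp
    rw [this, ← hp.1]
    simp only [zero_add, Finset.sum_range_one, Nat.sub_self, seriesTail_zero hg]
    ring
  | succ n ih =>
    have h1 := hp.step hg n
    have h2 := seriesTail_sub_succ h n
    rw [Finset.sum_range_succ, Nat.sub_self, seriesTail_zero hg]
    simp only [mul_sub, Finset.sum_sub_distrib] at h1
    linear_combination ih - h1 - h2

/-- Subtracting two consecutive instances of `mul_sub_sum` expresses the difference through earlier
differences multiplied by tails. By induction the `j`-th such product has order at least `(j + 1) +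
(n - j + 1)`. -/
theorem X_pow_dvd_sub (hp : IsResidueSequence g h p) (hg : PowerSeries.coeff 0 g = 1) (n : ℕ) :
    (PowerSeries.X : PowerSeries A) ^ (n + 1) ∣ p (n + 1) - p n := by
  induction n using Nat.strong_induction_on with
  | _ n ih =>
    have h0 := hp.mul_sub_sum hg (n + 1)
    have h1 := hp.mul_sub_sum hg n
    have h2 := seriesTail_sub_succ h n
    rw [Finset.sum_range_succ'] at h0
    simp only [Nat.add_sub_add_right, Nat.sub_zero] at h0
    rw [Finset.sum_range_succ, Nat.sub_self, seriesTail_zero hg] at h0 h1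
    have key : p (n + 1) - p n
        = PowerSeries.C (PowerSeries.coeff (n + 1) h) * PowerSeries.X ^ (n + 1)
          + p 0 * seriesTail g (n + 1)
          + ∑ j ∈ Finset.range n, (p (j + 1) - p j) * seriesTail g (n - j) := by
      simp only [sub_mul, Finset.sum_sub_distrib]
      linear_combination h0 - h1 + h2
    rw [key]
    refine dvd_add (dvd_add (Dvd.intro_left _ rfl) ?_) (Finset.dvd_sum fun j hj => ?_)
    · exact Dvd.dvd.mul_left ((pow_dvd_pow _ (by omega)).trans (X_pow_dvd_seriesTail g _)) _
    · have hj' := Finset.mem_range.1 hj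
      have := mul_dvd_mul (ih j hj') (X_pow_dvd_seriesTail g (n - j))
      rw [← pow_add] at this
      exact (pow_dvd_pow _ (by omega)).trans this

theorem X_pow_dvd_sub_of_le (hp : IsResidueSequence g h p) (hg : PowerSeries.coeff 0 g = 1)
    {j n : ℕ} (hjn : j ≤ n) : (PowerSeries.X : PowerSeries A) ^ (j + 1) ∣ p n - p j := by
  induction n, hjn using Nat.le_induction with
  | base => simp
  | succ n hn ih =>
    have := dvd_add ((pow_dvd_pow _ (by omega)).trans (hp.X_pow_dvd_sub hg n)) ih
    simpa using this

/-- `z ^ n P_n(g / z) = h / (g - z g') + O(z ^ (n + 1))`. -/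
theorem X_pow_dvd_mul_sub (hp : IsResidueSequence g h p) (hg : PowerSeries.coeff 0 g = 1) (n : ℕ) :
    (PowerSeries.X : PowerSeries A) ^ (n + 1) ∣
      (g - PowerSeries.X * PowerSeries.derivative A g) * p n - h := by
  have h1 := hp.mul_sub_sum hg n
  -- Replacing every `p j` by `p n` in `mul_sub_sum` is harmless to this order, and the tails then
  -- add up to `z g'`.
  have h2 : (PowerSeries.X : PowerSeries A) ^ (n + 1) ∣
      ∑ j ∈ Finset.range (n + 1), (p n - p j) * seriesTail g (n - j) := by
    refine Finset.dvd_sum fun j hj => ?_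
    have hj' := Finset.mem_range.1 hj
    have := mul_dvd_mul (hp.X_pow_dvd_sub_of_le hg (Nat.lt_succ_iff.1 hj'))
      (X_pow_dvd_seriesTail g (n - j))
    rw [← pow_add] at this
    exact (pow_dvd_pow _ (by omega)).trans this
  have h3 := X_pow_dvd_sum_seriesTail g n
  have h4 : ∑ j ∈ Finset.range (n + 1), seriesTail g (n - j)
      = ∑ j ∈ Finset.range (n + 1), seriesTail g j := by
    rw [← Finset.sum_range_reflect]
    refine Finset.sum_congr rfl fun j hj => ?_
    have hj' := Finset.mem_range.1 hj
    congr 1; omega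
  have key : (g - PowerSeries.X * PowerSeries.derivative A g) * p n - h
      = p n * (∑ m ∈ Finset.range (n + 1), seriesTail g m
          - PowerSeries.X * PowerSeries.derivative A g)
        - ∑ j ∈ Finset.range (n + 1), (p n - p j) * seriesTail g (n - j) - seriesTail h n := by
    rw [← h4]
    simp only [sub_mul, Finset.sum_sub_distrib, ← Finset.mul_sum]
    linear_combination h1
  rw [key]
  exact dvd_sub (dvd_sub (Dvd.dvd.mul_left h3 _) h2) (X_pow_dvd_seriesTail h n)

end IsResidueSequence

/-- The coefficient of `z ^ n` in `h / (g - x z)`, where `γ = g⁻¹`. -/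
noncomputable def resPoly (γ h : PowerSeries A) (n : ℕ) : Polynomial A :=
  ∑ k ∈ Finset.range (n + 1),
    Polynomial.C (PowerSeries.coeff (n - k) (h * γ ^ (k + 1))) * Polynomial.X ^ k

theorem coeff_resPoly (γ h : PowerSeries A) (n k : ℕ) :
    (resPoly γ h n).coeff k
      = if k ≤ n then PowerSeries.coeff (n - k) (h * γ ^ (k + 1)) else 0 := by
  rw [resPoly, Polynomial.finsetSum_coeff]
  simp only [Polynomial.coeff_C_mul_X_pow]
  rw [Finset.sum_ite_eq]
  simp

theorem natDegree_resPoly_le (γ h : PowerSeries A) (n : ℕ) :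
    (resPoly γ h n).natDegree ≤ n := by
  rw [Polynomial.natDegree_le_iff_coeff_eq_zero]
  intro m hm
  rw [coeff_resPoly, if_neg (by omega)]

theorem coeff_resPoly_self {γ h : PowerSeries A} (hγ : PowerSeries.constantCoeff γ = 1)
    (hh : PowerSeries.constantCoeff h = 1) (n : ℕ) : (resPoly γ h n).coeff n = 1 := by
  rw [coeff_resPoly, if_pos le_rfl, Nat.sub_self]
  simp [hγ, hh]

theorem monic_resPoly {γ h : PowerSeries A} (hγ : PowerSeries.constantCoeff γ = 1)
    (hh : PowerSeries.constantCoeff h = 1) (n : ℕ) : (resPoly γ h n).Monic :=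
  Polynomial.monic_of_natDegree_le_of_coeff_eq_one n (natDegree_resPoly_le γ h n)
    (coeff_resPoly_self hγ hh n)

theorem map_resPoly {B : Type*} [CommRing B] (θ : A →+* B) (γ h : PowerSeries A) (n : ℕ) :
    (resPoly γ h n).map θ = resPoly (PowerSeries.map θ γ) (PowerSeries.map θ h) n := by
  ext k
  rw [Polynomial.coeff_map, coeff_resPoly, coeff_resPoly]
  split_ifs with hk
  · rw [← PowerSeries.coeff_map, map_mul, map_pow]
  · rw [map_zero]

/-- Multiply the generating series `h / (g - xw)` by `g - xw` and compare coefficients of `w^(n+1)`.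
-/
theorem sum_C_mul_resPoly {g γ : PowerSeries A} (hgγ : g * γ = 1) (h : PowerSeries A) (n : ℕ) :
    ∑ k ∈ Finset.range (n + 2), Polynomial.C (PowerSeries.coeff k g) * resPoly γ h (n + 1 - k)
      = Polynomial.X * resPoly γ h n + Polynomial.C (PowerSeries.coeff (n + 1) h) := by
  ext l
  rw [Polynomial.finsetSum_coeff]
  simp only [Polynomial.coeff_C_mul, coeff_resPoly, Polynomial.coeff_add]
  have key : ∀ m u, ∑ k ∈ Finset.range (m + 1), PowerSeries.coeff k g
      * PowerSeries.coeff (m - k) u = PowerSeries.coeff m (g * u) := by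
    intro m u
    rw [PowerSeries.coeff_mul, Finset.Nat.sum_antidiagonal_eq_sum_range_succ
      (fun i j => PowerSeries.coeff i g * PowerSeries.coeff j u)]
  by_cases hl : l ≤ n + 1
  · have h1 : ∑ k ∈ Finset.range (n + 2), PowerSeries.coeff k g * (if l ≤ n + 1 - k then
        PowerSeries.coeff (n + 1 - k - l) (h * γ ^ (l + 1)) else 0)
        = PowerSeries.coeff (n + 1 - l) (g * (h * γ ^ (l + 1))) := by
      rw [← key]
      symm
      refine Finset.sum_subset_zero_on_sdiff ?_ ?_ ?_
      · intro k hk; simp only [Finset.mem_range] at *; omega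
      · intro k hk
        simp only [Finset.mem_sdiff, Finset.mem_range] at hk
        rw [if_neg (by omega), mul_zero]
      · intro k hk
        have := Finset.mem_range.1 hk
        rw [if_pos (by omega)]
        rw [Nat.sub_right_comm]
    rw [h1]
    have h2 : g * (h * γ ^ (l + 1)) = h * γ ^ l := by
      rw [pow_succ]; linear_combination (h * γ ^ l) * hgγ
    rw [h2]
    rcases l with _ | l
    · simp
    · rw [Polynomial.coeff_X_mul, coeff_resPoly, if_pos (by omega), Polynomial.coeff_C_succ,
        add_zero]
      congr 2; omega
  · rcases l with _ | l
    · omega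
    · rw [Polynomial.coeff_X_mul, coeff_resPoly, if_neg (by omega), Polynomial.coeff_C_succ,
        add_zero]
      refine Finset.sum_eq_zero fun k hk => ?_
      rw [if_neg (by omega), mul_zero]

/-- The Laurent series `P(g(z) / z)`. -/
noncomputable def laurentEval (g : PowerSeries A) : Polynomial A →+* LaurentSeries A :=
  Polynomial.eval₂RingHom ((HahnSeries.ofPowerSeries ℤ A).comp PowerSeries.C)
    (HahnSeries.ofPowerSeries ℤ A g * HahnSeries.single (-1) 1)

/-- `z ^ d P(g(z) / z)` for a polynomial `P` of degree at most `d`. -/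
noncomputable def homog (g : PowerSeries A) (d : ℕ) (P : Polynomial A) : PowerSeries A :=
  ∑ k ∈ Finset.range (d + 1), PowerSeries.C (P.coeff k) * PowerSeries.X ^ (d - k) * g ^ k

theorem single_mul_ofPowerSeries_X :
    (HahnSeries.single (-1) 1 : LaurentSeries A)
      * HahnSeries.ofPowerSeries ℤ A PowerSeries.X = 1 := by
  rw [HahnSeries.ofPowerSeries_X, HahnSeries.single_mul_single]; simp

theorem ofPowerSeries_homog (g : PowerSeries A) {d : ℕ} {P : Polynomial A}
    (hP : P.natDegree ≤ d) :
    HahnSeries.ofPowerSeries ℤ A (homog g d P)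
      = HahnSeries.ofPowerSeries ℤ A PowerSeries.X ^ d * laurentEval g P := by
  rw [laurentEval, Polynomial.coe_eval₂RingHom,
    Polynomial.eval₂_eq_sum_range' _ (Nat.lt_succ_iff.2 hP), homog, map_sum, Finset.mul_sum]
  refine Finset.sum_congr rfl fun k hk => ?_
  have hk' := Finset.mem_range.1 hk
  rw [map_mul, map_mul, map_pow, map_pow, RingHom.comp_apply, mul_pow]
  obtain ⟨m, rfl⟩ : ∃ m, d = m + k := ⟨d - k, by omega⟩
  rw [Nat.add_sub_cancel, pow_add]
  have := congrArg (· ^ k) (single_mul_ofPowerSeries_X (A := A))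
  simp only [mul_pow, one_pow] at this
  linear_combination (-(HahnSeries.ofPowerSeries ℤ A) (PowerSeries.C (P.coeff k))
    * (HahnSeries.ofPowerSeries ℤ A PowerSeries.X) ^ m * (HahnSeries.ofPowerSeries ℤ A g) ^ k)
      * this

/-- The recursion `sum_C_mul_resPoly` is evaluated at `x = g/z` and multiplied by `z^(n+1)`. The
check takes place in Laurent series, where `z` is invertible and power series embed. -/
theorem isResidueSequence_homog {g γ : PowerSeries A} (hgγ : g * γ = 1)
    (hγ : PowerSeries.constantCoeff γ = 1) (h : PowerSeries A) :
    IsResidueSequence g h fun n => homog g n (resPoly γ h n) := by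
  refine ⟨?_, fun n => ?_⟩
  · simp [homog, coeff_resPoly, hγ]
  · apply HahnSeries.ofPowerSeries_injective (Γ := ℤ) (R := A)
    have h1 := congrArg (laurentEval g) (sum_C_mul_resPoly hgγ h n)
    have hC : ∀ a : A, laurentEval g (Polynomial.C a)
        = HahnSeries.ofPowerSeries ℤ A (PowerSeries.C a) := by
      intro a; rw [laurentEval, Polynomial.coe_eval₂RingHom, Polynomial.eval₂_C]; rfl
    have hX : laurentEval g Polynomial.X
        = HahnSeries.ofPowerSeries ℤ A g * HahnSeries.single (-1) 1 := by
      rw [laurentEval, Polynomial.coe_eval₂RingHom, Polynomial.eval₂_X]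
    rw [map_sum, map_add, map_mul, hC, hX] at h1
    simp only [map_mul, hC] at h1
    rw [map_sum, map_add, map_mul, map_mul, ofPowerSeries_homog g (natDegree_resPoly_le γ h n)]
    have h2 := single_mul_ofPowerSeries_X (A := A)
    set ζ := HahnSeries.ofPowerSeries ℤ A PowerSeries.X with hζ
    have h3 : ∑ k ∈ Finset.range (n + 2), HahnSeries.ofPowerSeries ℤ A
        (PowerSeries.C (PowerSeries.coeff k g) * PowerSeries.X ^ k
          * homog g (n + 1 - k) (resPoly γ h (n + 1 - k)))
        = ζ ^ (n + 1) * ∑ k ∈ Finset.range (n + 2), HahnSeries.ofPowerSeries ℤ A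
          (PowerSeries.C (PowerSeries.coeff k g)) * laurentEval g (resPoly γ h (n + 1 - k)) := by
      rw [Finset.mul_sum]
      refine Finset.sum_congr rfl fun k hk => ?_
      have hk' := Finset.mem_range.1 hk
      rw [map_mul, map_mul, map_pow, ofPowerSeries_homog g (natDegree_resPoly_le γ h _), ← hζ]
      obtain ⟨m, hm⟩ : ∃ m, n + 1 = m + k := ⟨n + 1 - k, by omega⟩
      rw [hm, Nat.add_sub_cancel, pow_add]; ring
    rw [h3, h1, map_pow, ← hζ]
    linear_combination (ζ ^ n * (HahnSeries.ofPowerSeries ℤ A) g * (laurentEval g) (resPoly γ h n))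
      * h2

end Residue

/-! ### The residue pairing of the polynomials `φ_n` -/

section Metric

variable {A : Type*} [CommRing A]

/-- For `x = g/z` this is the vanishing residue of the exact form `x^k dx`: up to the factor `k +
1`, the series is `(k + 1) g^(k+1) - z (g^(k+1))'`. -/
theorem coeff_sub_derivative_mul_pow [IsDomain A] [CharZero A] (g : PowerSeries A) (k : ℕ) :
    PowerSeries.coeff (k + 1) ((g - PowerSeries.X * PowerSeries.derivative A g) * g ^ k) = 0 := by
  have h : ((k : PowerSeries A) + 1)
      * ((g - PowerSeries.X * PowerSeries.derivative A g) * g ^ k)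
      = ((k : PowerSeries A) + 1) * g ^ (k + 1)
        - PowerSeries.X * PowerSeries.derivative A (g ^ (k + 1)) := by
    rw [Derivation.leibniz_pow, smul_eq_mul, nsmul_eq_mul, Nat.add_sub_cancel]
    push_cast; ring
  have h2 := congrArg (PowerSeries.coeff (k + 1)) h
  have hc : ((k : PowerSeries A) + 1) = PowerSeries.C ((k : A) + 1) := by simp
  rw [hc, map_sub, PowerSeries.coeff_C_mul, PowerSeries.coeff_C_mul,
    PowerSeries.coeff_succ_X_mul, PowerSeries.coeff_derivative] at h2
  have h3 : ((k : A) + 1) ≠ 0 := by exact_mod_cast Nat.succ_ne_zero k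
  refine (mul_eq_zero.1 (?_ : ((k : A) + 1) * _ = 0)).resolve_left h3
  rw [h2]; ring

theorem coeff_sub_derivative_mul_homog [IsDomain A] [CharZero A] (g : PowerSeries A) (d : ℕ)
    (P : Polynomial A) :
    PowerSeries.coeff (d + 1)
      ((g - PowerSeries.X * PowerSeries.derivative A g) * homog g d P) = 0 := by
  rw [homog, Finset.mul_sum, map_sum]
  refine Finset.sum_eq_zero fun k hk => ?_
  have hk' := Finset.mem_range.1 hk
  have : (g - PowerSeries.X * PowerSeries.derivative A g)
      * (PowerSeries.C (P.coeff k) * PowerSeries.X ^ (d - k) * g ^ k)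
      = PowerSeries.C (P.coeff k) * (PowerSeries.X ^ (d - k)
        * ((g - PowerSeries.X * PowerSeries.derivative A g) * g ^ k)) := by ring
  rw [this, PowerSeries.coeff_C_mul, PowerSeries.coeff_X_pow_mul', if_pos (by omega)]
  have e : d + 1 - (d - k) = k + 1 := by omega
  rw [e, coeff_sub_derivative_mul_pow, mul_zero]

theorem laurentEval_X (g : PowerSeries A) :
    HahnSeries.ofPowerSeries ℤ A PowerSeries.X * laurentEval g Polynomial.X
      = HahnSeries.ofPowerSeries ℤ A g := by
  rw [laurentEval, Polynomial.coe_eval₂RingHom, Polynomial.eval₂_X]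
  linear_combination (HahnSeries.ofPowerSeries ℤ A g) * single_mul_ofPowerSeries_X (A := A)

theorem constantCoeff_homog (g : PowerSeries A) (hg : PowerSeries.constantCoeff g = 1) (d : ℕ)
    (P : Polynomial A) : PowerSeries.constantCoeff (homog g d P) = P.coeff d := by
  rw [homog, Finset.sum_range_succ, map_add, map_sum, Finset.sum_eq_zero]
  · simp [hg]
  · intro k hk
    have hk' := Finset.mem_range.1 hk
    have : d - k ≠ 0 := by omega
    simp [this]

/-- In the expansion at infinity the remainder of `φ_a φ_b` modulo `x ψ_{m+1}` has the leading
coefficient of a residue pairing. -/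
theorem coeff_resPoly_mul_modByMonic [IsDomain A] [CharZero A] {f e : PowerSeries A}
    (hfe : f * e = 1) (hf : PowerSeries.constantCoeff f = 1) {m a b : ℕ} (ha : a ≤ m + 1)
    (hb : b ≤ m + 1) :
    ((resPoly (e ^ 2) f a * resPoly (e ^ 2) f b) %ₘ
      (Polynomial.X * resPoly (e ^ 2) 1 (m + 1))).coeff (m + 1)
      = if a + b = m + 1 then 1 else 0 := by
  have he : PowerSeries.constantCoeff e = 1 := by
    have := congrArg PowerSeries.constantCoeff hfe
    simpa [hf] using this
  have hγ : PowerSeries.constantCoeff (e ^ 2) = 1 := by simp [he]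
  have hgγ : f ^ 2 * e ^ 2 = 1 := by rw [← mul_pow, hfe, one_pow]
  have hg : PowerSeries.constantCoeff (f ^ 2) = 1 := by simp [hf]
  have hg0 : PowerSeries.coeff 0 (f ^ 2) = 1 := by simpa using hg
  have hQ : (Polynomial.X * resPoly (e ^ 2) 1 (m + 1)).Monic :=
    Polynomial.monic_X.mul (monic_resPoly hγ (map_one _) _)
  have hQd : (Polynomial.X * resPoly (e ^ 2) 1 (m + 1)).natDegree = m + 2 := by
    rw [Polynomial.natDegree_X_mul (monic_resPoly hγ (map_one _) _).ne_zero]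
    refine congrArg (· + 1)
      (le_antisymm (natDegree_resPoly_le _ _ _) (Polynomial.le_natDegree_of_ne_zero ?_))
    rw [coeff_resPoly_self hγ (map_one _)]; exact one_ne_zero
  set P := resPoly (e ^ 2) f a * resPoly (e ^ 2) f b with hP
  set ψ := resPoly (e ^ 2) 1 (m + 1) with hψ
  have hPd : P.natDegree ≤ 2 * m + 2 := by
    refine Polynomial.natDegree_mul_le.trans ?_
    have h1 := natDegree_resPoly_le (e ^ 2) f a
    have h2 := natDegree_resPoly_le (e ^ 2) f b
    omega
  have hqd : (P /ₘ (Polynomial.X * ψ)).natDegree ≤ m := by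
    rw [Polynomial.natDegree_divByMonic _ hQ, hQd]; omega
  have hrd : (P %ₘ (Polynomial.X * ψ)).natDegree ≤ m + 1 := by
    have := Polynomial.natDegree_modByMonic_lt P hQ (by
      intro h; rw [h, Polynomial.natDegree_one] at hQd; omega)
    omega
  have hdiv := Polynomial.modByMonic_add_div P (Polynomial.X * ψ)
  set q := P /ₘ (Polynomial.X * ψ) with hq
  set r := P %ₘ (Polynomial.X * ψ) with hr
  -- The division `φ_a φ_b = xψ q + r` at `x = f²/z`, multiplied by `z^(2m+2)`.
  have hmain : PowerSeries.X ^ (2 * m + 2 - a - b) * homog (f ^ 2) a (resPoly (e ^ 2) f a)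
        * homog (f ^ 2) b (resPoly (e ^ 2) f b)
      = f ^ 2 * homog (f ^ 2) (m + 1) ψ * homog (f ^ 2) m q
        + PowerSeries.X ^ (m + 1) * homog (f ^ 2) (m + 1) r := by
    apply HahnSeries.ofPowerSeries_injective (Γ := ℤ) (R := A)
    have h1 := congrArg (laurentEval (f ^ 2)) hdiv
    rw [hP, map_add, map_mul, map_mul, map_mul] at h1
    rw [map_add, map_mul, map_mul, map_mul, map_mul, map_mul, map_pow, map_pow _ PowerSeries.X,
      ofPowerSeries_homog _ (natDegree_resPoly_le _ _ _),
      ofPowerSeries_homog _ (natDegree_resPoly_le _ _ _),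
      ofPowerSeries_homog _ (natDegree_resPoly_le _ _ _), ofPowerSeries_homog _ hqd,
      ofPowerSeries_homog _ hrd, ← laurentEval_X (f ^ 2)]
    set ζ := HahnSeries.ofPowerSeries ℤ A PowerSeries.X
    have e1 : ζ ^ (2 * m + 2) = ζ ^ (2 * m + 2 - a - b) * ζ ^ a * ζ ^ b := by
      rw [← pow_add, ← pow_add]; congr 1; omega
    rw [show 2 * m + 2 = (m + 1) + (m + 1) by ring, pow_add] at e1
    rw [show 2 * m + 2 = (m + 1) + (m + 1) by ring]
    have e2 : ζ ^ (m + 1) = ζ ^ m * ζ := pow_succ _ _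
    linear_combination (-ζ ^ (m + 1) * ζ ^ (m + 1)) * h1
      - (laurentEval (f ^ 2) (resPoly (e ^ 2) f a) * laurentEval (f ^ 2) (resPoly (e ^ 2) f b)) * e1
      + (ζ ^ (m + 1) * (laurentEval (f ^ 2) Polynomial.X * laurentEval (f ^ 2) ψ
        * laurentEval (f ^ 2) q)) * e2
  have hpa := (isResidueSequence_homog hgγ hγ f).X_pow_dvd_mul_sub hg0 a
  have hpb := (isResidueSequence_homog hgγ hγ f).X_pow_dvd_mul_sub hg0 b
  have hpψ := (isResidueSequence_homog hgγ hγ 1).X_pow_dvd_mul_sub hg0 (m + 1)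
  have hu := coeff_sub_derivative_mul_homog (f ^ 2) m q
  have hr0 := constantCoeff_homog (f ^ 2) hg (m + 1) r
  simp only [← hψ] at hpψ
  set u := f ^ 2 - PowerSeries.X * PowerSeries.derivative A (f ^ 2) with hudef
  have hu0 : PowerSeries.constantCoeff u = 1 := by simp [hudef, hf]
  set pa := homog (f ^ 2) a (resPoly (e ^ 2) f a)
  set pb := homog (f ^ 2) b (resPoly (e ^ 2) f b)
  set pψ := homog (f ^ 2) (m + 1) ψ
  set qh := homog (f ^ 2) m q
  set rh := homog (f ^ 2) (m + 1) r
  -- Multiply `hmain` by `e² u²` and use `u pa ≈ f`, `u pb ≈ f`, `u pψ ≈ 1`. In the coefficient of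
  -- `z^(m+1)` the quotient drops out by exactness (`hu`), and the remainder contributes its
  -- coefficient of `x^(m+1)`.
  have hdvd : (PowerSeries.X : PowerSeries A) ^ (m + 2) ∣
      PowerSeries.X ^ (2 * m + 2 - a - b)
        - (u * qh + PowerSeries.X ^ (m + 1) * (e ^ 2 * u ^ 2 * rh)) := by
    have key : PowerSeries.X ^ (2 * m + 2 - a - b)
        - (u * qh + PowerSeries.X ^ (m + 1) * (e ^ 2 * u ^ 2 * rh))
        = (u * pψ - 1) * (u * qh)
          - e ^ 2 * (PowerSeries.X ^ (2 * m + 2 - a - b) * ((u * pa - f) * (u * pb)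
            + f * (u * pb - f))) := by
      linear_combination (e ^ 2 * u ^ 2) * hmain
        + (u ^ 2 * pψ * qh - PowerSeries.X ^ (2 * m + 2 - a - b)) * hgγ
    rw [key]
    refine dvd_sub (Dvd.dvd.mul_right hpψ _) (Dvd.dvd.mul_left ?_ _)
    rw [mul_add]
    refine dvd_add ?_ ?_
    · have := mul_dvd_mul (dvd_refl ((PowerSeries.X : PowerSeries A) ^ (2 * m + 2 - a - b)))
        (Dvd.dvd.mul_right hpa (u * pb))
      rw [← pow_add] at this
      exact (pow_dvd_pow _ (by omega)).trans this
    · have := mul_dvd_mul (dvd_refl ((PowerSeries.X : PowerSeries A) ^ (2 * m + 2 - a - b)))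
        (Dvd.dvd.mul_left hpb f)
      rw [← pow_add] at this
      exact (pow_dvd_pow _ (by omega)).trans this
  have hcoef := PowerSeries.X_pow_dvd_iff.1 hdvd (m + 1) (by omega)
  rw [map_sub, map_add, hu, PowerSeries.coeff_X_pow_mul', if_pos le_rfl, Nat.sub_self,
    PowerSeries.coeff_X_pow] at hcoef
  have hlast : PowerSeries.coeff 0 (e ^ 2 * u ^ 2 * rh) = r.coeff (m + 1) := by
    simp [he, hu0, hr0]
  rw [hlast, zero_add, sub_eq_zero] at hcoef
  rw [← hcoef]
  congr 1
  apply propext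
  omega

/-- From `P = Qq + r` follows `xP = (xQ + κ) q + (xr - κq)`, and `q` has degree at most `m`. With `κ
= v_N²/4` this makes the pairing of the `φ_n` independent of `v_N`. -/
theorem coeff_X_mul_modByMonic [Nontrivial A] {Q : Polynomial A} (hQ : Q.Monic) {m : ℕ}
    (hQd : Q.natDegree = m + 2) (κ : A) {P : Polynomial A} (hP : P.natDegree ≤ 2 * m + 2) :
    ((Polynomial.X * P) %ₘ (Polynomial.X * Q + Polynomial.C κ)).coeff (m + 2)
      = (P %ₘ Q).coeff (m + 1) := by
  have hqd : (P /ₘ Q).natDegree ≤ m := by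
    rw [Polynomial.natDegree_divByMonic _ hQ, hQd]; omega
  have hrd : (P %ₘ Q).degree < (m + 2 : ℕ) := by
    have := Polynomial.degree_modByMonic_lt P hQ
    rwa [Polynomial.degree_eq_natDegree hQ.ne_zero, hQd] at this
  have hdiv := Polynomial.modByMonic_add_div P Q
  have hXQd : (Polynomial.X * Q).natDegree = m + 3 := by
    rw [Polynomial.natDegree_X_mul hQ.ne_zero, hQd]
  have hXQ : (Polynomial.X * Q).Monic := Polynomial.monic_X.mul hQ
  have hWlt : (Polynomial.C κ).degree < (Polynomial.X * Q).degree := by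
    rw [Polynomial.degree_eq_natDegree hXQ.ne_zero, hXQd]
    exact lt_of_le_of_lt Polynomial.degree_C_le (by exact_mod_cast Nat.succ_pos _)
  have hW : (Polynomial.X * Q + Polynomial.C κ).Monic := hXQ.add_of_left hWlt
  have hWd : (Polynomial.X * Q + Polynomial.C κ).degree = ((m + 3 : ℕ) : WithBot ℕ) := by
    rw [Polynomial.degree_add_eq_left_of_degree_lt hWlt,
      Polynomial.degree_eq_natDegree hXQ.ne_zero, hXQd]
  have := (Polynomial.div_modByMonic_unique (f := Polynomial.X * P) (P /ₘ Q)
    (Polynomial.X * (P %ₘ Q) - Polynomial.C κ * (P /ₘ Q)) hW ⟨?_, ?_⟩).2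
  · rw [this, Polynomial.coeff_sub, Polynomial.coeff_X_mul, Polynomial.coeff_C_mul,
      Polynomial.coeff_eq_zero_of_natDegree_lt (p := P /ₘ Q) (by omega), mul_zero, sub_zero]
  · linear_combination Polynomial.X * hdiv
  · rw [hWd, Polynomial.degree_lt_iff_coeff_zero]
    intro k hk
    obtain ⟨k, rfl⟩ : ∃ l, k = l + 1 := ⟨k - 1, by omega⟩
    rw [Polynomial.coeff_sub, Polynomial.coeff_X_mul, Polynomial.coeff_C_mul,
      Polynomial.coeff_eq_zero_of_natDegree_lt (p := P /ₘ Q) (by omega),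
      (Polynomial.degree_lt_iff_coeff_zero _ _).1 hrd k (by omega), mul_zero, sub_zero]

end Metric

/-! ### Flat coordinates from the series `f` -/

section FlatCoordinates

/-- The extension of a derivation to power series, coefficient by coefficient. -/
noncomputable def seriesDerivation {k A : Type*} [CommRing k] [CommRing A] [Algebra k A]
    (δ : Derivation k A A) : Derivation k (PowerSeries A) (PowerSeries A) :=
  Derivation.mk'
    { toFun := fun h => PowerSeries.mk fun n => δ (PowerSeries.coeff n h)
      map_add' := fun a b => by ext n; simp
      map_smul' := fun c a => by ext n; simp }
    (by
      intro a b
      ext n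
      simp only [LinearMap.coe_mk, AddHom.coe_mk, PowerSeries.coeff_mk, smul_eq_mul, map_add,
        PowerSeries.coeff_mul, map_sum, Derivation.leibniz, Finset.sum_add_distrib]
      congr 1
      rw [← Finset.Nat.sum_antidiagonal_swap]
      refine Finset.sum_congr rfl fun p _ => ?_
      simp)

theorem coeff_seriesDerivation {k A : Type*} [CommRing k] [CommRing A] [Algebra k A]
    (δ : Derivation k A A) (h : PowerSeries A) (n : ℕ) :
    PowerSeries.coeff n (seriesDerivation δ h) = δ (PowerSeries.coeff n h) := by
  simp [seriesDerivation]

theorem seriesDerivation_X {k A : Type*} [CommRing k] [CommRing A] [Algebra k A]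
    (δ : Derivation k A A) : seriesDerivation δ PowerSeries.X = 0 := by
  ext n
  rw [coeff_seriesDerivation, PowerSeries.coeff_X]
  split_ifs <;> simp

theorem seriesDerivation_derivative {k A : Type*} [CommRing k] [CommRing A] [Algebra k A]
    (δ : Derivation k A A) (h : PowerSeries A) :
    seriesDerivation δ (PowerSeries.derivative A h)
      = PowerSeries.derivative A (seriesDerivation δ h) := by
  ext n
  rw [coeff_seriesDerivation, PowerSeries.coeff_derivative, PowerSeries.coeff_derivative,
    coeff_seriesDerivation]
  have : PowerSeries.coeff (n + 1) h * ((n : A) + 1) = (n + 1) • PowerSeries.coeff (n + 1) h := by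
    rw [nsmul_eq_mul]; push_cast; ring
  rw [this, map_nsmul, nsmul_eq_mul]; push_cast; ring

/-- The series `1 - (1/2) ∑_{j ≥ 1} s_j z ^ j`. -/
noncomputable def univF : PowerSeries (MvPolynomial ℕ ℚ) :=
  PowerSeries.mk fun n => if n = 0 then 1 else C (-1 / 2) * X n

/-- The inverse of `univF`. -/
noncomputable def univE : PowerSeries (MvPolynomial ℕ ℚ) := PowerSeries.invOfUnit univF 1

theorem constantCoeff_univF : PowerSeries.constantCoeff univF = 1 := by
  rw [← PowerSeries.coeff_zero_eq_constantCoeff_apply, univF, PowerSeries.coeff_mk, if_pos rfl]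

theorem univF_mul_univE : univF * univE = 1 :=
  PowerSeries.mul_invOfUnit _ _ (by rw [constantCoeff_univF]; rfl)

/-- The substitution `s_j = t_{N-j}` for `1 ≤ j < N` and `s_j = 0` for the other `j`. -/
noncomputable def toFlat (N : ℕ) : MvPolynomial ℕ ℚ →+* MvPolynomial ℕ ℚ :=
  (aeval fun j => if 1 ≤ j ∧ j < N then X (N - j) else 0 :
    MvPolynomial ℕ ℚ →ₐ[ℚ] MvPolynomial ℕ ℚ).toRingHom

/-- The series `1 - (1/2) ∑_{1 ≤ j < N} t_{N-j} z ^ j`. -/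
noncomputable def flatF (N : ℕ) : PowerSeries (MvPolynomial ℕ ℚ) :=
  PowerSeries.map (toFlat N) univF

/-- The inverse of `flatF N`. -/
noncomputable def flatE (N : ℕ) : PowerSeries (MvPolynomial ℕ ℚ) :=
  PowerSeries.map (toFlat N) univE

theorem flatF_mul_flatE (N : ℕ) : flatF N * flatE N = 1 := by
  rw [flatF, flatE, ← map_mul, univF_mul_univE, map_one]

theorem constantCoeff_flatF (N : ℕ) : PowerSeries.constantCoeff (flatF N) = 1 := by
  rw [← PowerSeries.coeff_zero_eq_constantCoeff_apply, flatF, PowerSeries.coeff_map,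
    PowerSeries.coeff_zero_eq_constantCoeff_apply, constantCoeff_univF, map_one]

theorem constantCoeff_flatE (N : ℕ) : PowerSeries.constantCoeff (flatE N) = 1 := by
  have := congrArg PowerSeries.constantCoeff (flatF_mul_flatE N)
  simpa [constantCoeff_flatF] using this

theorem coeff_flatF (N n : ℕ) : PowerSeries.coeff n (flatF N)
    = if n = 0 then 1 else if n < N then C (-1 / 2) * X (N - n) else 0 := by
  rw [flatF, PowerSeries.coeff_map, univF, PowerSeries.coeff_mk]
  rcases Nat.eq_zero_or_pos n with rfl | hn
  · simp
  · rw [if_neg hn.ne', if_neg hn.ne', map_mul]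
    have h1 : toFlat N (X n) = if 1 ≤ n ∧ n < N then X (N - n) else 0 := by simp [toFlat]
    have h2 : toFlat N (C (-1 / 2)) = C (-1 / 2) := by
      simp only [toFlat, AlgHom.toRingHom_eq_coe, RingHom.coe_coe, algHom_C, algebraMap_eq]
    rw [h1, h2]
    by_cases h : n < N
    · rw [if_pos h, if_pos ⟨hn, h⟩]
    · rw [if_neg h, if_neg (by omega), mul_zero]

theorem seriesDerivation_flatF {N i : ℕ} (hi : 1 ≤ i) (hiN : i < N) :
    seriesDerivation (pderiv i) (flatF N)
      = PowerSeries.C (C (-1 / 2)) * PowerSeries.X ^ (N - i) := by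
  ext1 n
  rw [coeff_seriesDerivation, coeff_flatF, PowerSeries.coeff_C_mul_X_pow]
  split_ifs with h1 h2 h3 h4 h5
  · omega
  · simp
  · rw [pderiv_C_mul, show N - n = i by omega, pderiv_X_self, mul_one]
  · rw [pderiv_C_mul, pderiv_X_of_ne (by omega), mul_zero]
  · omega
  · simp

theorem seriesDerivation_flatF_eq_zero {N i : ℕ} (hi : i = 0 ∨ N ≤ i) :
    seriesDerivation (pderiv i) (flatF N) = 0 := by
  ext1 n
  rw [coeff_seriesDerivation, coeff_flatF, map_zero]
  split_ifs with h1 h2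
  · simp
  · rw [pderiv_C_mul, pderiv_X_of_ne (by omega), mul_zero]
  · simp

theorem seriesDerivation_flatE (N i : ℕ) : seriesDerivation (pderiv i) (flatE N)
    = -(flatE N ^ 2 * seriesDerivation (pderiv i) (flatF N)) := by
  rw [Derivation.leibniz_of_mul_eq_one (seriesDerivation (pderiv i))
    ((mul_comm _ _).trans (flatF_mul_flatE N)), smul_eq_mul, neg_mul]

/-- `∂Λ/∂t_{n+1}`, a polynomial in `x` of degree `n`. -/
noncomputable def flatPhi (N n : ℕ) : Polynomial (MvPolynomial ℕ ℚ) :=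
  resPoly (flatE N ^ 2) (flatF N) n

/-- For `n = N - 2`, the derivative with respect to `x` of the part of `Λ` without `y`. -/
noncomputable def flatPsi (N n : ℕ) : Polynomial (MvPolynomial ℕ ℚ) :=
  resPoly (flatE N ^ 2) 1 n

theorem coeff_flatPhi (N n k : ℕ) : (flatPhi N n).coeff k
    = if k ≤ n then PowerSeries.coeff (n - k) (flatE N ^ (2 * k + 1)) else 0 := by
  rw [flatPhi, coeff_resPoly]
  congr 2
  rw [← pow_mul, show 2 * (k + 1) = (2 * k + 1) + 1 by ring, pow_succ]
  linear_combination (flatE N ^ (2 * k + 1)) * flatF_mul_flatE N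

/-- The unfolding coordinate `v_k`, `1 ≤ k < N`, as a polynomial in the flat coordinates. -/
noncomputable def vFlat (N k : ℕ) : MvPolynomial ℕ ℚ :=
  if k = 1 then C (-2 / ((N : ℚ) - 1))
    * PowerSeries.coeff (N - 1) (PowerSeries.X * (PowerSeries.derivative _ (flatF N) * flatE N))
  else C (1 / ((k : ℚ) - 1)) * PowerSeries.coeff (N - k) (flatE N ^ (2 * (k - 1)))

theorem C_mul_vFlat {N k : ℕ} (hk : 2 ≤ k) (hkN : k ≤ N) :
    C ((k : ℚ) - 1) * vFlat N k = (flatPsi N (N - 2)).coeff (k - 2) := by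
  have hk0 : (k : ℚ) - 1 ≠ 0 := by
    have : (2 : ℚ) ≤ k := by exact_mod_cast hk
    linarith
  rw [vFlat, if_neg (by omega), ← mul_assoc, ← C_mul, mul_one_div_cancel hk0, C_1, one_mul,
    flatPsi, coeff_resPoly, if_pos (by omega), one_mul, ← pow_mul,
    show N - 2 - (k - 2) = N - k by omega, show k - 2 + 1 = k - 1 by omega]

theorem pderiv_vFlat_eq_zero {N i : ℕ} (hi : i = 0 ∨ N ≤ i) (k : ℕ) :
    pderiv i (vFlat N k) = 0 := by
  have hE : seriesDerivation (pderiv i) (flatE N) = 0 := by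
    rw [seriesDerivation_flatE, seriesDerivation_flatF_eq_zero hi, mul_zero, neg_zero]
  rw [vFlat]
  split_ifs with h
  · rw [pderiv_C_mul, ← coeff_seriesDerivation]
    simp only [Derivation.leibniz, seriesDerivation_X, seriesDerivation_derivative, hE,
      seriesDerivation_flatF_eq_zero hi, smul_zero, map_zero, add_zero, mul_zero]
  · rw [pderiv_C_mul, ← coeff_seriesDerivation, Derivation.leibniz_pow, hE]
    simp

/-- Since `∂f/∂t_i = -z^(N-i)/2`, its inverse `e` satisfies `∂e/∂t_i = z^(N-i) e²/2`, so
`e^(2(k-1))/(k-1)` has derivative `z^(N-i) e^(2k-1)`. The case `k = 1` is the logarithmic limit: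
`vFlat N 1` is the coefficient of `z^(N-1)` in `-2 log f`, written through `z f'/f` to stay within
power series. -/
theorem pderiv_vFlat {N i k : ℕ} (hi : 1 ≤ i) (hiN : i < N) (hk : 1 ≤ k) (hkN : k < N) :
    pderiv i (vFlat N k) = (flatPhi N (i - 1)).coeff (k - 1) := by
  have hF := seriesDerivation_flatF hi hiN
  have hE : seriesDerivation (pderiv i) (flatE N)
      = PowerSeries.C (C (1 / 2)) * (PowerSeries.X ^ (N - i) * flatE N ^ 2) := by
    rw [seriesDerivation_flatE, hF]
    have : (C (-1 / 2) : MvPolynomial ℕ ℚ) = - C (1 / 2) := by rw [← C_neg]; congr 1; ring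
    rw [this, map_neg]; ring
  rw [coeff_flatPhi, vFlat]
  split_ifs with h1 h2 h2
  · subst h1
    rw [pderiv_C_mul, ← coeff_seriesDerivation]
    -- The derivation commutes with `d/dz`, so `z f'/f` goes to `z d/dz` of `(∂f/∂t_i)/f`. In degree
    -- `N - 1` the operator `z d/dz` is multiplication by `N - 1`, which cancels the denominator of
    -- `vFlat N 1`.
    have hd : seriesDerivation (pderiv i)
        (PowerSeries.X * (PowerSeries.derivative _ (flatF N) * flatE N))
        = PowerSeries.C (C (-1 / 2)) * (PowerSeries.X *
          PowerSeries.derivative _ (PowerSeries.X ^ (N - i) * flatE N)) := by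
      have hE' : PowerSeries.derivative _ (flatE N)
          = -(flatE N ^ 2 * PowerSeries.derivative _ (flatF N)) := by
        rw [Derivation.leibniz_of_mul_eq_one (PowerSeries.derivative _)
          ((mul_comm _ _).trans (flatF_mul_flatE N)), smul_eq_mul, neg_mul]
      rw [Derivation.leibniz, Derivation.leibniz, seriesDerivation_X, seriesDerivation_derivative,
        hF, hE, Derivation.leibniz, Derivation.leibniz, hE', PowerSeries.derivative_C]
      have : (C (-1 / 2) : MvPolynomial ℕ ℚ) = - C (1 / 2) := by rw [← C_neg]; congr 1; ring
      rw [this]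
      simp only [smul_eq_mul, map_neg]
      ring
    rw [hd, PowerSeries.coeff_C_mul]
    obtain ⟨M, rfl⟩ : ∃ M, N = M + 1 := ⟨N - 1, by omega⟩
    rw [Nat.add_sub_cancel]
    obtain ⟨M, rfl⟩ : ∃ M', M = M' + 1 := ⟨M - 1, by omega⟩
    rw [PowerSeries.coeff_succ_X_mul, PowerSeries.coeff_derivative, PowerSeries.coeff_X_pow_mul',
      if_pos (by omega)]
    have hM : (((M + 1 + 1 : ℕ) : ℚ) - 1) ≠ 0 := by
      rw [show (((M + 1 + 1 : ℕ) : ℚ) - 1) = (M : ℚ) + 1 by push_cast; ring]; positivity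
    have e1 : M + 1 - (M + 1 + 1 - i) = i - 1 - (1 - 1) := by omega
    rw [e1]
    have e2 : (M : MvPolynomial ℕ ℚ) + 1 = C (((M + 1 + 1 : ℕ) : ℚ) - 1) := by
      push_cast; simp
    have e3 : (C (-2 / (((M + 1 + 1 : ℕ) : ℚ) - 1)) : MvPolynomial ℕ ℚ) * C (-1 / 2)
        * C (((M + 1 + 1 : ℕ) : ℚ) - 1) = 1 := by
      rw [← C_mul, ← C_mul, ← C_1]; congr 1; field_simp
    rw [e2]
    simp only [Nat.sub_self, mul_zero, zero_add, pow_one]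
    linear_combination PowerSeries.coeff (i - 1 - 0) (flatE (M + 1 + 1)) * e3
  · omega
  all_goals
    rw [pderiv_C_mul, ← coeff_seriesDerivation, Derivation.leibniz_pow, hE]
    have hk0 : (k : ℚ) - 1 ≠ 0 := by
      have : (2 : ℚ) ≤ k := by exact_mod_cast (by omega : 2 ≤ k)
      linarith
    obtain ⟨m, rfl⟩ : ∃ m, k = m + 2 := ⟨k - 2, by omega⟩
    have e1 : (2 * (m + 2 - 1)) • flatE N ^ (2 * (m + 2 - 1) - 1) • (PowerSeries.C (C (1 / 2))
        * (PowerSeries.X ^ (N - i) * flatE N ^ 2))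
        = PowerSeries.C (C (((m + 2 : ℕ) : ℚ) - 1))
          * (PowerSeries.X ^ (N - i) * flatE N ^ (2 * (m + 2 - 1) + 1)) := by
      have : PowerSeries.C (C (((m + 2 : ℕ) : ℚ) - 1)) = ((2 * (m + 2 - 1) : ℕ) :
          PowerSeries (MvPolynomial ℕ ℚ)) * PowerSeries.C (C (1 / 2)) := by
        rw [← map_natCast (PowerSeries.C (R := MvPolynomial ℕ ℚ)), ← map_mul,
          ← map_natCast (C (σ := ℕ) (R := ℚ)), ← C_mul]
        congr 2
        push_cast [show m + 2 - 1 = m + 1 by omega]; ring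
      rw [this, nsmul_eq_mul, smul_eq_mul,
        show 2 * (m + 2 - 1) + 1 = (2 * (m + 2 - 1) - 1) + 2 by omega, pow_add]
      ring
    rw [e1, PowerSeries.coeff_C_mul, ← mul_assoc, ← C_mul, one_div_mul_cancel hk0, C_1, one_mul,
      PowerSeries.coeff_X_pow_mul']
  · rw [if_pos (by omega)]
    congr 2; omega
  · rw [if_neg (by omega)]

theorem map_constantCoeff_flatF (N : ℕ) :
    PowerSeries.map (constantCoeff (σ := ℕ) (R := ℚ)) (flatF N) = 1 := by
  ext n
  rw [PowerSeries.coeff_map, coeff_flatF, PowerSeries.coeff_one]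
  split_ifs <;> simp

theorem map_constantCoeff_flatE (N : ℕ) :
    PowerSeries.map (constantCoeff (σ := ℕ) (R := ℚ)) (flatE N) = 1 := by
  have := congrArg (PowerSeries.map (constantCoeff (σ := ℕ) (R := ℚ))) (flatF_mul_flatE N)
  rwa [map_mul, map_constantCoeff_flatF, one_mul, map_one] at this

theorem constantCoeff_coeff_flatPhi (N n k : ℕ) :
    constantCoeff ((flatPhi N n).coeff k) = if k = n then 1 else 0 := by
  rw [coeff_flatPhi, apply_ite constantCoeff, ← PowerSeries.coeff_map, map_pow,
    map_constantCoeff_flatE, one_pow, PowerSeries.coeff_one, map_zero]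
  split_ifs <;> first | rfl | omega

theorem constantCoeff_vFlat {N k : ℕ} (hkN : k < N) : constantCoeff (vFlat N k) = 0 := by
  rw [vFlat]
  split_ifs with h
  · rw [map_mul]
    obtain ⟨M, hM⟩ : ∃ M, N - 1 = M + 1 := ⟨N - 2, by omega⟩
    rw [hM, PowerSeries.coeff_succ_X_mul, ← PowerSeries.coeff_map, map_mul,
      map_constantCoeff_flatE, mul_one, PowerSeries.coeff_map, PowerSeries.coeff_derivative,
      map_mul, ← PowerSeries.coeff_map, map_constantCoeff_flatF, PowerSeries.coeff_one]
    simp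
  · rw [map_mul, ← PowerSeries.coeff_map, map_pow, map_constantCoeff_flatE, one_pow,
      PowerSeries.coeff_one, if_neg (by omega), mul_zero]

theorem vars_subset_of_pderiv_eq_zero {K : Type*} [Field K] [CharZero K] {s : Finset ℕ}
    {p : MvPolynomial ℕ K} (h : ∀ i ∉ s, pderiv i p = 0) : p.vars ⊆ s := by
  intro i hi
  by_contra his
  obtain ⟨d, hd, hid⟩ := (mem_vars_iff_mem_support i).1 hi
  have h1 := congrArg (coeff (d - Finsupp.single i 1)) (h i his)
  have hdi : 1 ≤ d i := Nat.one_le_iff_ne_zero.2 (Finsupp.mem_support_iff.1 hid)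
  rw [coeff_pderiv, coeff_zero, tsub_add_cancel_of_le (Finsupp.single_le_iff.2 hdi)] at h1
  rcases mul_eq_zero.1 h1 with h2 | h2
  · exact (mem_support_iff.1 hd) h2
  · exact absurd h2 (Nat.cast_add_one_ne_zero _)

theorem vars_vFlat {N : ℕ} (k : ℕ) : (vFlat N k).vars ⊆ Finset.Icc 1 (N - 1) := by
  refine vars_subset_of_pderiv_eq_zero fun i hi => pderiv_vFlat_eq_zero ?_ k
  rw [Finset.mem_Icc] at hi
  omega

end FlatCoordinates

/-! ### The residue functional after elimination of `y` -/

section Functional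

variable {K : Type*} [Field K]

/-- The polynomial `x ^ 2 ψ + c ^ 2 / 4`, the relation satisfied by `x` modulo `2 x y + c` and
`ψ + y ^ 2`. -/
noncomputable def relPoly (c : K) (ψ : Polynomial K) : Polynomial K :=
  Polynomial.X * (Polynomial.X * ψ) + Polynomial.C (c ^ 2 / 4)

/-- The class `y = 2 x ψ / c`. -/
noncomputable def yPoly (c : K) (ψ : Polynomial K) : Polynomial K :=
  Polynomial.C (2 / c) * (Polynomial.X * ψ)

/-- The residue functional on `K[x]`: the coefficient of `x ^ (n + 1)` of the remainder of `x P`. -/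
noncomputable def resFunctional (c : K) (ψ : Polynomial K) (n : ℕ) : Polynomial K →ₗ[K] K :=
  Polynomial.lcoeff K (n + 1) ∘ₗ Polynomial.modByMonicHom (relPoly c ψ)
    ∘ₗ LinearMap.mulLeft K Polynomial.X

theorem resFunctional_apply (c : K) (ψ P : Polynomial K) (n : ℕ) :
    resFunctional c ψ n P = ((Polynomial.X * P) %ₘ relPoly c ψ).coeff (n + 1) := rfl

variable {c : K} {ψ : Polynomial K} {n : ℕ}

theorem monic_relPoly (hψ : ψ.Monic) : (relPoly c ψ).Monic := by
  have h : (Polynomial.X * (Polynomial.X * ψ)).Monic :=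
    Polynomial.monic_X.mul (Polynomial.monic_X.mul hψ)
  refine h.add_of_left (lt_of_le_of_lt Polynomial.degree_C_le ?_)
  rw [← Polynomial.natDegree_pos_iff_degree_pos,
    Polynomial.natDegree_X_mul (Polynomial.monic_X.mul hψ).ne_zero]
  exact Nat.succ_pos _

theorem natDegree_relPoly (hψ : ψ.Monic) : (relPoly c ψ).natDegree = ψ.natDegree + 2 := by
  rw [relPoly, Polynomial.natDegree_add_C,
    Polynomial.natDegree_X_mul (Polynomial.monic_X.mul hψ).ne_zero,
    Polynomial.natDegree_X_mul hψ.ne_zero]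

theorem relPoly_dvd_of_xy (hc : c ≠ 0) [CharZero K] :
    relPoly c ψ ∣ 2 * (Polynomial.X * yPoly c ψ) + Polynomial.C c := by
  refine ⟨Polynomial.C (4 / c), ?_⟩
  have h1 : (Polynomial.C (4 / c) : Polynomial K) = 2 * Polynomial.C (2 / c) := by
    rw [← Polynomial.C_ofNat, ← Polynomial.C_mul]; congr 1; ring
  have h2 : Polynomial.C (c ^ 2 / 4) * Polynomial.C (4 / c) = (Polynomial.C c : Polynomial K) := by
    rw [← Polynomial.C_mul]; congr 1; field_simp
  rw [relPoly, yPoly, add_mul, h2, h1]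
  ring

theorem relPoly_dvd_of_yy (hc : c ≠ 0) [CharZero K] :
    relPoly c ψ ∣ ψ + yPoly c ψ ^ 2 := by
  refine ⟨Polynomial.C (4 / c ^ 2) * ψ, ?_⟩
  have h1 : (Polynomial.C (4 / c ^ 2) : Polynomial K) = Polynomial.C (2 / c) ^ 2 := by
    rw [← Polynomial.C_pow]; congr 1; ring
  have h2 : Polynomial.C (c ^ 2 / 4) * Polynomial.C (4 / c ^ 2) = (1 : Polynomial K) := by
    rw [← Polynomial.C_mul, ← Polynomial.C_1]; congr 1; field_simp
  rw [relPoly, yPoly]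
  linear_combination (-ψ) * h2 - (Polynomial.X * (Polynomial.X * ψ) * ψ) * h1

theorem resFunctional_congr (hψ : ψ.Monic) {P Q : Polynomial K} (h : relPoly c ψ ∣ P - Q) :
    resFunctional c ψ n P = resFunctional c ψ n Q := by
  rw [resFunctional_apply, resFunctional_apply]
  congr 1
  refine Polynomial.modByMonic_eq_of_dvd_sub (monic_relPoly hψ) ?_
  rw [← mul_sub]
  exact Dvd.dvd.mul_left h _

theorem resFunctional_C_mul (a : K) (P : Polynomial K) :
    resFunctional c ψ n (Polynomial.C a * P) = a * resFunctional c ψ n P := by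
  rw [← Polynomial.smul_eq_C_mul, map_smul, smul_eq_mul]

theorem resFunctional_of_natDegree_le (hψ : ψ.Monic) (hn : ψ.natDegree = n) {P : Polynomial K}
    (hP : P.natDegree ≤ n) : resFunctional c ψ n P = P.coeff n := by
  have h : (Polynomial.X * P) %ₘ relPoly c ψ = Polynomial.X * P := by
    rw [Polynomial.modByMonic_eq_self_iff (monic_relPoly hψ)]
    refine Polynomial.degree_lt_degree ?_
    rw [natDegree_relPoly hψ, hn]
    refine lt_of_le_of_lt Polynomial.natDegree_mul_le ?_
    rw [Polynomial.natDegree_X]; omega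
  rw [resFunctional_apply, h, Polynomial.coeff_X_mul]

theorem modByMonic_relPoly_of_natDegree_le (hψ : ψ.Monic) (hn : ψ.natDegree = n)
    {P : Polynomial K} (hP : P.natDegree ≤ n) : P %ₘ relPoly c ψ = P := by
  rw [Polynomial.modByMonic_eq_self_iff (monic_relPoly hψ)]
  refine Polynomial.degree_lt_degree ?_
  rw [natDegree_relPoly hψ, hn]; omega

variable [CharZero K]

/-- Modulo the relation `xy` is `-c/2`, so the factor `x` built into the functional absorbs `y`. -/
theorem resFunctional_mul_yPoly (hc : c ≠ 0) (hψ : ψ.Monic) (P : Polynomial K) :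
    resFunctional c ψ n (P * yPoly c ψ) = -(c / 2) * (P %ₘ relPoly c ψ).coeff (n + 1) := by
  rw [resFunctional_apply]
  have h : (Polynomial.X * (P * yPoly c ψ)) %ₘ relPoly c ψ
      = (-(c / 2)) • (P %ₘ relPoly c ψ) := by
    rw [← Polynomial.smul_modByMonic]
    refine Polynomial.modByMonic_eq_of_dvd_sub (monic_relPoly hψ) ?_
    obtain ⟨d, hd⟩ := relPoly_dvd_of_xy (ψ := ψ) hc
    refine ⟨Polynomial.C (1 / 2) * P * d, ?_⟩
    have h1 : (Polynomial.C (1 / 2) : Polynomial K) * 2 = 1 := by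
      rw [← Polynomial.C_ofNat, ← Polynomial.C_mul, ← Polynomial.C_1]; congr 1; norm_num
    have h2 : (Polynomial.C (-(c / 2)) : Polynomial K)
        = - (Polynomial.C (1 / 2) * Polynomial.C c) := by
      rw [← Polynomial.C_mul, ← Polynomial.C_neg]; congr 1; ring
    rw [Polynomial.smul_eq_C_mul, h2]
    linear_combination Polynomial.C (1 / 2) * P * hd - (Polynomial.X * P * yPoly c ψ) * h1
  rw [h, Polynomial.coeff_smul, smul_eq_mul]

theorem resFunctional_mul_yPoly_of_natDegree_le (hc : c ≠ 0) (hψ : ψ.Monic)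
    (hn : ψ.natDegree = n) {P : Polynomial K} (hP : P.natDegree ≤ n) :
    resFunctional c ψ n (P * yPoly c ψ) = 0 := by
  rw [resFunctional_mul_yPoly hc hψ, modByMonic_relPoly_of_natDegree_le hψ hn hP,
    Polynomial.coeff_eq_zero_of_natDegree_lt (by omega), mul_zero]

theorem resFunctional_yPoly (hc : c ≠ 0) (hψ : ψ.Monic) (hn : ψ.natDegree = n) :
    resFunctional c ψ n (yPoly c ψ) = 0 := by
  have := resFunctional_mul_yPoly_of_natDegree_le (n := n) hc hψ hn (P := 1) (by simp)
  rwa [one_mul] at this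

/-- Split `P = P(0) + x P₁` and use `y² ≡ -ψ`, `x y² ≡ -(c/2) y`. The first part contributes the
leading coefficient of `ψ`; the second is a low-degree multiple of `y`, on which the functional
vanishes. -/
theorem resFunctional_mul_yPoly_mul_yPoly (hc : c ≠ 0) (hψ : ψ.Monic) (hn : ψ.natDegree = n)
    {P : Polynomial K} (hP : P.natDegree ≤ n) :
    resFunctional c ψ n (P * yPoly c ψ * yPoly c ψ) = -P.coeff 0 := by
  have h1 : resFunctional c ψ n (P * yPoly c ψ * yPoly c ψ)
      = resFunctional c ψ n (Polynomial.C (-P.coeff 0) * ψ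
        + Polynomial.C (-(c / 2)) * (P.divX * yPoly c ψ)) := by
    refine resFunctional_congr hψ ?_
    obtain ⟨d, hd⟩ := relPoly_dvd_of_yy (ψ := ψ) hc
    obtain ⟨d', hd'⟩ := relPoly_dvd_of_xy (ψ := ψ) hc
    refine ⟨Polynomial.C (P.coeff 0) * d + Polynomial.C (1 / 2) * P.divX * yPoly c ψ * d', ?_⟩
    have h0 := Polynomial.divX_mul_X_add P
    have h1 : (Polynomial.C (1 / 2) : Polynomial K) * 2 = 1 := by
      rw [← Polynomial.C_ofNat, ← Polynomial.C_mul, ← Polynomial.C_1]; congr 1; norm_num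
    have h2 : (Polynomial.C (-(c / 2)) : Polynomial K)
        = -(Polynomial.C (1 / 2) * Polynomial.C c) := by
      rw [← Polynomial.C_mul, ← Polynomial.C_neg]; congr 1; ring
    rw [Polynomial.C_neg, h2]
    linear_combination (-yPoly c ψ ^ 2) * h0 + Polynomial.C (P.coeff 0) * hd
      + Polynomial.C (1 / 2) * P.divX * yPoly c ψ * hd'
      - P.divX * yPoly c ψ ^ 2 * Polynomial.X * h1
  rw [h1, map_add, resFunctional_C_mul, resFunctional_C_mul,
    resFunctional_of_natDegree_le hψ hn hn.le,
    resFunctional_mul_yPoly_of_natDegree_le hc hψ hn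
      ((Polynomial.natDegree_divX_le).trans hP)]
  have : ψ.coeff n = 1 := by rw [← hn]; exact hψ
  rw [this]; ring

/-- Here `y³ ≡ -ψ y`, and `ψ` still has degree at most `n`. -/
theorem resFunctional_yPoly_cube (hc : c ≠ 0) (hψ : ψ.Monic) (hn : ψ.natDegree = n) :
    resFunctional c ψ n (yPoly c ψ * yPoly c ψ * yPoly c ψ) = 0 := by
  have h1 : resFunctional c ψ n (yPoly c ψ * yPoly c ψ * yPoly c ψ)
      = resFunctional c ψ n (Polynomial.C (-1) * (ψ * yPoly c ψ)) := by
    refine resFunctional_congr hψ ?_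
    obtain ⟨d, hd⟩ := relPoly_dvd_of_yy (ψ := ψ) hc
    refine ⟨d * yPoly c ψ, ?_⟩
    rw [Polynomial.C_neg, Polynomial.C_1]
    linear_combination (yPoly c ψ) * hd
  rw [h1, resFunctional_C_mul, resFunctional_mul_yPoly_of_natDegree_le hc hψ hn hn.le, mul_zero]

end Functional

/-! ### Passage from the Jacobian ring to polynomials in `x` -/

section Transfer

/-- The inclusion of rational polynomials into complex polynomials. -/
noncomputable def ratMap : MvPolynomial ℕ ℚ →+* MvPolynomial ℕ ℂ := map (algebraMap ℚ ℂ)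

theorem ratMap_injective : Function.Injective ratMap :=
  map_injective _ (algebraMap ℚ ℂ).injective

theorem pderiv_ratMap (i : ℕ) (p : MvPolynomial ℕ ℚ) :
    pderiv i (ratMap p) = ratMap (pderiv i p) := pderiv_map

/-- The coordinates `v_1, …, v_N` as polynomials in `t_1, …, t_{N-1}, v_N`. -/
noncomputable def vCoord (N k : ℕ) : MvPolynomial ℕ ℂ :=
  if k = N then X N else ratMap (vFlat N k)

/-- The substitution of `vCoord N` for the coordinates `v`. -/
noncomputable def vSubst (N : ℕ) : MvPolynomial ℕ ℂ →ₐ[ℂ] MvPolynomial ℕ ℂ := aeval (vCoord N)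

theorem flatPsi_monic (N n : ℕ) : (flatPsi N n).Monic :=
  monic_resPoly (by simp [constantCoeff_flatE]) (map_one _) n

theorem natDegree_flatPsi (N n : ℕ) : (flatPsi N n).natDegree = n := by
  refine le_antisymm (natDegree_resPoly_le _ _ _) (Polynomial.le_natDegree_of_ne_zero ?_)
  rw [flatPsi, coeff_resPoly_self (by simp [constantCoeff_flatE]) (map_one _)]
  exact one_ne_zero

theorem natDegree_flatPhi_le (N n : ℕ) : (flatPhi N n).natDegree ≤ n := natDegree_resPoly_le _ _ _

theorem flatPsi_eq {N : ℕ} (hN : 2 ≤ N) : flatPsi N (N - 2) = Polynomial.X ^ (N - 2)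
    + ∑ k ∈ Finset.range (N - 2), Polynomial.C (C ((k : ℚ) + 1) * vFlat N (k + 2))
      * Polynomial.X ^ k := by
  conv_lhs => rw [(flatPsi N (N - 2)).as_sum_range_C_mul_X_pow, natDegree_flatPsi,
    Finset.sum_range_succ]
  have h1 : (flatPsi N (N - 2)).coeff (N - 2) = 1 := by
    have := flatPsi_monic N (N - 2)
    rwa [Polynomial.Monic, Polynomial.leadingCoeff, natDegree_flatPsi] at this
  rw [h1, Polynomial.C_1, one_mul, add_comm]
  congr 1
  refine Finset.sum_congr rfl fun k hk => ?_
  have hk' := Finset.mem_range.1 hk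
  have := C_mul_vFlat (N := N) (k := k + 2) (by omega) (by omega)
  rw [Nat.add_sub_cancel] at this
  rw [← this]
  push_cast
  congr 5; ring

/-- The field of fractions of the ring of polynomials in the flat coordinates. -/
abbrev FlatField : Type := FractionRing (MvPolynomial ℕ ℂ)

instance : CharZero FlatField :=
  charZero_of_injective_algebraMap (IsFractionRing.injective (MvPolynomial ℕ ℂ) FlatField)

/-- The inclusion of rational polynomials into the field of fractions. -/
noncomputable def ratField : MvPolynomial ℕ ℚ →+* FlatField :=
  (algebraMap (MvPolynomial ℕ ℂ) FlatField).comp ratMap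

/-- The derivative in `x` of the part of the unfolding without `y`, over the field of fractions. -/
noncomputable def psiField (N : ℕ) : Polynomial FlatField := (flatPsi N (N - 2)).map ratField

/-- The coordinate `v_N` in the field of fractions. -/
noncomputable def cField (N : ℕ) : FlatField := algebraMap (MvPolynomial ℕ ℂ) FlatField (X N)

theorem cField_ne_zero (N : ℕ) : cField N ≠ 0 := by
  rw [cField, Ne, FaithfulSMul.algebraMap_eq_zero_iff]
  exact X_ne_zero N

theorem psiField_monic (N : ℕ) : (psiField N).Monic := (flatPsi_monic N _).map _

theorem natDegree_psiField (N : ℕ) : (psiField N).natDegree = N - 2 := by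
  rw [psiField, (flatPsi_monic N _).natDegree_map, natDegree_flatPsi]

/-- The coefficients of polynomials in `x, y`, mapped to the field of fractions. -/
noncomputable def coeffMap (N : ℕ) : MvPolynomial ℕ ℂ →+* FlatField :=
  (algebraMap (MvPolynomial ℕ ℂ) FlatField).comp (vSubst N).toRingHom

theorem coeffMap_apply (N : ℕ) (p : MvPolynomial ℕ ℂ) :
    coeffMap N p = algebraMap (MvPolynomial ℕ ℂ) FlatField (vSubst N p) := rfl

/-- Evaluation of polynomials in `x, y` at `y = 2 x ψ / v_N`. -/
noncomputable def xyEval (N : ℕ) :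
    MvPolynomial (Fin 2) (MvPolynomial ℕ ℂ) →+* Polynomial FlatField :=
  eval₂Hom (Polynomial.C.comp (coeffMap N)) ![Polynomial.X, yPoly (cField N) (psiField N)]

theorem xyEval_C (N : ℕ) (p : MvPolynomial ℕ ℂ) :
    xyEval N (C p) = Polynomial.C (coeffMap N p) := by
  rw [xyEval, eval₂Hom_C]; rfl

theorem xyEval_X_zero (N : ℕ) : xyEval N (X 0) = Polynomial.X := by
  rw [xyEval, eval₂Hom_X']; rfl

theorem xyEval_X_one (N : ℕ) : xyEval N (X 1) = yPoly (cField N) (psiField N) := by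
  rw [xyEval, eval₂Hom_X']; rfl

theorem coeffMap_X {N k : ℕ} (hk : k ≠ N) : coeffMap N (X k) = ratField (vFlat N k) := by
  rw [coeffMap_apply, vSubst, aeval_X, vCoord, if_neg hk]; rfl

theorem coeffMap_X_self (N : ℕ) : coeffMap N (X N) = cField N := by
  rw [coeffMap_apply, vSubst, aeval_X, vCoord, if_pos rfl]; rfl

theorem xyEval_pderiv_one (N : ℕ) : xyEval N (pderiv 1 (dUnfolding N))
    = 2 * (Polynomial.X * yPoly (cField N) (psiField N)) + Polynomial.C (cField N) := by
  have h : pderiv 1 (dUnfolding N) = 2 * X 0 * X 1 + C (X N) := by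
    simp only [dUnfolding, map_add, map_sum, pderiv_mul, pderiv_pow, pderiv_C,
      pderiv_X_of_ne (show (0 : Fin 2) ≠ 1 by decide), pderiv_X_self]
    simp only [mul_zero, zero_mul, add_zero, zero_add, Finset.sum_const_zero, mul_one]
    push_cast; ring
  rw [h, map_add, map_mul, map_mul, xyEval_C, xyEval_X_zero, xyEval_X_one,
    coeffMap_X_self, map_ofNat, mul_assoc]

theorem sum_Icc_one_eq {M : Type*} [AddCommMonoid M] (f : ℕ → M) (n : ℕ) :
    ∑ k ∈ Finset.Icc 1 n, f k = ∑ k ∈ Finset.range n, f (k + 1) := by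
  rw [Finset.range_eq_Ico, Finset.sum_Ico_add' f 0 n 1]; rfl

theorem xyEval_pderiv_zero {N : ℕ} (hN : 2 ≤ N) : xyEval N (pderiv 0 (dUnfolding N))
    = psiField N + yPoly (cField N) (psiField N) ^ 2 := by
  obtain ⟨M, rfl⟩ : ∃ M, N = M + 2 := ⟨N - 2, by omega⟩
  have hM : ((M + 2 : ℕ) : ℂ) - 1 ≠ 0 := by
    rw [show ((M + 2 : ℕ) : ℂ) - 1 = ((M + 1 : ℕ) : ℂ) by push_cast; ring]
    exact_mod_cast Nat.succ_ne_zero M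
  have h : pderiv 0 (dUnfolding (M + 2)) = X 0 ^ M + X 1 ^ 2
      + ∑ k ∈ Finset.range M, C (C ((k : ℂ) + 1) * X (k + 2)) * X 0 ^ k := by
    have e1 : (C (C (1 / (((M + 2 : ℕ) : ℂ) - 1))) : MvPolynomial (Fin 2) (MvPolynomial ℕ ℂ))
        * ((M + 1 : ℕ) : MvPolynomial (Fin 2) (MvPolynomial ℕ ℂ)) = 1 := by
      rw [← map_natCast (C (σ := Fin 2) (R := MvPolynomial ℕ ℂ)), ← C_mul,
        ← map_natCast (C (σ := ℕ) (R := ℂ)), ← C_mul]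
      rw [show ((M + 1 : ℕ) : ℂ) = ((M + 2 : ℕ) : ℂ) - 1 by push_cast; ring,
        one_div_mul_cancel hM, C_1, C_1]
    rw [dUnfolding, sum_Icc_one_eq, show M + 2 - 1 = M + 1 by omega, Finset.sum_range_succ']
    simp only [map_add, map_sum, pderiv_mul, pderiv_pow, pderiv_C,
      pderiv_X_of_ne (show (1 : Fin 2) ≠ 0 by decide), pderiv_X_self]
    simp only [mul_zero, zero_mul, add_zero, zero_add, mul_one, Nat.add_sub_cancel, Nat.sub_self,
      Nat.cast_zero, one_mul]
    rw [← mul_assoc, e1, one_mul]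
    refine congrArg _ (Finset.sum_congr rfl fun k _ => ?_)
    have : (C (C ((k : ℂ) + 1)) : MvPolynomial (Fin 2) (MvPolynomial ℕ ℂ))
        = ((k + 1 : ℕ) : MvPolynomial (Fin 2) (MvPolynomial ℕ ℂ)) := by simp
    rw [map_mul C (C (k : ℂ) + C 1) (X (k + 2)), ← C_add, this]; ring
  rw [h, map_add, map_add, map_pow, map_pow, map_sum, xyEval_X_zero, xyEval_X_one, psiField,
    flatPsi_eq hN, Nat.add_sub_cancel, Polynomial.map_add, Polynomial.map_pow, Polynomial.map_X,
    Polynomial.map_sum]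
  have : ∀ k ∈ Finset.range M, xyEval (M + 2) (C (C ((k : ℂ) + 1) * X (k + 2)) * X 0 ^ k)
      = Polynomial.map ratField (Polynomial.C (C ((k : ℚ) + 1) * vFlat (M + 2) (k + 2))
        * Polynomial.X ^ k) := by
    intro k hk
    have hk' := Finset.mem_range.1 hk
    rw [map_mul, map_pow, xyEval_C, xyEval_X_zero, map_mul, coeffMap_X (by omega),
      Polynomial.map_mul, Polynomial.map_C, Polynomial.map_pow, Polynomial.map_X, map_mul]
    congr 3
    simp
  rw [Finset.sum_congr rfl this]
  ring

/-- Consequently the residue functional is defined on the Jacobian ring, and every congruence that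
defines the structure constants can be tested by it. -/
theorem relPoly_dvd_xyEval {N : ℕ} (hN : 2 ≤ N) {P : MvPolynomial (Fin 2) (MvPolynomial ℕ ℂ)}
    (hP : P ∈ dJacobianIdeal N) : relPoly (cField N) (psiField N) ∣ xyEval N P := by
  rw [dJacobianIdeal, Ideal.mem_span_pair] at hP
  obtain ⟨a, b, rfl⟩ := hP
  rw [map_add, map_mul, map_mul, xyEval_pderiv_zero hN, xyEval_pderiv_one]
  exact dvd_add (Dvd.dvd.mul_left (relPoly_dvd_of_yy (cField_ne_zero N)) _)
    (Dvd.dvd.mul_left (relPoly_dvd_of_xy (cField_ne_zero N)) _)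

/-- The residue functional of the `D_N` unfolding. -/
noncomputable def dRes (N : ℕ) : Polynomial FlatField →ₗ[FlatField] FlatField :=
  resFunctional (cField N) (psiField N) (N - 2)

/-- The image of `∂Λ/∂v_k`. -/
noncomputable def basisPoly (N k : ℕ) : Polynomial FlatField :=
  if k = N then yPoly (cField N) (psiField N) else Polynomial.X ^ (k - 1)

theorem xyEval_dBasis (N k : ℕ) : xyEval N (dBasis N k) = basisPoly N k := by
  rw [dBasis, basisPoly]
  split_ifs
  · exact xyEval_X_one N
  · rw [map_pow, xyEval_X_zero]

/-- This identifies `dRes` with the coordinate of index `N - 1`, the one that defines the pairing.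
-/
theorem dRes_basisPoly {N k : ℕ} (hN : 2 ≤ N) (hk : k ∈ Finset.Icc 1 N) :
    dRes N (basisPoly N k) = if k = N - 1 then 1 else 0 := by
  rw [Finset.mem_Icc] at hk
  rw [basisPoly, dRes]
  by_cases h : k = N
  · rw [if_pos h, if_neg (by omega),
      resFunctional_yPoly (cField_ne_zero N) (psiField_monic N) (natDegree_psiField N)]
  · rw [if_neg h, resFunctional_of_natDegree_le (psiField_monic N) (natDegree_psiField N)
      (by rw [Polynomial.natDegree_X_pow]; omega), Polynomial.coeff_X_pow]
    congr 1; apply propext; omega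

theorem dRes_basisPoly_mul {N : ℕ} (hN : 2 ≤ N) {c : ℕ → ℕ → ℕ → MvPolynomial ℕ ℂ}
    (hc : IsDStructureConstants N c) {a b : ℕ} (ha : a ∈ Finset.Icc 1 N)
    (hb : b ∈ Finset.Icc 1 N) (Q : Polynomial FlatField) :
    dRes N (basisPoly N a * basisPoly N b * Q)
      = ∑ k ∈ Finset.Icc 1 N, coeffMap N (c a b k) * dRes N (basisPoly N k * Q) := by
  have h := relPoly_dvd_xyEval hN (hc a ha b hb)
  rw [map_sub, map_mul, map_sum, xyEval_dBasis, xyEval_dBasis] at h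
  simp only [map_mul, xyEval_C, xyEval_dBasis] at h
  rw [dRes, resFunctional_congr (psiField_monic N)
    (Q := ∑ k ∈ Finset.Icc 1 N, Polynomial.C (coeffMap N (c a b k)) * (basisPoly N k * Q)) ?_,
    map_sum]
  · simp only [resFunctional_C_mul]
  · have := Dvd.dvd.mul_right h Q
    rwa [sub_mul, Finset.sum_mul, Finset.sum_congr rfl fun k _ => mul_assoc _ _ Q] at this

theorem dRes_basisPoly_mul_basisPoly {N : ℕ} (hN : 2 ≤ N) {c : ℕ → ℕ → ℕ → MvPolynomial ℕ ℂ}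
    (hc : IsDStructureConstants N c) {a b : ℕ} (ha : a ∈ Finset.Icc 1 N)
    (hb : b ∈ Finset.Icc 1 N) :
    dRes N (basisPoly N a * basisPoly N b) = coeffMap N (c a b (N - 1)) := by
  have h := dRes_basisPoly_mul hN hc ha hb 1
  simp only [mul_one] at h
  rw [h, Finset.sum_congr rfl fun k hk => by rw [dRes_basisPoly hN hk]]
  simp only [mul_ite, mul_one, mul_zero, Finset.sum_ite_eq']
  rw [if_pos (Finset.mem_Icc.2 ⟨by omega, by omega⟩)]

/-- The image of `∂Λ/∂t_i` for `i < N`, and of `∂Λ/∂v_N` for `i = N`. -/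
noncomputable def flatBasis (N i : ℕ) : Polynomial FlatField :=
  if i = N then yPoly (cField N) (psiField N) else (flatPhi N (i - 1)).map ratField

/-- The chain rule for `Λ` in the coordinates `t_1, …, t_{N-1}, v_N`, by `pderiv_vFlat`. -/
theorem flatBasis_eq {N i : ℕ} (hi : i ∈ Finset.Icc 1 N) :
    flatBasis N i = ∑ a ∈ Finset.Icc 1 N,
      Polynomial.C (algebraMap (MvPolynomial ℕ ℂ) FlatField (pderiv i (vCoord N a)))
        * basisPoly N a := by
  rw [Finset.mem_Icc] at hi
  obtain ⟨M, rfl⟩ : ∃ M, N = M + 1 := ⟨N - 1, by omega⟩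
  rw [sum_Icc_one_eq, Finset.sum_range_succ]
  have hb : ∀ a ∈ Finset.range M, basisPoly (M + 1) (a + 1) = Polynomial.X ^ a := by
    intro a ha
    have := Finset.mem_range.1 ha
    rw [basisPoly, if_neg (by omega), Nat.add_sub_cancel]
  have hv : ∀ a ∈ Finset.range M, vCoord (M + 1) (a + 1) = ratMap (vFlat (M + 1) (a + 1)) := by
    intro a ha
    have := Finset.mem_range.1 ha
    rw [vCoord, if_neg (by omega)]
  rw [Finset.sum_congr rfl fun a ha => by rw [hb a ha, hv a ha, pderiv_ratMap]]
  rw [vCoord, if_pos rfl, basisPoly, if_pos rfl, flatBasis]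
  by_cases h : i = M + 1
  · rw [if_pos h, h, pderiv_X_self, map_one, Polynomial.C_1, one_mul, Finset.sum_eq_zero, zero_add]
    intro a _
    rw [pderiv_vFlat_eq_zero (Or.inr le_rfl)]; simp
  · rw [if_neg h, pderiv_X_of_ne (Ne.symm h), map_zero, Polynomial.C_0, zero_mul, add_zero,
      ((flatPhi (M + 1) (i - 1)).map ratField).as_sum_range_C_mul_X_pow' (n := M)]
    · refine Finset.sum_congr rfl fun a ha => ?_
      have := Finset.mem_range.1 ha
      rw [pderiv_vFlat hi.1 (by omega) (by omega) (by omega), Nat.add_sub_cancel,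
        Polynomial.coeff_map]
      rfl
    · have h1 := natDegree_flatPhi_le (M + 1) (i - 1)
      have h2 := Polynomial.natDegree_map_le (f := ratField) (p := flatPhi (M + 1) (i - 1))
      omega

end Transfer

/-! ### Rigidity of constant metrics -/

section Isometry

theorem pderiv_comm {σ K : Type*} [CommRing K] (i j : σ) (p : MvPolynomial σ K) :
    pderiv i (pderiv j p) = pderiv j (pderiv i p) := by
  have h : ⁅(pderiv i : Derivation K (MvPolynomial σ K) (MvPolynomial σ K)),
      (pderiv j : Derivation K (MvPolynomial σ K) (MvPolynomial σ K))⁆ = 0 := by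
    classical
    refine derivation_ext fun k => ?_
    rw [Derivation.commutator_apply, pderiv_X, pderiv_X, Pi.single_apply, Pi.single_apply]
    split_ifs <;> simp
  have h2 := congrArg (fun D : Derivation K (MvPolynomial σ K) (MvPolynomial σ K) => D p) h
  simpa [Derivation.commutator_apply, sub_eq_zero] using h2

theorem eq_zero_of_pderiv_eq_zero {K : Type*} [Field K] [CharZero K] {p : MvPolynomial ℕ K}
    (h : ∀ i, pderiv i p = 0) (h0 : constantCoeff p = 0) : p = 0 := by
  have hv : p.vars ⊆ ∅ := vars_subset_of_pderiv_eq_zero fun i _ => h i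
  have hp := vars_eq_empty_iff_eq_C.1 (Finset.subset_empty.1 hv)
  rw [hp, ← constantCoeff_eq, h0, C_0]

theorem eq_of_pderiv_eq {K : Type*} [Field K] [CharZero K] {p q : MvPolynomial ℕ K}
    (h : ∀ i, pderiv i p = pderiv i q) (h0 : constantCoeff p = constantCoeff q) : p = q := by
  rw [← sub_eq_zero]
  exact eq_zero_of_pderiv_eq_zero (fun i => by rw [map_sub, h, sub_self])
    (by rw [map_sub, h0, sub_self])

theorem pderiv_aeval {K : Type*} [CommRing K] {s : Finset ℕ} (g : ℕ → MvPolynomial ℕ K)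
    {p : MvPolynomial ℕ K} (hp : p.vars ⊆ s) (i : ℕ) :
    pderiv i (aeval g p) = ∑ a ∈ s, pderiv i (g a) * aeval g (pderiv a p) := by
  have hp' : p ∈ supported K (s : Set ℕ) := mem_supported.2 (by exact_mod_cast hp)
  rw [supported] at hp'
  induction hp' using Algebra.adjoin_induction with
  | mem x hx =>
    obtain ⟨a, ha, rfl⟩ := hx
    rw [Finset.sum_eq_single a]
    · simp
    · intro b _ hb
      rw [pderiv_X_of_ne hb.symm]; simp
    · intro h; exact absurd ha h
  | algebraMap r => simp [algebraMap_eq]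
  | add x y hx hy ihx ihy =>
    have e1 := ihx (by exact_mod_cast mem_supported.1 hx)
    have e2 := ihy (by exact_mod_cast mem_supported.1 hy)
    simp only [map_add, mul_add, Finset.sum_add_distrib, e1, e2]
  | mul x y hx hy ihx ihy =>
    have e1 := ihx (by exact_mod_cast mem_supported.1 hx)
    have e2 := ihy (by exact_mod_cast mem_supported.1 hy)
    rw [map_mul, pderiv_mul, e1, e2, Finset.sum_mul, Finset.mul_sum, ← Finset.sum_add_distrib]
    refine Finset.sum_congr rfl fun a _ => ?_
    rw [pderiv_mul, map_add, map_mul, map_mul]; ring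

/-- Maps that pull a constant nondegenerate metric back to a constant one are affine. -/
theorem pderiv_pderiv_eq_zero_of_isometry {K : Type*} [Field K] [CharZero K] {s : Finset ℕ}
    {T : ℕ → MvPolynomial ℕ K} {E E' H H' : ℕ → ℕ → K} (hE : ∀ α β, E α β = E β α)
    (hEE : ∀ α ∈ s, ∀ β ∈ s, ∑ γ ∈ s, E' α γ * E γ β = if α = β then 1 else 0)
    (hHH : ∀ α ∈ s, ∀ β ∈ s, ∑ γ ∈ s, H α γ * H' γ β = if α = β then 1 else 0)
    (hT : ∀ i ∈ s, ∀ j ∈ s, ∑ α ∈ s, ∑ β ∈ s, C (E α β) * pderiv i (T α) * pderiv j (T β)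
      = C (H i j)) {i j α : ℕ} (hi : i ∈ s) (hj : j ∈ s) (hα : α ∈ s) :
    pderiv i (pderiv j (T α)) = 0 := by
  classical
  have hE' : ∀ u v : ℕ → MvPolynomial ℕ K,
      ∑ α ∈ s, ∑ β ∈ s, C (E α β) * u α * v β = ∑ α ∈ s, ∑ β ∈ s, C (E α β) * v α * u β := by
    intro u v
    rw [Finset.sum_comm]
    refine Finset.sum_congr rfl fun a _ => Finset.sum_congr rfl fun b _ => ?_
    rw [hE]; ring
  -- `S k i j` is symmetric in `k, i`, and differentiating the constant metric makes it
  -- antisymmetric in `i, j`; permuting the indices gives `S = -S`, as for Christoffel symbols.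
  let S : ℕ → ℕ → ℕ → MvPolynomial ℕ K := fun k i j =>
    ∑ α ∈ s, ∑ β ∈ s, C (E α β) * pderiv k (pderiv i (T α)) * pderiv j (T β)
  have hS1 : ∀ k i j, S k i j = S i k j := by
    intro k i j
    simp only [S, pderiv_comm k i]
  have hS2 : ∀ k, ∀ i ∈ s, ∀ j ∈ s, S k i j = - S k j i := by
    intro k i hi j hj
    have h := congrArg (pderiv k) (hT i hi j hj)
    rw [pderiv_C, map_sum] at h
    rw [eq_neg_iff_add_eq_zero, ← h]
    simp only [S]
    rw [hE' (fun α => pderiv k (pderiv j (T α))) (fun β => pderiv i (T β)),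
      ← Finset.sum_add_distrib]
    refine Finset.sum_congr rfl fun a _ => ?_
    rw [map_sum, ← Finset.sum_add_distrib]
    refine Finset.sum_congr rfl fun b _ => ?_
    rw [pderiv_mul, pderiv_C_mul]
  have hS : ∀ k ∈ s, ∀ i ∈ s, ∀ j ∈ s, S k i j = 0 := by
    intro k hk i hi j hj
    have h1 := hS2 k i hi j hj
    rw [hS1 k j i, hS2 j k hk i hi, hS1 j i k, hS2 i j hj k hk, hS1 i k j] at h1
    simp only [neg_neg] at h1
    have h2 : (2 : MvPolynomial ℕ K) * S k i j = 0 := by linear_combination h1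
    exact (mul_eq_zero.1 h2).resolve_left two_ne_zero
  let M : Matrix s s (MvPolynomial ℕ K) := Matrix.of fun a b => pderiv (a : ℕ) (T b)
  let ME : Matrix s s (MvPolynomial ℕ K) := Matrix.of fun a b => C (E a b)
  let MH' : Matrix s s (MvPolynomial ℕ K) := Matrix.of fun a b => C (H' a b)
  -- The metric identity and the inverse `H'` make the Jacobian matrix invertible over polynomials.
  -- It can therefore be cancelled from `S = 0`, and then `E` by means of `E'`.
  have hM : M * (ME * M.transpose * MH') = 1 := by
    have h1 : M * (ME * M.transpose)
        = (Matrix.of fun a b => C (H a b) : Matrix s s (MvPolynomial ℕ K)) := by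
      ext1 a b
      rw [Matrix.of_apply, ← hT a a.2 b b.2, ← Finset.sum_coe_sort]
      simp only [Matrix.mul_apply, Matrix.transpose_apply, Matrix.of_apply, M, ME]
      apply Finset.sum_congr rfl
      intro x _
      rw [← Finset.sum_coe_sort s, Finset.mul_sum]
      apply Finset.sum_congr rfl
      intro y _
      ring
    rw [← Matrix.mul_assoc, h1]
    ext1 a b
    rw [Matrix.mul_apply, Matrix.one_apply]
    have h2 := hHH a a.2 b b.2
    rw [← Finset.sum_coe_sort] at h2
    have h3 := congrArg (C : K → MvPolynomial ℕ K) h2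
    rw [map_sum] at h3
    simp only [MH', Matrix.of_apply, ← C_mul]
    rw [h3]
    by_cases hab : a = b
    · rw [if_pos hab, if_pos (congrArg _ hab), C_1]
    · rw [if_neg hab, if_neg (fun h => hab (Subtype.ext h)), C_0]
  have hM' := mul_eq_one_comm.1 hM
  have hw : ∀ β ∈ s, ∑ α ∈ s, C (E α β) * pderiv i (pderiv j (T α)) = 0 := by
    let w : s → MvPolynomial ℕ K := fun β => ∑ α ∈ s, C (E α β) * pderiv i (pderiv j (T α))
    have h0 : M.mulVec w = 0 := by
      ext1 a
      have := hS i hi j hj a a.2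
      simp only [S] at this
      rw [Finset.sum_comm, ← Finset.sum_coe_sort] at this
      rw [Pi.zero_apply, ← this, Matrix.mulVec, dotProduct]
      refine Finset.sum_congr rfl fun x _ => ?_
      rw [← Finset.sum_mul, mul_comm]; rfl
    have h1 : w = 0 := by
      rw [← Matrix.one_mulVec w, ← hM', ← Matrix.mulVec_mulVec, h0, Matrix.mulVec_zero]
    intro β hβ
    exact congrFun h1 ⟨β, hβ⟩
  have hfin : ∑ β ∈ s, C (E' α β) * ∑ γ ∈ s, C (E γ β) * pderiv i (pderiv j (T γ)) = 0 :=
    Finset.sum_eq_zero fun β hβ => by rw [hw β hβ, mul_zero]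
  simp only [Finset.mul_sum] at hfin
  rw [Finset.sum_comm] at hfin
  have h4 : ∀ γ ∈ s, ∑ β ∈ s, C (E' α β) * (C (E γ β) * pderiv i (pderiv j (T γ)))
      = (if α = γ then 1 else 0) * pderiv i (pderiv j (T γ)) := by
    intro γ hγ
    have h5 := congrArg (C : K → MvPolynomial ℕ K) (hEE α hα γ hγ)
    rw [map_sum] at h5
    have h6 : (C (if α = γ then 1 else 0) : MvPolynomial ℕ K) = if α = γ then 1 else 0 := by
      split_ifs <;> simp
    rw [← h6, ← h5, Finset.sum_mul]
    refine Finset.sum_congr rfl fun β _ => ?_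
    rw [hE γ β, C_mul]; ring
  rw [Finset.sum_congr rfl h4] at hfin
  simpa [hα] using hfin

end Isometry

/-! ### Values of the residue functional on flat basis elements -/

section Values

/-- The relation of `x` with coefficients in the flat coordinates. -/
noncomputable def relFlat (N : ℕ) : Polynomial (MvPolynomial ℕ ℚ) :=
  Polynomial.X * (Polynomial.X * flatPsi N (N - 2)) + Polynomial.C (C (1 / 4) * X N ^ 2)

theorem relFlat_monic (N : ℕ) : (relFlat N).Monic := by
  have h : (Polynomial.X * (Polynomial.X * flatPsi N (N - 2))).Monic :=
    Polynomial.monic_X.mul (Polynomial.monic_X.mul (flatPsi_monic N _))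
  refine h.add_of_left (lt_of_le_of_lt Polynomial.degree_C_le ?_)
  rw [← Polynomial.natDegree_pos_iff_degree_pos,
    Polynomial.natDegree_X_mul (Polynomial.monic_X.mul (flatPsi_monic N _)).ne_zero]
  exact Nat.succ_pos _

theorem map_relFlat (N : ℕ) :
    (relFlat N).map ratField = relPoly (cField N) (psiField N) := by
  rw [relFlat, relPoly, psiField, Polynomial.map_add, Polynomial.map_mul, Polynomial.map_mul,
    Polynomial.map_X, Polynomial.map_C]
  congr 2
  rw [map_mul, map_pow]
  have h1 : ratField (X N) = cField N := by
    rw [ratField, RingHom.comp_apply, ratMap, map_X]; rfl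
  have h2 : ratField (C (1 / 4)) = 1 / 4 := by
    have h3 : ratField (C (1 / 4)) * 4 = 1 := by
      have h4 : (4 : FlatField) = ratField (C 4) := by
        rw [show (C 4 : MvPolynomial ℕ ℚ) = 4 from map_ofNat C 4, map_ofNat]
      rw [h4, ← map_mul, ← C_mul, show (1 / 4 : ℚ) * 4 = 1 by norm_num, C_1, map_one]
    field_simp
    exact h3
  rw [h1, h2]; ring

theorem dRes_map (N : ℕ) (P : Polynomial (MvPolynomial ℕ ℚ)) :
    dRes N (P.map ratField) = ratField (((Polynomial.X * P) %ₘ relFlat N).coeff (N - 2 + 1)) := by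
  rw [dRes, resFunctional_apply, ← map_relFlat, ← Polynomial.coeff_map,
    Polynomial.map_modByMonic _ (relFlat_monic N), Polynomial.map_mul, Polynomial.map_X]

theorem coeff_flatPhi_mul_modByMonic {N i j : ℕ} (hN : 3 ≤ N) (hi : i < N - 1) (hj : j < N - 1)
    (κ : MvPolynomial ℕ ℚ) :
    ((Polynomial.X * (flatPhi N i * flatPhi N j)) %ₘ
      (Polynomial.X * (Polynomial.X * flatPsi N (N - 2)) + Polynomial.C κ)).coeff (N - 2 + 1)
      = if i + j = N - 2 then 1 else 0 := by
  obtain ⟨m, rfl⟩ : ∃ m, N = m + 3 := ⟨N - 3, by omega⟩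
  have hQ : (Polynomial.X * flatPsi (m + 3) (m + 1)).Monic :=
    Polynomial.monic_X.mul (flatPsi_monic _ _)
  have hQd : (Polynomial.X * flatPsi (m + 3) (m + 1)).natDegree = m + 2 := by
    rw [Polynomial.natDegree_X_mul (flatPsi_monic _ _).ne_zero, natDegree_flatPsi]
  have hP : (flatPhi (m + 3) i * flatPhi (m + 3) j).natDegree ≤ 2 * m + 2 := by
    refine Polynomial.natDegree_mul_le.trans ?_
    have := natDegree_flatPhi_le (m + 3) i
    have := natDegree_flatPhi_le (m + 3) j
    omega
  rw [show m + 3 - 2 = m + 1 by omega, coeff_X_mul_modByMonic hQ hQd κ hP]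
  exact coeff_resPoly_mul_modByMonic (flatF_mul_flatE _) (constantCoeff_flatF _) (by omega)
    (by omega)

/-- The matrix of the pairing in the coordinates `t_1, …, t_{N-1}, v_N`. -/
def halfFlatMetric (N i j : ℕ) : ℂ :=
  if i = N ∧ j = N then -1 else if i + j = N then 1 else 0

theorem natDegree_map_flatPhi_le (N i : ℕ) : ((flatPhi N i).map ratField).natDegree ≤ i :=
  Polynomial.natDegree_map_le.trans (natDegree_flatPhi_le N i)

theorem dRes_flatBasis_mul {N i j : ℕ} (hN : 3 ≤ N) (hi : i ∈ Finset.Icc 1 N)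
    (hj : j ∈ Finset.Icc 1 N) : dRes N (flatBasis N i * flatBasis N j)
      = algebraMap (MvPolynomial ℕ ℂ) FlatField (C (halfFlatMetric N i j)) := by
  rw [Finset.mem_Icc] at hi hj
  have hy : ∀ k, 1 ≤ k → k < N → dRes N ((flatPhi N (k - 1)).map ratField
      * yPoly (cField N) (psiField N)) = 0 := by
    intro k hk hkN
    refine resFunctional_mul_yPoly_of_natDegree_le (cField_ne_zero N) (psiField_monic N)
      (natDegree_psiField N) ?_
    have := natDegree_map_flatPhi_le N (k - 1)
    omega
  rw [flatBasis, flatBasis, halfFlatMetric]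
  by_cases h1 : i = N <;> by_cases h2 : j = N
  · rw [if_pos h1, if_pos h2, if_pos ⟨h1, h2⟩]
    have := resFunctional_mul_yPoly_mul_yPoly (cField_ne_zero N) (psiField_monic N)
      (natDegree_psiField N) (P := 1) (by simp)
    rw [one_mul, Polynomial.coeff_one_zero] at this
    rw [dRes, this]; simp
  · rw [if_pos h1, if_neg h2, if_neg (by tauto), if_neg (by omega), mul_comm,
      hy j hj.1 (by omega)]
    simp
  · rw [if_neg h1, if_pos h2, if_neg (by tauto), if_neg (by omega), hy i hi.1 (by omega)]
    simp
  · rw [if_neg h1, if_neg h2, if_neg (by tauto), ← Polynomial.map_mul, dRes_map, relFlat,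
      coeff_flatPhi_mul_modByMonic hN (by omega) (by omega)]
    by_cases h : i + j = N
    · rw [if_pos h, if_pos (by omega), map_one, C_1, map_one]
    · rw [if_neg h, if_neg (by omega), map_zero, C_0, map_zero]

/-- Only the explicit factor `X N` matters later: it makes these third derivatives vanish on `t_N =
0`. -/
theorem dRes_flatPhi_mul_yPoly (N i j : ℕ) :
    dRes N ((flatPhi N i).map ratField * (flatPhi N j).map ratField
      * yPoly (cField N) (psiField N))
      = ratField (X N * (C (-1 / 2) * ((flatPhi N i * flatPhi N j) %ₘ relFlat N).coeff
        (N - 2 + 1))) := by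
  rw [dRes, resFunctional_mul_yPoly (cField_ne_zero N) (psiField_monic N), ← Polynomial.map_mul,
    ← map_relFlat, ← Polynomial.map_modByMonic _ (relFlat_monic N), Polynomial.coeff_map,
    map_mul, map_mul]
  have h1 : ratField (X N) = cField N := by
    rw [ratField, RingHom.comp_apply, ratMap, map_X]; rfl
  have h2 : ratField (C (-1 / 2)) = -1 / 2 := by
    have h3 : ratField (C (-1 / 2)) * 2 = -1 := by
      have h4 : (2 : FlatField) = ratField (C 2) := by
        rw [show (C 2 : MvPolynomial ℕ ℚ) = 2 from map_ofNat C 2, map_ofNat]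
      rw [h4, ← map_mul, ← C_mul, show (-1 / 2 : ℚ) * 2 = -1 by norm_num, C_neg, C_1, map_neg,
        map_one]
    rw [eq_div_iff two_ne_zero]
    exact h3
  rw [h1, h2]; ring

theorem dRes_yPoly_mul_yPoly_mul_flatPhi {N i : ℕ} (hi : i ≤ N - 2) :
    dRes N ((flatPhi N i).map ratField * yPoly (cField N) (psiField N)
      * yPoly (cField N) (psiField N)) = ratField (-(flatPhi N i).coeff 0) := by
  rw [dRes, resFunctional_mul_yPoly_mul_yPoly (cField_ne_zero N) (psiField_monic N)
    (natDegree_psiField N) ((natDegree_map_flatPhi_le N i).trans hi), Polynomial.coeff_map,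
    map_neg]

theorem dRes_yPoly_cube (N : ℕ) : dRes N (yPoly (cField N) (psiField N)
    * yPoly (cField N) (psiField N) * yPoly (cField N) (psiField N)) = 0 :=
  resFunctional_yPoly_cube (cField_ne_zero N) (psiField_monic N) (natDegree_psiField N)

end Values

/-! ### Identification of the given flat coordinates -/

section FlatIdentification

theorem sum_sum_comm {M : Type*} [AddCommMonoid M] (s : Finset ℕ) (f : ℕ → ℕ → ℕ → ℕ → M) :
    ∑ a ∈ s, ∑ b ∈ s, ∑ α ∈ s, ∑ β ∈ s, f a b α β
      = ∑ α ∈ s, ∑ β ∈ s, ∑ a ∈ s, ∑ b ∈ s, f a b α β := by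
  have h : ∀ g : ℕ → ℕ → ℕ → M, ∑ a ∈ s, ∑ b ∈ s, ∑ α ∈ s, g a b α
      = ∑ α ∈ s, ∑ a ∈ s, ∑ b ∈ s, g a b α := fun g => by
    rw [Finset.sum_congr rfl fun a _ => Finset.sum_comm, Finset.sum_comm]
  rw [h fun a b α => ∑ β ∈ s, f a b α β]
  exact Finset.sum_congr rfl fun α _ => h fun a b β => f a b α β

theorem sum_sum_sum_comm {M : Type*} [AddCommMonoid M] (s : Finset ℕ)
    (f : ℕ → ℕ → ℕ → ℕ → ℕ → ℕ → M) :
    ∑ a ∈ s, ∑ b ∈ s, ∑ d ∈ s, ∑ α ∈ s, ∑ β ∈ s, ∑ γ ∈ s, f a b d α β γ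
      = ∑ α ∈ s, ∑ β ∈ s, ∑ γ ∈ s, ∑ a ∈ s, ∑ b ∈ s, ∑ d ∈ s, f a b d α β γ := by
  have h : ∀ g : ℕ → ℕ → ℕ → ℕ → M, ∑ a ∈ s, ∑ b ∈ s, ∑ d ∈ s, ∑ α ∈ s, g a b d α
      = ∑ α ∈ s, ∑ a ∈ s, ∑ b ∈ s, ∑ d ∈ s, g a b d α := fun g => by
    rw [Finset.sum_congr rfl fun a _ => Finset.sum_congr rfl fun b _ => Finset.sum_comm,
      Finset.sum_congr rfl fun a _ => Finset.sum_comm, Finset.sum_comm]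
  rw [h fun a b d α => ∑ β ∈ s, ∑ γ ∈ s, f a b d α β γ]
  refine Finset.sum_congr rfl fun α _ => ?_
  rw [h fun a b d β => ∑ γ ∈ s, f a b d α β γ]
  exact Finset.sum_congr rfl fun β _ => h fun a b d γ => f a b d α β γ

theorem sum_mul_sum_mul_sum {M : Type*} [CommSemiring M] (s : Finset ℕ) (f g h : ℕ → M) :
    (∑ a ∈ s, f a) * (∑ b ∈ s, g b) * (∑ d ∈ s, h d)
      = ∑ a ∈ s, ∑ b ∈ s, ∑ d ∈ s, f a * g b * h d := by
  rw [Finset.sum_mul_sum, Finset.sum_mul]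
  refine Finset.sum_congr rfl fun a _ => ?_
  rw [Finset.sum_mul]
  refine Finset.sum_congr rfl fun b _ => ?_
  rw [Finset.mul_sum]

theorem vars_pderiv_subset {K : Type*} [Field K] [CharZero K] {s : Finset ℕ}
    {p : MvPolynomial ℕ K} (hp : p.vars ⊆ s) (i : ℕ) : (pderiv i p).vars ⊆ s := by
  refine vars_subset_of_pderiv_eq_zero fun j hj => ?_
  rw [pderiv_comm, pderiv_eq_zero_of_notMem_vars fun h => hj (hp h), map_zero]

theorem aeval_congr_of_vars {K : Type*} [CommRing K] {s : Finset ℕ} {g g' : ℕ → MvPolynomial ℕ K}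
    {p : MvPolynomial ℕ K} (hp : p.vars ⊆ s) (h : ∀ a ∈ s, g a = g' a) :
    aeval g p = aeval g' p :=
  eval₂Hom_congr' rfl (fun a ha _ => h a (hp ha)) rfl

variable {N : ℕ} {c : ℕ → ℕ → ℕ → MvPolynomial ℕ ℂ} {t : ℕ → MvPolynomial ℕ ℂ}

theorem pderiv_vSubst {p : MvPolynomial ℕ ℂ} (hp : p.vars ⊆ Finset.Icc 1 N) (i : ℕ) :
    pderiv i (vSubst N p)
      = ∑ a ∈ Finset.Icc 1 N, pderiv i (vCoord N a) * vSubst N (pderiv a p) :=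
  pderiv_aeval _ hp i

theorem dRes_flatBasis_mul_flatBasis (hN : 3 ≤ N) (hc : IsDStructureConstants N c) {i j : ℕ}
    (hi : i ∈ Finset.Icc 1 N) (hj : j ∈ Finset.Icc 1 N) :
    dRes N (flatBasis N i * flatBasis N j) = algebraMap (MvPolynomial ℕ ℂ) FlatField
      (∑ a ∈ Finset.Icc 1 N, ∑ b ∈ Finset.Icc 1 N,
        pderiv i (vCoord N a) * pderiv j (vCoord N b) * vSubst N (c a b (N - 1))) := by
  rw [flatBasis_eq hi, flatBasis_eq hj, Finset.sum_mul_sum, map_sum, map_sum]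
  refine Finset.sum_congr rfl fun a ha => ?_
  rw [map_sum, map_sum]
  refine Finset.sum_congr rfl fun b hb => ?_
  rw [mul_mul_mul_comm, ← Polynomial.C_mul, dRes, resFunctional_C_mul, ← dRes,
    dRes_basisPoly_mul_basisPoly (by omega) hc ha hb, coeffMap_apply, map_mul, map_mul]

/-- Both sides are the pairing of `∂/∂t_i` and `∂/∂t_j` (with `∂/∂v_N` for index `N`): once through
the given flat coordinates, once through residues. Hence the transition between the two systems is
an isometry of constant metrics. -/
theorem pairing_pullback (hN : 3 ≤ N) (hc : IsDStructureConstants N c)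
    (ht : IsDFlatCoordinates N c t) {i j : ℕ} (hi : i ∈ Finset.Icc 1 N)
    (hj : j ∈ Finset.Icc 1 N) :
    ∑ α ∈ Finset.Icc 1 N, ∑ β ∈ Finset.Icc 1 N, C (dEta N α β) * pderiv i (vSubst N (t α))
      * pderiv j (vSubst N (t β)) = C (halfFlatMetric N i j) := by
  apply IsFractionRing.injective (MvPolynomial ℕ ℂ) FlatField
  rw [← dRes_flatBasis_mul hN hi hj, dRes_flatBasis_mul_flatBasis hN hc hi hj]
  refine congrArg (algebraMap (MvPolynomial ℕ ℂ) FlatField) ?_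
  have h1 : ∀ a ∈ Finset.Icc 1 N, ∀ b ∈ Finset.Icc 1 N,
      pderiv i (vCoord N a) * pderiv j (vCoord N b) * vSubst N (c a b (N - 1))
      = ∑ α ∈ Finset.Icc 1 N, ∑ β ∈ Finset.Icc 1 N, C (dEta N α β)
        * (pderiv i (vCoord N a) * vSubst N (pderiv a (t α)))
        * (pderiv j (vCoord N b) * vSubst N (pderiv b (t β))) := by
    intro a ha b hb
    rw [← ht.pairing_eq a ha b hb, map_sum, Finset.mul_sum]
    refine Finset.sum_congr rfl fun α _ => ?_
    rw [map_sum, Finset.mul_sum]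
    refine Finset.sum_congr rfl fun β _ => ?_
    rw [map_mul, map_mul, algHom_C, algebraMap_eq]; ring
  rw [Finset.sum_congr rfl fun a ha => Finset.sum_congr rfl fun b hb => h1 a ha b hb,
    sum_sum_comm]
  refine Finset.sum_congr rfl fun α hα => Finset.sum_congr rfl fun β hβ => ?_
  rw [pderiv_vSubst (ht.vars_subset α hα), pderiv_vSubst (ht.vars_subset β hβ), mul_assoc,
    Finset.sum_mul_sum, Finset.mul_sum]
  refine Finset.sum_congr rfl fun a _ => ?_
  rw [Finset.mul_sum]
  refine Finset.sum_congr rfl fun b _ => ?_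
  ring

theorem halfFlatMetric_mul (α β : ℕ) (hα : α ∈ Finset.Icc 1 N)
    (hβ : β ∈ Finset.Icc 1 N) :
    ∑ γ ∈ Finset.Icc 1 N, halfFlatMetric N α γ * halfFlatMetric N γ β
      = if α = β then 1 else 0 := by
  rw [Finset.mem_Icc] at hα hβ
  by_cases h : α = N
  · rw [Finset.sum_eq_single N]
    · unfold halfFlatMetric
      split_ifs <;> first | (exfalso; omega) | simp
    · intro γ hγ hne
      rw [Finset.mem_Icc] at hγ
      unfold halfFlatMetric
      split_ifs <;> first | (exfalso; omega) | simp
    · intro hN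
      exact absurd (Finset.mem_Icc.2 ⟨by omega, le_rfl⟩) hN
  · rw [Finset.sum_eq_single (N - α)]
    · unfold halfFlatMetric
      split_ifs <;> first | (exfalso; omega) | simp
    · intro γ hγ hne
      rw [Finset.mem_Icc] at hγ
      unfold halfFlatMetric
      split_ifs <;> first | (exfalso; omega) | simp
    · intro hN
      exact absurd (Finset.mem_Icc.2 ⟨by omega, by omega⟩) hN

theorem dEta_comm (α β : ℕ) : dEta N α β = dEta N β α := by
  simp only [dEta, and_comm, add_comm]

theorem constantCoeff_vCoord {k : ℕ} (hk : k ∈ Finset.Icc 1 N) :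
    constantCoeff (vCoord N k) = 0 := by
  rw [Finset.mem_Icc] at hk
  rw [vCoord]
  split_ifs with h
  · simp
  · rw [ratMap, constantCoeff_map, constantCoeff_vFlat (by omega), map_zero]

theorem constantCoeff_vSubst {p : MvPolynomial ℕ ℂ} (hp : p.vars ⊆ Finset.Icc 1 N) :
    constantCoeff (vSubst N p) = constantCoeff p := by
  have h : (constantCoeff.comp (vSubst N).toRingHom) p = constantCoeff p := by
    refine hom_congr_vars ?_ (fun i hi _ => ?_) rfl
    · ext r; simp
    · have := constantCoeff_vCoord (hp hi)
      simp [vSubst, this]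
  exact h

theorem constantCoeff_pderiv_vCoord {i k : ℕ} (hi : i ∈ Finset.Icc 1 N)
    (hk : k ∈ Finset.Icc 1 N) :
    constantCoeff (pderiv i (vCoord N k)) = if k = i then 1 else 0 := by
  rw [Finset.mem_Icc] at hi hk
  rw [vCoord]
  split_ifs with h h2 h2
  · rw [← h2, h, pderiv_X_self, map_one]
  · rw [pderiv_X_of_ne (by omega), map_zero]
  all_goals
    rw [pderiv_ratMap, ratMap, constantCoeff_map]
  · rw [pderiv_vFlat (by omega) (by omega) (by omega) (by omega), constantCoeff_coeff_flatPhi,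
      if_pos (by omega), map_one]
  · by_cases hiN : i = N
    · rw [pderiv_vFlat_eq_zero (by omega), map_zero, map_zero]
    · rw [pderiv_vFlat (by omega) (by omega) (by omega) (by omega), constantCoeff_coeff_flatPhi,
        if_neg (by omega), map_zero]

theorem pderiv_vCoord_eq_zero {i k : ℕ} (hi : i ∉ Finset.Icc 1 N) (hN : 1 ≤ N) :
    pderiv i (vCoord N k) = 0 := by
  rw [Finset.mem_Icc] at hi
  rw [vCoord]
  split_ifs with h
  · rw [pderiv_X_of_ne (by omega)]
  · rw [pderiv_ratMap, pderiv_vFlat_eq_zero (by omega), map_zero]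

theorem constantCoeff_pderiv (p : MvPolynomial ℕ ℂ) (i : ℕ) :
    constantCoeff (pderiv i p) = coeff (Finsupp.single i 1) p := by
  rw [constantCoeff_eq, coeff_pderiv]; simp

/-- The transition map is affine by rigidity, so its value and gradient at the origin determine it.
Both are known, because `t` and `v` agree there to first order and so do `v` and the explicit
coordinates. -/
theorem vSubst_flat (hN : 3 ≤ N) (hc : IsDStructureConstants N c)
    (ht : IsDFlatCoordinates N c t) {α : ℕ} (hα : α ∈ Finset.Icc 1 (N - 1)) :
    vSubst N (t α) = X α := by
  have hα' : α ∈ Finset.Icc 1 N := by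
    rw [Finset.mem_Icc] at hα ⊢; omega
  have hvars := ht.vars_subset α hα'
  have hd0 : ∀ i ∉ Finset.Icc 1 N, pderiv i (vSubst N (t α)) = 0 := by
    intro i hi
    rw [pderiv_vSubst hvars]
    exact Finset.sum_eq_zero fun a _ => by rw [pderiv_vCoord_eq_zero hi (by omega), zero_mul]
  have hd1 : ∀ i ∈ Finset.Icc 1 N, pderiv i (vSubst N (t α)) = C (if α = i then 1 else 0) := by
    intro i hi
    have hv : (pderiv i (vSubst N (t α))).vars ⊆ ∅ := by
      refine vars_subset_of_pderiv_eq_zero fun j _ => ?_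
      by_cases hj : j ∈ Finset.Icc 1 N
      · exact pderiv_pderiv_eq_zero_of_isometry (s := Finset.Icc 1 N) (T := fun α => vSubst N (t α))
          dEta_comm (fun α hα β hβ => dEta_mul_dEta N α β hα hβ)
          (fun α hα β hβ => halfFlatMetric_mul α β hα hβ)
          (fun i hi j hj => pairing_pullback hN hc ht hi hj) hj hi hα'
      · rw [pderiv_comm, hd0 j hj, map_zero]
    rw [vars_eq_empty_iff_eq_C.1 (Finset.subset_empty.1 hv), ← constantCoeff_eq]
    congr 1
    rw [pderiv_vSubst hvars, map_sum]
    have : ∀ a ∈ Finset.Icc 1 N,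
        constantCoeff (pderiv i (vCoord N a) * vSubst N (pderiv a (t α)))
        = if a = i then (if a = α then 1 else 0) else 0 := by
      intro a ha
      rw [map_mul, constantCoeff_pderiv_vCoord hi ha,
        constantCoeff_vSubst (vars_pderiv_subset hvars a), constantCoeff_pderiv,
        ht.linear_coeff_eq α hα a ha]
      split_ifs <;> simp
    rw [Finset.sum_congr rfl this, Finset.sum_ite_eq', if_pos hi]
    simp only [eq_comm]
  refine eq_of_pderiv_eq (fun i => ?_) ?_
  · by_cases hi : i ∈ Finset.Icc 1 N
    · rw [hd1 i hi]
      by_cases h : α = i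
      · rw [if_pos h, h, pderiv_X_self, C_1]
      · rw [if_neg h, pderiv_X_of_ne h, C_0]
    · rw [hd0 i hi, pderiv_X_of_ne (fun h => hi (by rw [← h]; exact hα'))]
  · rw [constantCoeff_vSubst hvars, ht.constantCoeff_eq α hα, constantCoeff_X]

/-- The two metrics have entries `1` and `-1` at `(N, N)`, and only `t_N` depends on `v_N`. -/
theorem sq_eq_neg_one (hN : 3 ≤ N) (hc : IsDStructureConstants N c)
    (ht : IsDFlatCoordinates N c t) {r : ℂ} (hr : t N = C r * X N) : r ^ 2 = -1 := by
  have hNN : N ∈ Finset.Icc 1 N := Finset.mem_Icc.2 ⟨by omega, le_rfl⟩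
  have h := pairing_pullback hN hc ht hNN hNN
  have hT : vSubst N (t N) = C r * X N := by
    rw [hr, map_mul, algHom_C, algebraMap_eq, vSubst, aeval_X, vCoord, if_pos rfl]
  have hd : ∀ α ∈ Finset.Icc 1 N, pderiv N (vSubst N (t α)) = if α = N then C r else 0 := by
    intro α hα
    split_ifs with h
    · rw [h, hT, pderiv_C_mul, pderiv_X_self, mul_one]
    · rw [vSubst_flat hN hc ht (Finset.mem_Icc.2 ⟨(Finset.mem_Icc.1 hα).1, by
        have := (Finset.mem_Icc.1 hα).2; omega⟩), pderiv_X_of_ne h]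
  rw [Finset.sum_congr rfl fun α hα => Finset.sum_congr rfl fun β hβ => by
    rw [hd α hα, hd β hβ]] at h
  simp only [mul_ite, mul_zero, Finset.sum_ite_eq', if_pos hNN, ite_mul, zero_mul] at h
  rw [dEta, if_pos ⟨rfl, rfl⟩, halfFlatMetric, if_pos ⟨rfl, rfl⟩, C_1, one_mul, ← C_mul] at h
  rw [pow_two]
  exact C_injective _ _ h

end FlatIdentification

/-! ### Third derivatives of the potential as residues -/

section ThirdDerivatives

variable {N : ℕ} {c : ℕ → ℕ → ℕ → MvPolynomial ℕ ℂ} {t : ℕ → MvPolynomial ℕ ℂ}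
  {F : MvPolynomial ℕ ℂ}

theorem sum_contract {K : Type*} [CommRing K] {s : Finset ℕ} {E : ℕ → ℕ → K}
    (hE : ∀ α ∈ s, ∀ β ∈ s, ∑ γ ∈ s, E α γ * E γ β = if α = β then 1 else 0)
    (P Q : ℕ → MvPolynomial ℕ K) :
    ∑ δ ∈ s, (∑ γ ∈ s, P γ * C (E γ δ)) * (∑ ε ∈ s, C (E δ ε) * Q ε) = ∑ γ ∈ s, P γ * Q γ := by
  have h1 : ∀ δ, (∑ γ ∈ s, P γ * C (E γ δ)) * (∑ ε ∈ s, C (E δ ε) * Q ε)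
      = ∑ γ ∈ s, ∑ ε ∈ s, P γ * Q ε * C (E γ δ * E δ ε) := by
    intro δ
    rw [Finset.sum_mul_sum]
    refine Finset.sum_congr rfl fun γ _ => Finset.sum_congr rfl fun ε _ => ?_
    rw [C_mul]; ring
  rw [Finset.sum_congr rfl fun δ _ => h1 δ, Finset.sum_comm]
  refine Finset.sum_congr rfl fun γ hγ => ?_
  rw [Finset.sum_comm]
  have h2 : ∀ ε ∈ s, ∑ δ ∈ s, P γ * Q ε * C (E γ δ * E δ ε)
      = if γ = ε then P γ * Q ε else 0 := by
    intro ε hε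
    rw [← Finset.mul_sum, ← map_sum, hE γ hγ ε hε]
    split_ifs <;> simp
  rw [Finset.sum_congr rfl h2, Finset.sum_ite_eq, if_pos hγ]

/-- Both sides are `η(∂_a ∘ ∂_b, ∂_d)`; on the right the inverse metric in the product cancels
against the metric in the pairing. -/
theorem sum_structure_mul_pairing (hF : IsDPotentialWith N c t F) {a b d : ℕ}
    (ha : a ∈ Finset.Icc 1 N) (hb : b ∈ Finset.Icc 1 N) (hd : d ∈ Finset.Icc 1 N) :
    ∑ k ∈ Finset.Icc 1 N, c a b k * c k d (N - 1)
      = ∑ α ∈ Finset.Icc 1 N, ∑ β ∈ Finset.Icc 1 N, ∑ γ ∈ Finset.Icc 1 N,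
        pderiv a (t α) * pderiv b (t β) * pderiv d (t γ)
          * aeval t (pderiv α (pderiv β (pderiv γ F))) := by
  set s := Finset.Icc 1 N with hs
  have hprod : ∀ δ ∈ s, ∑ k ∈ s, c a b k * pderiv k (t δ)
      = ∑ γ ∈ s, (∑ α ∈ s, ∑ β ∈ s, pderiv a (t α) * pderiv b (t β)
        * aeval t (pderiv α (pderiv β (pderiv γ F)))) * C (dEta N γ δ) := by
    intro δ hδ
    rw [hF.product_eq a ha b hb δ hδ]
    rw [Finset.sum_congr rfl fun α _ => Finset.sum_comm, Finset.sum_comm]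
    refine Finset.sum_congr rfl fun γ _ => ?_
    rw [Finset.sum_mul]
    refine Finset.sum_congr rfl fun α _ => ?_
    rw [Finset.sum_mul]
  have hpair : ∀ k ∈ s, c a b k * c k d (N - 1) = ∑ δ ∈ s, (c a b k * pderiv k (t δ))
      * ∑ ε ∈ s, C (dEta N δ ε) * pderiv d (t ε) := by
    intro k hk
    rw [← hF.flat.pairing_eq k hk d hd, Finset.mul_sum]
    refine Finset.sum_congr rfl fun δ _ => ?_
    rw [Finset.mul_sum, Finset.mul_sum]
    refine Finset.sum_congr rfl fun ε _ => ?_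
    ring
  rw [Finset.sum_congr rfl hpair, Finset.sum_comm]
  have : ∀ δ ∈ s, ∑ k ∈ s, (c a b k * pderiv k (t δ))
      * ∑ ε ∈ s, C (dEta N δ ε) * pderiv d (t ε)
      = (∑ γ ∈ s, (∑ α ∈ s, ∑ β ∈ s, pderiv a (t α) * pderiv b (t β)
        * aeval t (pderiv α (pderiv β (pderiv γ F)))) * C (dEta N γ δ))
        * ∑ ε ∈ s, C (dEta N δ ε) * pderiv d (t ε) := by
    intro δ hδ
    rw [← hprod δ hδ, Finset.sum_mul]
  rw [Finset.sum_congr rfl this, sum_contract (fun α hα β hβ => dEta_mul_dEta N α β hα hβ)]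
  rw [Finset.sum_congr rfl fun α _ => Finset.sum_comm, Finset.sum_comm]
  refine Finset.sum_congr rfl fun γ _ => ?_
  rw [Finset.sum_mul]
  refine Finset.sum_congr rfl fun α _ => ?_
  rw [Finset.sum_mul]
  refine Finset.sum_congr rfl fun β _ => ?_
  ring

theorem C_mul_mul_C_mul_mul_C_mul {K : Type*} [CommRing K] (x y z : K) (P Q R : Polynomial K) :
    Polynomial.C x * P * (Polynomial.C y * Q) * (Polynomial.C z * R)
      = Polynomial.C (x * y * z) * (P * Q * R) := by
  rw [Polynomial.C_mul, Polynomial.C_mul]; ring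

theorem dRes_flatBasis_triple (hN : 3 ≤ N) (hF : IsDPotentialWith N c t F) {i j l : ℕ}
    (hi : i ∈ Finset.Icc 1 N) (hj : j ∈ Finset.Icc 1 N) (hl : l ∈ Finset.Icc 1 N) :
    dRes N (flatBasis N i * flatBasis N j * flatBasis N l)
      = algebraMap (MvPolynomial ℕ ℂ) FlatField
        (∑ α ∈ Finset.Icc 1 N, ∑ β ∈ Finset.Icc 1 N, ∑ γ ∈ Finset.Icc 1 N,
          pderiv i (vSubst N (t α)) * pderiv j (vSubst N (t β)) * pderiv l (vSubst N (t γ))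
            * vSubst N (aeval t (pderiv α (pderiv β (pderiv γ F))))) := by
  have hterm : ∀ a ∈ Finset.Icc 1 N, ∀ b ∈ Finset.Icc 1 N, ∀ d ∈ Finset.Icc 1 N,
      dRes N (basisPoly N a * basisPoly N b * basisPoly N d)
        = algebraMap (MvPolynomial ℕ ℂ) FlatField (vSubst N (∑ α ∈ Finset.Icc 1 N,
          ∑ β ∈ Finset.Icc 1 N, ∑ γ ∈ Finset.Icc 1 N, pderiv a (t α) * pderiv b (t β)
            * pderiv d (t γ) * aeval t (pderiv α (pderiv β (pderiv γ F))))) := by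
    intro a ha b hb d hd
    rw [dRes_basisPoly_mul (by omega) hF.structureConstants ha hb,
      ← sum_structure_mul_pairing hF ha hb hd, ← coeffMap_apply, map_sum]
    refine Finset.sum_congr rfl fun k hk => ?_
    rw [dRes_basisPoly_mul_basisPoly (by omega) hF.structureConstants hk hd, map_mul]
  have hsum : ∀ a ∈ Finset.Icc 1 N, ∀ b ∈ Finset.Icc 1 N, ∀ d ∈ Finset.Icc 1 N,
      dRes N (Polynomial.C (algebraMap (MvPolynomial ℕ ℂ) FlatField (pderiv i (vCoord N a)))
        * basisPoly N a
        * (Polynomial.C (algebraMap (MvPolynomial ℕ ℂ) FlatField (pderiv j (vCoord N b)))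
        * basisPoly N b)
        * (Polynomial.C (algebraMap (MvPolynomial ℕ ℂ) FlatField (pderiv l (vCoord N d)))
        * basisPoly N d))
      = algebraMap (MvPolynomial ℕ ℂ) FlatField (∑ α ∈ Finset.Icc 1 N,
          ∑ β ∈ Finset.Icc 1 N, ∑ γ ∈ Finset.Icc 1 N,
          (pderiv i (vCoord N a) * vSubst N (pderiv a (t α)))
            * (pderiv j (vCoord N b) * vSubst N (pderiv b (t β)))
            * (pderiv l (vCoord N d) * vSubst N (pderiv d (t γ)))
            * vSubst N (aeval t (pderiv α (pderiv β (pderiv γ F))))) := by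
    intro a ha b hb d hd
    rw [C_mul_mul_C_mul_mul_C_mul, dRes,
      resFunctional_C_mul, ← dRes, hterm a ha b hb d hd, ← map_mul, ← map_mul,
      ← map_mul]
    refine congrArg (algebraMap (MvPolynomial ℕ ℂ) FlatField) ?_
    rw [map_sum, Finset.mul_sum]
    refine Finset.sum_congr rfl fun α _ => ?_
    rw [map_sum, Finset.mul_sum]
    refine Finset.sum_congr rfl fun β _ => ?_
    rw [map_sum, Finset.mul_sum]
    refine Finset.sum_congr rfl fun γ _ => ?_
    rw [map_mul, map_mul, map_mul]; ring
  rw [flatBasis_eq hi, flatBasis_eq hj, flatBasis_eq hl, sum_mul_sum_mul_sum, map_sum,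
    Finset.sum_congr rfl fun a ha => by
      rw [map_sum, Finset.sum_congr rfl fun b hb => by
        rw [map_sum, Finset.sum_congr rfl fun d hd => hsum a ha b hb d hd]]]
  simp only [← map_sum]
  refine congrArg (algebraMap (MvPolynomial ℕ ℂ) FlatField) ?_
  rw [sum_sum_sum_comm]
  refine Finset.sum_congr rfl fun α hα => Finset.sum_congr rfl fun β hβ =>
    Finset.sum_congr rfl fun γ hγ => ?_
  rw [pderiv_vSubst (hF.flat.vars_subset α hα), pderiv_vSubst (hF.flat.vars_subset β hβ),
    pderiv_vSubst (hF.flat.vars_subset γ hγ), sum_mul_sum_mul_sum, Finset.sum_mul]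
  refine Finset.sum_congr rfl fun a _ => ?_
  rw [Finset.sum_mul]
  refine Finset.sum_congr rfl fun b _ => ?_
  rw [Finset.sum_mul]

/-- The substitution of `r v_N` for `t_N`. -/
noncomputable def flatScale (N : ℕ) (r : ℂ) : MvPolynomial ℕ ℂ →ₐ[ℂ] MvPolynomial ℕ ℂ :=
  aeval fun α => if α = N then C r * X N else X α

/-- The factor of `∂/∂t_i` relative to `∂/∂v_N`. -/
noncomputable def scaleFactor (N : ℕ) (r : ℂ) (i : ℕ) : ℂ := if i = N then r else 1

theorem vSubst_flat_eq (hN : 3 ≤ N) (hF : IsDPotentialWith N c t F) {r : ℂ}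
    (hr : t N = C r * X N) {α : ℕ} (hα : α ∈ Finset.Icc 1 N) :
    vSubst N (t α) = if α = N then C r * X N else X α := by
  split_ifs with h
  · rw [h, hr, map_mul, algHom_C, algebraMap_eq, vSubst, aeval_X, vCoord, if_pos rfl]
  · refine vSubst_flat hN hF.structureConstants hF.flat ?_
    rw [Finset.mem_Icc] at hα ⊢; omega

theorem vSubst_aeval_flat (hN : 3 ≤ N) (hF : IsDPotentialWith N c t F) {r : ℂ}
    (hr : t N = C r * X N) {p : MvPolynomial ℕ ℂ} (hp : p.vars ⊆ Finset.Icc 1 N) :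
    vSubst N (aeval t p) = flatScale N r p := by
  rw [comp_aeval_apply, flatScale]
  exact aeval_congr_of_vars hp fun α hα => vSubst_flat_eq hN hF hr hα

/-- The Jacobian from `t_1, …, t_{N-1}, v_N` to the flat coordinates is diagonal with entries `1, …,
1, r`, so the triple sum in `dRes_flatBasis_triple` has one surviving term. -/
theorem flatScale_third (hN : 3 ≤ N) (hF : IsDPotentialWith N c t F) {r : ℂ}
    (hr : t N = C r * X N) {i j l : ℕ}
    (hi : i ∈ Finset.Icc 1 N) (hj : j ∈ Finset.Icc 1 N) (hl : l ∈ Finset.Icc 1 N) :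
    algebraMap (MvPolynomial ℕ ℂ) FlatField
      (C (scaleFactor N r i * scaleFactor N r j * scaleFactor N r l)
        * flatScale N r (pderiv i (pderiv j (pderiv l F))))
      = dRes N (flatBasis N i * flatBasis N j * flatBasis N l) := by
  rw [dRes_flatBasis_triple hN hF hi hj hl]
  refine congrArg (algebraMap (MvPolynomial ℕ ℂ) FlatField) ?_
  have hd : ∀ k, ∀ α ∈ Finset.Icc 1 N, pderiv k (vSubst N (t α))
      = if α = k then C (scaleFactor N r k) else 0 := by
    intro k α hα
    rw [vSubst_flat_eq hN hF hr hα, scaleFactor]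
    by_cases h : α = N
    · rw [if_pos h, pderiv_C_mul]
      by_cases hk : N = k
      · rw [if_pos (h.trans hk), if_pos hk.symm, hk, pderiv_X_self, mul_one]
      · rw [if_neg (by omega), pderiv_X_of_ne hk, mul_zero]
    · rw [if_neg h]
      by_cases hk : α = k
      · rw [if_pos hk, if_neg (by omega), hk, pderiv_X_self, C_1]
      · rw [if_neg hk, pderiv_X_of_ne hk]
  have hv : ∀ α β γ, (pderiv α (pderiv β (pderiv γ F))).vars ⊆ Finset.Icc 1 N := fun α β γ =>
    vars_pderiv_subset (vars_pderiv_subset (vars_pderiv_subset hF.vars_subset _) _) _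
  rw [Finset.sum_congr rfl fun α hα => Finset.sum_congr rfl fun β hβ =>
    Finset.sum_congr rfl fun γ hγ => by
      rw [hd i α hα, hd j β hβ, hd l γ hγ, vSubst_aeval_flat hN hF hr (hv α β γ)]]
  simp only [ite_mul, mul_ite, zero_mul, mul_zero, Finset.sum_ite_eq', hi, hj, hl, if_true, C_mul]

end ThirdDerivatives

/-! ### Quasi-homogeneity and vanishing constant terms -/

section Euler

theorem constantCoeff_eq_zero_of_euler {K : Type*} [Field K] {s : Finset ℕ}
    {w : ℕ → K} {d : K} {p : MvPolynomial ℕ K}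
    (h : ∑ α ∈ s, C (w α) * X α * pderiv α p = C d * p) (hd : d ≠ 0) : constantCoeff p = 0 := by
  have h1 := congrArg constantCoeff h
  rw [map_sum, map_mul, constantCoeff_C, Finset.sum_eq_zero fun α _ => by simp] at h1
  exact (mul_eq_zero.1 h1.symm).resolve_left hd

theorem euler_pderiv {K : Type*} [Field K] {s : Finset ℕ}
    {w : ℕ → K} {d : K} {p : MvPolynomial ℕ K}
    (h : ∑ α ∈ s, C (w α) * X α * pderiv α p = C d * p) {i : ℕ} (hi : i ∈ s) :
    ∑ α ∈ s, C (w α) * X α * pderiv α (pderiv i p) = C (d - w i) * pderiv i p := by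
  have h1 := congrArg (pderiv i) h
  rw [map_sum, pderiv_C_mul] at h1
  have h2 : ∀ α ∈ s, pderiv i (C (w α) * X α * pderiv α p)
      = C (w α) * X α * pderiv α (pderiv i p) + if α = i then C (w i) * pderiv i p else 0 := by
    intro α _
    rw [pderiv_mul, pderiv_C_mul, pderiv_comm i α]
    split_ifs with h
    · rw [h, pderiv_X_self]; ring
    · rw [pderiv_X_of_ne h]; ring
  rw [Finset.sum_congr rfl h2, Finset.sum_add_distrib, Finset.sum_ite_eq', if_pos hi] at h1
  rw [C_sub]
  linear_combination h1

/-- The weight of `t_α`. -/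
noncomputable def flatWeight (N α : ℕ) : ℂ :=
  if α = N then (N : ℂ) / (2 * ((N : ℂ) - 1)) else ((N : ℂ) - α) / ((N : ℂ) - 1)

variable {N : ℕ} {c : ℕ → ℕ → ℕ → MvPolynomial ℕ ℂ} {t : ℕ → MvPolynomial ℕ ℂ}
  {F : MvPolynomial ℕ ℂ}

theorem sum_flatWeight (hN : 3 ≤ N) (hF : IsDPotentialWith N c t F) :
    ∑ α ∈ Finset.Icc 1 N, C (flatWeight N α) * X α * pderiv α F
      = C (3 - ((N : ℂ) - 2) / ((N : ℂ) - 1)) * F := by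
  rw [← hF.euler_eq]
  obtain ⟨M, rfl⟩ : ∃ M, N = M + 1 := ⟨N - 1, by omega⟩
  rw [Nat.add_sub_cancel, Finset.sum_Icc_succ_top (by omega)]
  congr 1
  · refine Finset.sum_congr rfl fun α hα => ?_
    rw [Finset.mem_Icc] at hα
    rw [flatWeight, if_neg (by omega)]
  · rw [flatWeight, if_pos rfl]

theorem constantCoeff_pderiv_potential (hN : 3 ≤ N) (hF : IsDPotentialWith N c t F) {i : ℕ}
    (hi : i ∈ Finset.Icc 1 N) : constantCoeff (pderiv i F) = 0 := by
  refine constantCoeff_eq_zero_of_euler (euler_pderiv (sum_flatWeight hN hF) hi) ?_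
  rw [Finset.mem_Icc] at hi
  obtain ⟨M, rfl⟩ : ∃ M, N = M + 3 := ⟨N - 3, by omega⟩
  obtain ⟨k, rfl⟩ : ∃ k, i = k + 1 := ⟨i - 1, by omega⟩
  have hM : ((M + 3 : ℕ) : ℂ) - 1 ≠ 0 := by
    rw [show ((M + 3 : ℕ) : ℂ) - 1 = ((M + 2 : ℕ) : ℂ) by push_cast; ring]
    exact Nat.cast_ne_zero.2 (by omega)
  rw [flatWeight]
  split_ifs
  · rw [show (3 - (((M + 3 : ℕ) : ℂ) - 2) / (((M + 3 : ℕ) : ℂ) - 1)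
      - ((M + 3 : ℕ) : ℂ) / (2 * (((M + 3 : ℕ) : ℂ) - 1)))
      = ((3 * M + 7 : ℕ) : ℂ) / (2 * (((M + 3 : ℕ) : ℂ) - 1)) by
        field_simp; push_cast; ring]
    exact div_ne_zero (Nat.cast_ne_zero.2 (by omega)) (mul_ne_zero two_ne_zero hM)
  · rw [show (3 - (((M + 3 : ℕ) : ℂ) - 2) / (((M + 3 : ℕ) : ℂ) - 1)
      - (((M + 3 : ℕ) : ℂ) - ((k + 1 : ℕ) : ℂ)) / (((M + 3 : ℕ) : ℂ) - 1))
      = ((M + k + 3 : ℕ) : ℂ) / (((M + 3 : ℕ) : ℂ) - 1) by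
        field_simp; push_cast; ring]
    exact div_ne_zero (Nat.cast_ne_zero.2 (by omega)) hM

/-- The weight of `∂_i ∂_j F` is `(i + j - 1)/(N - 1)` for `i, j < N`, `(N + 2i - 2)/(2(N - 1))` for
`i < N = j` (symmetrically in `i, j`), and `1` for `i = j = N`. None of these is zero, which fixes
the constants of integration. -/
theorem constantCoeff_pderiv_pderiv_potential (hN : 3 ≤ N) (hF : IsDPotentialWith N c t F)
    {i j : ℕ} (hi : i ∈ Finset.Icc 1 N) (hj : j ∈ Finset.Icc 1 N) :
    constantCoeff (pderiv i (pderiv j F)) = 0 := by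
  refine constantCoeff_eq_zero_of_euler
    (euler_pderiv (euler_pderiv (sum_flatWeight hN hF) hj) hi) ?_
  rw [Finset.mem_Icc] at hi hj
  obtain ⟨M, rfl⟩ : ∃ M, N = M + 3 := ⟨N - 3, by omega⟩
  obtain ⟨k, rfl⟩ : ∃ k, i = k + 1 := ⟨i - 1, by omega⟩
  obtain ⟨l, rfl⟩ : ∃ k, j = k + 1 := ⟨j - 1, by omega⟩
  have hM : ((M + 3 : ℕ) : ℂ) - 1 ≠ 0 := by
    rw [show ((M + 3 : ℕ) : ℂ) - 1 = ((M + 2 : ℕ) : ℂ) by push_cast; ring]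
    exact Nat.cast_ne_zero.2 (by omega)
  rw [flatWeight, flatWeight]
  split_ifs
  · rw [show (3 - (((M + 3 : ℕ) : ℂ) - 2) / (((M + 3 : ℕ) : ℂ) - 1)
      - ((M + 3 : ℕ) : ℂ) / (2 * (((M + 3 : ℕ) : ℂ) - 1))
      - ((M + 3 : ℕ) : ℂ) / (2 * (((M + 3 : ℕ) : ℂ) - 1))) = 1 by
        field_simp; push_cast; ring]
    exact one_ne_zero
  · rw [show (3 - (((M + 3 : ℕ) : ℂ) - 2) / (((M + 3 : ℕ) : ℂ) - 1)
      - ((M + 3 : ℕ) : ℂ) / (2 * (((M + 3 : ℕ) : ℂ) - 1))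
      - (((M + 3 : ℕ) : ℂ) - ((k + 1 : ℕ) : ℂ)) / (((M + 3 : ℕ) : ℂ) - 1))
      = ((M + 2 * k + 3 : ℕ) : ℂ) / (2 * (((M + 3 : ℕ) : ℂ) - 1)) by
        field_simp; push_cast; ring]
    exact div_ne_zero (Nat.cast_ne_zero.2 (by omega)) (mul_ne_zero two_ne_zero hM)
  · rw [show (3 - (((M + 3 : ℕ) : ℂ) - 2) / (((M + 3 : ℕ) : ℂ) - 1)
      - (((M + 3 : ℕ) : ℂ) - ((l + 1 : ℕ) : ℂ)) / (((M + 3 : ℕ) : ℂ) - 1)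
      - ((M + 3 : ℕ) : ℂ) / (2 * (((M + 3 : ℕ) : ℂ) - 1)))
      = ((M + 2 * l + 3 : ℕ) : ℂ) / (2 * (((M + 3 : ℕ) : ℂ) - 1)) by
        field_simp; push_cast; ring]
    exact div_ne_zero (Nat.cast_ne_zero.2 (by omega)) (mul_ne_zero two_ne_zero hM)
  · rw [show (3 - (((M + 3 : ℕ) : ℂ) - 2) / (((M + 3 : ℕ) : ℂ) - 1)
      - (((M + 3 : ℕ) : ℂ) - ((l + 1 : ℕ) : ℂ)) / (((M + 3 : ℕ) : ℂ) - 1)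
      - (((M + 3 : ℕ) : ℂ) - ((k + 1 : ℕ) : ℂ)) / (((M + 3 : ℕ) : ℂ) - 1))
      = ((k + l + 1 : ℕ) : ℂ) / (((M + 3 : ℕ) : ℂ) - 1) by
        field_simp; push_cast; ring]
    exact div_ne_zero (Nat.cast_ne_zero.2 (by omega)) hM

end Euler

/-! ### Restriction to `t_N = 0` and descent to rational coefficients -/

section SetZero

variable {K : Type*} [Field K]

/-- The restriction to the hyperplane `t_N = 0`. -/
noncomputable def setZero (N : ℕ) : MvPolynomial ℕ K →ₐ[K] MvPolynomial ℕ K :=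
  aeval fun j => if j = N then 0 else X j

theorem pderiv_setZero {N i : ℕ} (hi : i ≠ N) (p : MvPolynomial ℕ K) :
    pderiv i (setZero N p) = setZero N (pderiv i p) := by
  rw [setZero, pderiv_aeval _ (s := p.vars) subset_rfl i]
  have h : ∀ a ∈ p.vars, pderiv i (if a = N then (0 : MvPolynomial ℕ K) else X a)
      * aeval (fun j => if j = N then (0 : MvPolynomial ℕ K) else X j) (pderiv a p)
      = if a = i then aeval (fun j => if j = N then (0 : MvPolynomial ℕ K) else X j) (pderiv i p)
        else 0 := by
    intro a _
    by_cases ha : a = i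
    · subst ha
      rw [if_neg hi, if_pos rfl, pderiv_X_self, one_mul]
    · rw [if_neg ha]
      split_ifs
      · rw [map_zero, zero_mul]
      · rw [pderiv_X_of_ne ha, zero_mul]
  rw [Finset.sum_congr rfl h, Finset.sum_ite_eq']
  split_ifs with hv
  · rfl
  · rw [pderiv_eq_zero_of_notMem_vars hv, map_zero]

theorem pderiv_setZero_self (N : ℕ) (p : MvPolynomial ℕ K) : pderiv N (setZero N p) = 0 := by
  rw [setZero, pderiv_aeval _ (s := p.vars) subset_rfl N]
  refine Finset.sum_eq_zero fun a _ => ?_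
  split_ifs with h
  · rw [map_zero, zero_mul]
  · rw [pderiv_X_of_ne h, zero_mul]

theorem aeval_eq_self_of_pderiv_eq_zero [CharZero K] {N : ℕ} {p : MvPolynomial ℕ K}
    (hp : pderiv N p = 0) {g : ℕ → MvPolynomial ℕ K} (hg : ∀ j, j ≠ N → g j = X j) :
    aeval g p = p := by
  have hv : p.vars ⊆ p.vars.erase N := by
    refine vars_subset_of_pderiv_eq_zero fun i hi => ?_
    by_cases h : i = N
    · rw [h, hp]
    · exact pderiv_eq_zero_of_notMem_vars fun h2 => hi (Finset.mem_erase.2 ⟨h, h2⟩)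
  rw [aeval_congr_of_vars hv (g' := X) fun a ha => hg a (Finset.ne_of_mem_erase ha),
    aeval_X_left_apply]

theorem setZero_eq_self [CharZero K] {N : ℕ} {p : MvPolynomial ℕ K} (hp : pderiv N p = 0) :
    setZero N p = p :=
  aeval_eq_self_of_pderiv_eq_zero hp fun _ hj => if_neg hj

theorem setZero_X_self (N : ℕ) : setZero N (X N : MvPolynomial ℕ K) = 0 := by
  rw [setZero, aeval_X, if_pos rfl]

theorem eq_of_pderiv_eq_of_setZero_eq [CharZero K] {N : ℕ} {p q : MvPolynomial ℕ K}
    (h : pderiv N p = pderiv N q) (h0 : setZero N p = setZero N q) : p = q := by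
  rw [← sub_eq_zero, ← setZero_eq_self (N := N) (p := p - q) (by rw [map_sub, h, sub_self]),
    map_sub, h0, sub_self]

theorem constantCoeff_setZero (N : ℕ) (p : MvPolynomial ℕ K) :
    constantCoeff (setZero N p) = constantCoeff p := by
  have h : constantCoeff.comp (setZero N : MvPolynomial ℕ K →ₐ[K] MvPolynomial ℕ K).toRingHom
      = constantCoeff := by
    refine ringHom_ext (fun r => by simp) fun i => ?_
    simp only [setZero, AlgHom.toRingHom_eq_coe, RingHom.comp_apply, RingHom.coe_coe, aeval_X,
      constantCoeff_X]
    split_ifs <;> simp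
  exact congrArg (fun f => f p) h

theorem setZero_ratMap (N : ℕ) (p : MvPolynomial ℕ ℚ) :
    setZero N (ratMap p) = ratMap (setZero N p) := by
  have h : (setZero N : MvPolynomial ℕ ℂ →ₐ[ℂ] MvPolynomial ℕ ℂ).toRingHom.comp ratMap
      = ratMap.comp (setZero N : MvPolynomial ℕ ℚ →ₐ[ℚ] MvPolynomial ℕ ℚ).toRingHom := by
    refine ringHom_ext (fun r => by simp [ratMap]) fun i => ?_
    simp only [setZero, ratMap, AlgHom.toRingHom_eq_coe, RingHom.comp_apply, RingHom.coe_coe,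
      aeval_X, map_X]
    split_ifs <;> simp
  exact congrArg (fun f => f p) h

theorem setZero_flatScale (N : ℕ) (r : ℂ) (p : MvPolynomial ℕ ℂ) :
    setZero N (flatScale N r p) = setZero N p := by
  have h : (setZero N : MvPolynomial ℕ ℂ →ₐ[ℂ] MvPolynomial ℕ ℂ).comp (flatScale N r)
      = setZero N := by
    refine algHom_ext fun i => ?_
    simp only [setZero, flatScale, AlgHom.comp_apply, aeval_X]
    split_ifs with h
    · simp
    · simp [h]
  exact congrArg (fun f => f p) h

theorem eq_of_flatScale_eq {N : ℕ} {r : ℂ} (hr : r ≠ 0) {p q : MvPolynomial ℕ ℂ}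
    (h : flatScale N r p = q) (hq : pderiv N q = 0) : p = q := by
  have h1 : (flatScale N r⁻¹).comp (flatScale N r) = AlgHom.id ℂ _ := by
    refine algHom_ext fun i => ?_
    simp only [flatScale, AlgHom.comp_apply, aeval_X, AlgHom.id_apply]
    split_ifs with hi
    · rw [map_mul, algHom_C, algebraMap_eq, aeval_X, if_pos rfl, ← mul_assoc, ← C_mul,
        mul_inv_cancel₀ hr, C_1, one_mul, hi]
    · rw [aeval_X, if_neg hi]
  have h2 := congrArg (fun f => f p) h1
  simp only [AlgHom.comp_apply, AlgHom.id_apply] at h2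
  rw [← h2, h]
  exact aeval_eq_self_of_pderiv_eq_zero hq fun _ hj => if_neg hj

/-- A coefficient at a nonconstant monomial is a coefficient of some partial derivative divided by a
positive integer. -/
theorem mem_range_ratMap_of_pderiv {p : MvPolynomial ℕ ℂ}
    (h : ∀ i, pderiv i p ∈ Set.range ratMap) (h0 : constantCoeff p = 0) :
    p ∈ Set.range ratMap := by
  rw [ratMap, mem_range_map_iff_coeffs_subset]
  intro x hx
  obtain ⟨m, -, rfl⟩ := mem_coeffs_iff.1 hx
  by_cases hm : m = 0
  · rw [hm, ← constantCoeff_eq, h0]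
    exact ⟨0, map_zero _⟩
  · obtain ⟨i, hi⟩ := Finsupp.ne_iff.1 hm
    have hi' : 1 ≤ m i := Nat.one_le_iff_ne_zero.2 hi
    obtain ⟨q, hq⟩ := h i
    have h1 := congrArg (coeff (m - Finsupp.single i 1)) hq
    rw [coeff_pderiv, tsub_add_cancel_of_le (Finsupp.single_le_iff.2 hi'), ratMap, coeff_map] at h1
    have h2 : (((m - Finsupp.single i 1 : ℕ →₀ ℕ) i : ℕ) : ℂ) + 1 ≠ 0 := Nat.cast_add_one_ne_zero _
    refine ⟨coeff (m - Finsupp.single i 1) q / (((m - Finsupp.single i 1 : ℕ →₀ ℕ) i : ℕ) + 1), ?_⟩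
    rw [map_div₀, h1, map_add, map_natCast, map_one, mul_div_cancel_right₀ _ h2]

end SetZero

/-! ### Integration of the third derivatives -/

section Decomposition

/-- Algebraic independence of the `vCoord N k`: their Jacobian is unitriangular, so a relation is
inherited by all partial derivatives of `p`, and induction on the degree applies. -/
theorem coeff_eq_zero_of_vSubst {N : ℕ} (n : ℕ) : ∀ p : MvPolynomial ℕ ℂ,
    p.vars ⊆ Finset.Icc 1 N → vSubst N p = 0 → ∀ m : ℕ →₀ ℕ, m.degree = n → coeff m p = 0 := by
  induction n with
  | zero =>
    intro p hp h m hm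
    rw [(Finsupp.degree_eq_zero_iff m).1 hm, ← constantCoeff_eq, ← constantCoeff_vSubst hp, h,
      map_zero]
  | succ n ih =>
    intro p hp h m hm
    -- In the chain rule for `∂/∂t_i` the terms `a < i` vanish by induction and the terms `i < a`
    -- because `φ_{i-1}` has degree `i - 1`; the term `a = i` has coefficient `1`.
    have hd : ∀ i, i < N → 1 ≤ i → vSubst N (pderiv i p) = 0 := by
      intro i
      induction i using Nat.strong_induction_on with
      | _ i ihi =>
        intro hiN hi
        have h1 := pderiv_vSubst hp i
        rw [h, map_zero, Finset.sum_eq_single i] at h1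
        · rw [vCoord, if_neg (by omega), pderiv_ratMap, pderiv_vFlat hi hiN hi hiN,
            coeff_flatPhi, if_pos le_rfl, Nat.sub_self, PowerSeries.coeff_zero_eq_constantCoeff,
            map_pow, constantCoeff_flatE, one_pow, map_one, one_mul] at h1
          exact h1.symm
        · intro a ha hai
          rw [Finset.mem_Icc] at ha
          rcases lt_or_gt_of_ne hai with h2 | h2
          · rw [ihi a h2 (by omega) (by omega), mul_zero]
          · rw [vCoord]
            split_ifs with haN
            · rw [pderiv_X_of_ne (by omega), zero_mul]
            · rw [pderiv_ratMap, pderiv_vFlat hi hiN ha.1 (by omega), coeff_flatPhi,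
                if_neg (by omega), map_zero, zero_mul]
        · intro h2
          exact absurd (Finset.mem_Icc.2 ⟨hi, hiN.le⟩) h2
    have hd' : ∀ i, vSubst N (pderiv i p) = 0 := by
      intro i
      by_cases hi : i ∈ Finset.Icc 1 N
      · rw [Finset.mem_Icc] at hi
        rcases lt_or_eq_of_le hi.2 with h2 | h2
        · exact hd i h2 hi.1
        · have h1 := pderiv_vSubst hp i
          rw [h, map_zero, Finset.sum_eq_single i] at h1
          · rw [vCoord, if_pos h2, ← h2, pderiv_X_self, one_mul] at h1
            rw [← h2]
            exact h1.symm
          · intro a ha hai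
            rw [Finset.mem_Icc] at ha
            rw [hd a (by omega) ha.1, mul_zero]
          · intro h3
            exact absurd (Finset.mem_Icc.2 hi) h3
      · rw [pderiv_eq_zero_of_notMem_vars fun h2 => hi (hp h2), map_zero]
    have hm0 : m ≠ 0 := by
      rintro rfl
      simp at hm
    obtain ⟨i, hi⟩ := Finsupp.ne_iff.1 hm0
    have hi' : 1 ≤ m i := Nat.one_le_iff_ne_zero.2 hi
    have hle := Finsupp.single_le_iff.2 hi'
    have h1 := ih (pderiv i p) (vars_pderiv_subset hp i) (hd' i) (m - Finsupp.single i 1) (by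
      have h2 := congrArg Finsupp.degree (tsub_add_cancel_of_le hle)
      rw [map_add, Finsupp.degree_single, hm] at h2
      omega)
    rw [coeff_pderiv, tsub_add_cancel_of_le hle] at h1
    exact (mul_eq_zero.1 h1).resolve_right (Nat.cast_add_one_ne_zero _)

theorem vSubst_injective {N : ℕ} {p q : MvPolynomial ℕ ℂ} (hp : p.vars ⊆ Finset.Icc 1 N)
    (hq : q.vars ⊆ Finset.Icc 1 N) (h : vSubst N p = vSubst N q) : p = q := by
  rw [← sub_eq_zero]
  ext m
  rw [coeff_zero]
  classical
  exact coeff_eq_zero_of_vSubst _ _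
    ((vars_sub_subset (p := p) (q := q)).trans (Finset.union_subset hp hq))
    (by rw [map_sub, h, sub_self]) m rfl

variable {N : ℕ} {c : ℕ → ℕ → ℕ → MvPolynomial ℕ ℂ} {t : ℕ → MvPolynomial ℕ ℂ}
  {F : MvPolynomial ℕ ℂ}

/-- `vSubst` turns `t_α` into the variable `X α`, so both sides acquire the same image, and `vSubst`
is injective. -/
theorem aeval_vFlat_one (hN : 3 ≤ N) (hF : IsDPotentialWith N c t F) :
    aeval t (vFlat N 1) = (X 1 : MvPolynomial ℕ ℂ) := by
  have hvars := vars_vFlat (N := N) 1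
  have hI : ∀ {α}, α ∈ Finset.Icc 1 (N - 1) → α ∈ Finset.Icc 1 N := by
    intro α hα; rw [Finset.mem_Icc] at *; omega
  have h1 : aeval t (vFlat N 1) = aeval t (ratMap (vFlat N 1)) := by
    rw [ratMap, aeval_map_algebraMap]
  rw [h1]
  have hv : (ratMap (vFlat N 1)).vars ⊆ Finset.Icc 1 (N - 1) := (vars_map _ _).trans hvars
  obtain ⟨r, hr⟩ := hF.flat.last_eq
  have hv' : (ratMap (vFlat N 1)).vars ⊆ Finset.Icc 1 N := fun a ha => hI (hv ha)
  refine vSubst_injective (N := N) ?_ ?_ ?_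
  · refine vars_subset_of_pderiv_eq_zero fun i hi => ?_
    rw [pderiv_aeval _ hv']
    refine Finset.sum_eq_zero fun a ha => ?_
    rw [pderiv_eq_zero_of_notMem_vars fun h => hi (hF.flat.vars_subset a ha h), zero_mul]
  · rw [vars_X, Finset.singleton_subset_iff, Finset.mem_Icc]; omega
  · rw [comp_aeval_apply, aeval_congr_of_vars hv (g' := X) fun a ha => by
      rw [vSubst_flat hN hF.structureConstants hF.flat ha], aeval_X_left_apply, vSubst, aeval_X,
      vCoord, if_neg (by omega)]

/-- For `k < N` the residue of `φ_{k-1} y²` is `-φ_{k-1}(0)`, and `r² = -1` cancels the sign; for `k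
= N` the residue of `y³` is zero. -/
theorem third_last_last (hN : 3 ≤ N) (hF : IsDPotentialWith N c t F) (k : ℕ) :
    pderiv k (pderiv N (pderiv N F)) = ratMap (pderiv k (vFlat N 1)) := by
  obtain ⟨r, hr⟩ := hF.flat.last_eq
  have hr2 := sq_eq_neg_one hN hF.structureConstants hF.flat hr
  have hr0 : r ≠ 0 := by
    rintro rfl
    norm_num at hr2
  have hNN : N ∈ Finset.Icc 1 N := Finset.mem_Icc.2 ⟨by omega, le_rfl⟩
  by_cases hk : k ∈ Finset.Icc 1 N
  · have h := flatScale_third hN hF hr hk hNN hNN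
    rw [Finset.mem_Icc] at hk
    by_cases hkN : k = N
    · subst hkN
      rw [flatBasis, if_pos rfl, dRes_yPoly_cube, scaleFactor, if_pos rfl, map_eq_zero_iff _
        (IsFractionRing.injective (MvPolynomial ℕ ℂ) FlatField)] at h
      have h2 : (C (r * r * r) : MvPolynomial ℕ ℂ) ≠ 0 := by
        rw [Ne, C_eq_zero]; exact mul_ne_zero (mul_ne_zero hr0 hr0) hr0
      rw [eq_of_flatScale_eq hr0 ((mul_eq_zero.1 h).resolve_left h2) (map_zero _),
        pderiv_vFlat_eq_zero (Or.inr le_rfl), map_zero]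
    · rw [flatBasis, if_neg hkN, flatBasis, if_pos rfl,
        dRes_yPoly_mul_yPoly_mul_flatPhi (by omega), ratField, RingHom.comp_apply] at h
      have h1 := IsFractionRing.injective (MvPolynomial ℕ ℂ) FlatField h
      rw [scaleFactor, if_neg hkN, scaleFactor, if_pos rfl, one_mul, ← pow_two, hr2, map_neg,
        C_1, neg_mul, one_mul, map_neg, neg_inj] at h1
      rw [pderiv_vFlat hk.1 (by omega) le_rfl (by omega), Nat.sub_self]
      refine eq_of_flatScale_eq hr0 h1 ?_
      rw [pderiv_ratMap, ← Nat.sub_self 1, ← pderiv_vFlat hk.1 (by omega) le_rfl (by omega),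
        pderiv_comm, pderiv_vFlat_eq_zero (Or.inr le_rfl), map_zero, map_zero]
  · have hv := vars_pderiv_subset (vars_pderiv_subset hF.vars_subset N) N
    rw [pderiv_eq_zero_of_notMem_vars fun h => hk (hv h)]
    rw [Finset.mem_Icc] at hk
    rw [pderiv_vFlat_eq_zero (by omega), map_zero]

theorem pderiv_last_last (hN : 3 ≤ N) (hF : IsDPotentialWith N c t F) :
    pderiv N (pderiv N F) = ratMap (vFlat N 1) := by
  have hNN : N ∈ Finset.Icc 1 N := Finset.mem_Icc.2 ⟨by omega, le_rfl⟩
  refine eq_of_pderiv_eq (fun i => ?_) ?_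
  · rw [third_last_last hN hF, pderiv_ratMap]
  · rw [constantCoeff_pderiv_pderiv_potential hN hF hNN hNN, ratMap, constantCoeff_map,
      constantCoeff_vFlat (by omega), map_zero]

/-- The residue `L(φ_i φ_j φ_l)`. -/
noncomputable def flatTriple (N i j l : ℕ) : MvPolynomial ℕ ℚ :=
  ((Polynomial.X * (flatPhi N (i - 1) * flatPhi N (j - 1) * flatPhi N (l - 1)))
    %ₘ relFlat N).coeff (N - 2 + 1)

theorem setZero_third (hN : 3 ≤ N) (hF : IsDPotentialWith N c t F) {i j l : ℕ}
    (hi : i ∈ Finset.Icc 1 (N - 1)) (hj : j ∈ Finset.Icc 1 (N - 1))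
    (hl : l ∈ Finset.Icc 1 (N - 1)) :
    setZero N (pderiv i (pderiv j (pderiv l F))) = ratMap (setZero N (flatTriple N i j l)) := by
  obtain ⟨r, hr⟩ := hF.flat.last_eq
  rw [Finset.mem_Icc] at hi hj hl
  have h := flatScale_third hN hF hr (i := i) (j := j) (l := l)
    (by rw [Finset.mem_Icc]; omega) (by rw [Finset.mem_Icc]; omega) (by rw [Finset.mem_Icc]; omega)
  rw [scaleFactor, scaleFactor, scaleFactor, if_neg (by omega), if_neg (by omega),
    if_neg (by omega), flatBasis, flatBasis, flatBasis, if_neg (by omega), if_neg (by omega),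
    if_neg (by omega), ← Polynomial.map_mul, ← Polynomial.map_mul, dRes_map, ratField,
    RingHom.comp_apply] at h
  have h1 := IsFractionRing.injective (MvPolynomial ℕ ℂ) FlatField h
  rw [mul_one, mul_one, C_1, one_mul] at h1
  rw [← setZero_flatScale N r, h1, setZero_ratMap, flatTriple]

theorem setZero_third_last (hN : 3 ≤ N) (hF : IsDPotentialWith N c t F) {i j : ℕ}
    (hi : i ∈ Finset.Icc 1 (N - 1)) (hj : j ∈ Finset.Icc 1 (N - 1)) :
    setZero N (pderiv i (pderiv j (pderiv N F))) = 0 := by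
  obtain ⟨r, hr⟩ := hF.flat.last_eq
  have hr2 := sq_eq_neg_one hN hF.structureConstants hF.flat hr
  have hr0 : r ≠ 0 := by
    rintro rfl
    norm_num at hr2
  rw [Finset.mem_Icc] at hi hj
  have h := flatScale_third hN hF hr (i := i) (j := j) (l := N)
    (by rw [Finset.mem_Icc]; omega) (by rw [Finset.mem_Icc]; omega) (by rw [Finset.mem_Icc]; omega)
  rw [scaleFactor, scaleFactor, scaleFactor, if_neg (by omega), if_neg (by omega),
    if_pos rfl, flatBasis, flatBasis, flatBasis, if_neg (by omega), if_neg (by omega),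
    if_pos rfl, dRes_flatPhi_mul_yPoly, ratField, RingHom.comp_apply] at h
  have h1 := congrArg (setZero N) (IsFractionRing.injective (MvPolynomial ℕ ℂ) FlatField h)
  rw [one_mul, one_mul, map_mul, setZero_flatScale, setZero_ratMap, map_mul, setZero_X_self,
    zero_mul, map_zero, algHom_C, algebraMap_eq] at h1
  exact (mul_eq_zero.1 h1).resolve_left fun h0 => hr0 (C_eq_zero.1 h0)

/-- The `t_N`-derivatives agree by `pderiv_last_last`. On `t_N = 0` all second derivatives of
`∂F/∂t_N` vanish, and quasi-homogeneity excludes constant and linear terms. -/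
theorem pderiv_last (hN : 3 ≤ N) (hF : IsDPotentialWith N c t F) :
    pderiv N F = ratMap (vFlat N 1) * X N := by
  have hNN : N ∈ Finset.Icc 1 N := Finset.mem_Icc.2 ⟨by omega, le_rfl⟩
  have hv0 : ∀ i, N ≤ i ∨ i = 0 → pderiv i (ratMap (vFlat N 1)) = 0 := by
    intro i hi
    rw [pderiv_ratMap, pderiv_vFlat_eq_zero hi.symm, map_zero]
  have hN1 : pderiv N (ratMap (vFlat N 1) * X N) = ratMap (vFlat N 1) := by
    rw [pderiv_mul, hv0 N (Or.inl le_rfl), pderiv_X_self, zero_mul, zero_add, mul_one]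
  refine eq_of_pderiv_eq_of_setZero_eq (N := N) (by rw [pderiv_last_last hN hF, hN1]) ?_
  rw [map_mul, setZero_X_self, mul_zero]
  refine eq_zero_of_pderiv_eq_zero (fun i => ?_) ?_
  · by_cases hiN : i = N
    · rw [hiN, pderiv_setZero_self]
    rw [pderiv_setZero hiN]
    by_cases hi : i ∈ Finset.Icc 1 N
    · have hi' : i ∈ Finset.Icc 1 (N - 1) := by rw [Finset.mem_Icc] at *; omega
      refine eq_zero_of_pderiv_eq_zero (fun j => ?_) ?_
      · by_cases hjN : j = N
        · rw [hjN, pderiv_setZero_self]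
        rw [pderiv_setZero hjN]
        by_cases hj : j ∈ Finset.Icc 1 (N - 1)
        · exact setZero_third_last hN hF hj hi'
        · have hv := vars_pderiv_subset (vars_pderiv_subset hF.vars_subset N) i
          rw [pderiv_eq_zero_of_notMem_vars fun h => hj ?_, map_zero]
          have := hv h
          rw [Finset.mem_Icc] at *; omega
      · rw [constantCoeff_setZero, constantCoeff_pderiv_pderiv_potential hN hF hi hNN]
    · have hv := vars_pderiv_subset hF.vars_subset N
      rw [pderiv_eq_zero_of_notMem_vars fun h => hi (hv h), map_zero]
  · rw [constantCoeff_setZero, constantCoeff_pderiv_potential hN hF hNN]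

theorem setZero_pderiv_mem_range (hN : 3 ≤ N) (hF : IsDPotentialWith N c t F) {γ : ℕ}
    (hγ : γ ∈ Finset.Icc 1 (N - 1)) : setZero N (pderiv γ F) ∈ Set.range ratMap := by
  have hI : ∀ {α}, α ∈ Finset.Icc 1 (N - 1) → α ∈ Finset.Icc 1 N := by
    intro α hα; rw [Finset.mem_Icc] at *; omega
  have key : ∀ (p : MvPolynomial ℕ ℂ), p.vars ⊆ Finset.Icc 1 N → ∀ i, i ∉ Finset.Icc 1 (N - 1) →
      pderiv i (setZero N p) = 0 := by
    intro p hp i hi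
    by_cases hiN : i = N
    · rw [hiN, pderiv_setZero_self]
    · rw [pderiv_setZero hiN, pderiv_eq_zero_of_notMem_vars fun h => hi ?_, map_zero]
      have := hp h
      rw [Finset.mem_Icc] at *; omega
  refine mem_range_ratMap_of_pderiv (fun i => ?_) ?_
  · by_cases hi : i ∈ Finset.Icc 1 (N - 1)
    · have hiN : i ≠ N := by rw [Finset.mem_Icc] at hi; omega
      rw [pderiv_setZero hiN]
      refine mem_range_ratMap_of_pderiv (fun j => ?_) ?_
      · by_cases hj : j ∈ Finset.Icc 1 (N - 1)
        · have hjN : j ≠ N := by rw [Finset.mem_Icc] at hj; omega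
          rw [pderiv_setZero hjN, setZero_third hN hF hj hi hγ]
          exact Set.mem_range_self _
        · rw [key _ (vars_pderiv_subset (vars_pderiv_subset hF.vars_subset _) _) j hj]
          exact ⟨0, map_zero _⟩
      · rw [constantCoeff_setZero, constantCoeff_pderiv_pderiv_potential hN hF (hI hi) (hI hγ)]
    · rw [key _ (vars_pderiv_subset hF.vars_subset _) i hi]
      exact ⟨0, map_zero _⟩
  · rw [constantCoeff_setZero, constantCoeff_pderiv_potential hN hF (hI hγ)]

theorem vars_subset_of_ratMap {s : Finset ℕ} {q : MvPolynomial ℕ ℚ}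
    (h : ∀ i ∉ s, pderiv i (ratMap q) = 0) : q.vars ⊆ s := by
  refine vars_subset_of_pderiv_eq_zero fun i hi => ratMap_injective ?_
  rw [← pderiv_ratMap, h i hi, map_zero]

/-- Integrate `∂_N ∂_γ F = (∂_γ v_1) t_N` in `t_N`, using that `v_1` does not involve `t_N`. -/
theorem pderiv_eq_setZero_add (hN : 3 ≤ N) (hF : IsDPotentialWith N c t F) {γ : ℕ}
    (hγ : γ ∈ Finset.Icc 1 (N - 1)) :
    pderiv γ F = setZero N (pderiv γ F)
      + ratMap (C (1 / 2) * pderiv γ (vFlat N 1)) * X N ^ 2 := by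
  have hγN : γ ≠ N := by rw [Finset.mem_Icc] at hγ; omega
  have hv : pderiv N (ratMap (C (1 / 2) * pderiv γ (vFlat N 1))) = 0 := by
    rw [pderiv_ratMap, pderiv_C_mul, pderiv_comm, pderiv_vFlat_eq_zero (Or.inr le_rfl), map_zero,
      mul_zero, map_zero]
  refine eq_of_pderiv_eq_of_setZero_eq (N := N) ?_ ?_
  · rw [pderiv_comm, pderiv_last hN hF, map_add, pderiv_setZero_self, pderiv_mul, pderiv_mul, hv,
      pderiv_X_of_ne hγN.symm, pderiv_pow, pderiv_X_self, pderiv_ratMap, map_mul]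
    have h2 : ratMap (C (1 / 2)) * 2 = 1 := by
      have h3 : (2 : MvPolynomial ℕ ℂ) = ratMap (C 2) := by
        rw [show (C 2 : MvPolynomial ℕ ℚ) = 2 from map_ofNat C 2, map_ofNat]
      rw [h3, ← map_mul, ← C_mul, show (1 / 2 : ℚ) * 2 = 1 by norm_num, C_1, map_one]
    push_cast
    linear_combination (-ratMap (pderiv γ (vFlat N 1)) * X N) * h2
  · rw [map_add, map_mul, map_pow, setZero_X_self, setZero_eq_self (pderiv_setZero_self N _)]
    ring

theorem exists_decomposition (hN : 3 ≤ N) (hF : IsDPotentialWith N c t F) :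
    ∃ (v₁ : MvPolynomial ℕ ℚ) (A B : ℕ → MvPolynomial ℕ ℚ), IsDDecomposition N t F v₁ A B := by
  have hA : ∀ γ, ∃ q, γ ∈ Finset.Icc 1 (N - 1) → ratMap q = setZero N (pderiv γ F) := by
    intro γ
    by_cases hγ : γ ∈ Finset.Icc 1 (N - 1)
    · obtain ⟨q, hq⟩ := setZero_pderiv_mem_range hN hF hγ
      exact ⟨q, fun _ => hq⟩
    · exact ⟨0, fun h => absurd h hγ⟩
  choose A hA using hA
  refine ⟨vFlat N 1, A, fun γ => C (1 / 2) * pderiv γ (vFlat N 1), vars_vFlat 1, ?_, ?_,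
    aeval_vFlat_one hN hF, ?_, pderiv_last hN hF⟩
  · intro γ hγ
    refine vars_subset_of_ratMap fun i hi => ?_
    rw [hA γ hγ]
    by_cases hiN : i = N
    · rw [hiN, pderiv_setZero_self]
    · rw [pderiv_setZero hiN, pderiv_eq_zero_of_notMem_vars fun h => hi ?_, map_zero]
      have := vars_pderiv_subset hF.vars_subset γ h
      rw [Finset.mem_Icc] at *; omega
  · intro γ _
    refine vars_subset_of_pderiv_eq_zero fun i hi => ?_
    rw [pderiv_C_mul, pderiv_comm, pderiv_vFlat_eq_zero (by rw [Finset.mem_Icc] at hi; omega),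
      map_zero, mul_zero]
  · intro γ hγ
    have := pderiv_eq_setZero_add hN hF hγ
    rw [← hA γ hγ] at this
    exact this

end Decomposition

/-! ### Independence of `N` in the variables `s` -/

section Stabilization

/-- The substitution of `0` for the variables `s_j` with `j = 0` or `N ≤ j`. -/
noncomputable def truncVars (N : ℕ) : MvPolynomial ℕ ℚ →+* MvPolynomial ℕ ℚ :=
  (aeval fun j => if 1 ≤ j ∧ j < N then X j else 0 :
    MvPolynomial ℕ ℚ →ₐ[ℚ] MvPolynomial ℕ ℚ).toRingHom

theorem truncVars_C (N : ℕ) (a : ℚ) : truncVars N (C a) = C a := by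
  simp only [truncVars, AlgHom.toRingHom_eq_coe, RingHom.coe_coe, algHom_C, algebraMap_eq]

theorem truncVars_X (N j : ℕ) : truncVars N (X j) = if 1 ≤ j ∧ j < N then X j else 0 := by
  simp [truncVars]

theorem toFlat_C (N : ℕ) (a : ℚ) : toFlat N (C a) = C a := by
  simp only [toFlat, AlgHom.toRingHom_eq_coe, RingHom.coe_coe, algHom_C, algebraMap_eq]

theorem toFlat_X (N j : ℕ) : toFlat N (X j) = if 1 ≤ j ∧ j < N then X (N - j) else 0 := by
  simp [toFlat]

theorem toS_toFlat (N : ℕ) (p : MvPolynomial ℕ ℚ) : toS N (toFlat N p) = truncVars N p := by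
  have h : (rename fun γ => N - γ : MvPolynomial ℕ ℚ →ₐ[ℚ] MvPolynomial ℕ ℚ).toRingHom.comp
      (toFlat N) = truncVars N := by
    refine ringHom_ext (fun a => ?_) fun j => ?_
    · rw [RingHom.comp_apply, toFlat_C, truncVars_C]
      exact rename_C _ a
    · rw [RingHom.comp_apply, toFlat_X, truncVars_X, AlgHom.toRingHom_eq_coe, RingHom.coe_coe]
      split_ifs with hj
      · rw [rename_X, show N - (N - j) = j by omega]
      · rw [map_zero]
  exact congrArg (fun f => f p) h

theorem truncVars_truncVars {M N : ℕ} (h : M ≤ N) (p : MvPolynomial ℕ ℚ) :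
    truncVars N (truncVars M p) = truncVars M p := by
  have h : (truncVars N).comp (truncVars M) = truncVars M := by
    refine ringHom_ext (fun a => ?_) fun j => ?_
    · rw [RingHom.comp_apply, truncVars_C, truncVars_C]
    · rw [RingHom.comp_apply, truncVars_X]
      split_ifs with hj
      · rw [truncVars_X, if_pos (by omega)]
      · rw [map_zero]
  exact congrArg (fun f => f p) h

theorem setZero_toFlat (N : ℕ) (p : MvPolynomial ℕ ℚ) : setZero N (toFlat N p) = toFlat N p := by
  have h : (setZero N : MvPolynomial ℕ ℚ →ₐ[ℚ] MvPolynomial ℕ ℚ).toRingHom.comp (toFlat N)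
      = toFlat N := by
    refine ringHom_ext (fun a => ?_) fun j => ?_
    · rw [RingHom.comp_apply, toFlat_C, AlgHom.toRingHom_eq_coe, RingHom.coe_coe, algHom_C,
        algebraMap_eq]
    · rw [RingHom.comp_apply, toFlat_X, AlgHom.toRingHom_eq_coe, RingHom.coe_coe]
      split_ifs with hj
      · rw [setZero, aeval_X, if_neg (by omega)]
      · rw [map_zero]
  exact congrArg (fun f => f p) h

/-- Truncation changes `f` only from order `z^N` on, and the inverses differ by the difference of
the series times both inverses. -/
theorem X_pow_dvd_truncVars_univE (N : ℕ) :
    PowerSeries.X ^ N ∣ PowerSeries.map (truncVars N) univE - univE := by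
  have h1 : PowerSeries.X ^ N ∣ univF - PowerSeries.map (truncVars N) univF := by
    rw [PowerSeries.X_pow_dvd_iff]
    intro m hm
    rw [map_sub, PowerSeries.coeff_map, univF, PowerSeries.coeff_mk]
    split_ifs with h0
    · rw [map_one, sub_self]
    · rw [map_mul, truncVars_C, truncVars_X, if_pos (by omega), sub_self]
  have h2 : PowerSeries.map (truncVars N) univF * PowerSeries.map (truncVars N) univE = 1 := by
    rw [← map_mul, univF_mul_univE, map_one]
  have h3 : PowerSeries.map (truncVars N) univE - univE
      = (univF - PowerSeries.map (truncVars N) univF)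
        * (univE * PowerSeries.map (truncVars N) univE) := by
    linear_combination (-PowerSeries.map (truncVars N) univE) * univF_mul_univE + univE * h2
  rw [h3]
  exact h1.mul_right _

theorem truncVars_coeff_univE_pow {N n : ℕ} (hn : n < N) (k : ℕ) :
    truncVars N (PowerSeries.coeff n (univE ^ k)) = PowerSeries.coeff n (univE ^ k) := by
  have h := (X_pow_dvd_truncVars_univE N).trans (sub_dvd_pow_sub_pow _ _ k)
  rw [← map_pow] at h
  have h1 := PowerSeries.X_pow_dvd_iff.1 h n hn
  rwa [map_sub, PowerSeries.coeff_map, sub_eq_zero] at h1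

/-- The polynomial `flatPhi N n` in the variables `s`. -/
noncomputable def univPhi (n : ℕ) : Polynomial (MvPolynomial ℕ ℚ) :=
  resPoly (univE ^ 2) univF n

theorem constantCoeff_univE : PowerSeries.constantCoeff univE = 1 := by
  have := congrArg PowerSeries.constantCoeff univF_mul_univE
  simpa [constantCoeff_univF] using this

theorem coeff_univPhi (n k : ℕ) : (univPhi n).coeff k
    = if k ≤ n then PowerSeries.coeff (n - k) (univE ^ (2 * k + 1)) else 0 := by
  rw [univPhi, coeff_resPoly]
  congr 2
  rw [← pow_mul, show 2 * (k + 1) = (2 * k + 1) + 1 by ring, pow_succ]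
  linear_combination (univE ^ (2 * k + 1)) * univF_mul_univE

theorem map_toFlat_univPhi (N n : ℕ) : (univPhi n).map (toFlat N) = flatPhi N n := by
  rw [univPhi, map_resPoly, map_pow]; rfl

theorem map_truncVars_univPhi {N n : ℕ} (hn : n < N) :
    (univPhi n).map (truncVars N) = univPhi n := by
  ext1 k
  rw [Polynomial.coeff_map, coeff_univPhi]
  split_ifs
  · exact truncVars_coeff_univE_pow (by omega) _
  · rw [map_zero]

theorem exists_sum_C_mul {A : Type*} [CommRing A] {φ : ℕ → Polynomial A}
    (h1 : ∀ n, (φ n).coeff n = 1) (h0 : ∀ n k, n < k → (φ n).coeff k = 0) (m : ℕ) :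
    ∀ P : Polynomial A, (∀ k, m ≤ k → P.coeff k = 0) →
      ∃ D : ℕ → A, P = ∑ l ∈ Finset.range m, Polynomial.C (D l) * φ l := by
  induction m with
  | zero =>
    intro P hP
    exact ⟨0, by rw [Finset.range_zero, Finset.sum_empty]; ext k; simp [hP k (Nat.zero_le k)]⟩
  | succ m ih =>
    intro P hP
    obtain ⟨D, hD⟩ := ih (P - Polynomial.C (P.coeff m) * φ m) fun k hk => by
      rw [Polynomial.coeff_sub, Polynomial.coeff_C_mul]
      rcases hk.eq_or_lt with rfl | hk
      · rw [h1, mul_one, sub_self]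
      · rw [hP k hk, h0 m k hk, mul_zero, sub_self]
    refine ⟨Function.update D m (P.coeff m), ?_⟩
    rw [Finset.sum_range_succ, Function.update_self, Finset.sum_congr rfl fun l hl => by
      rw [Function.update_of_ne (Finset.mem_range.1 hl).ne], ← hD, sub_add_cancel]

/-- The `φ_l` are monic of degree `l`, so the product expands in them over the universal ring. The
same `D` then serves every `N ≥ M`. -/
theorem exists_univPhi_mul {M i j : ℕ} (h : i + j < M) : ∃ D : ℕ → MvPolynomial ℕ ℚ,
    (∀ l, truncVars M (D l) = D l) ∧ (∀ l, i + j < l → D l = 0) ∧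
      univPhi i * univPhi j = ∑ l ∈ Finset.range (i + j + 1), Polynomial.C (D l) * univPhi l := by
  have hdeg : ∀ n, (univPhi n).natDegree ≤ n := natDegree_resPoly_le _ _
  obtain ⟨D, hD⟩ := exists_sum_C_mul (φ := univPhi)
    (coeff_resPoly_self (by rw [map_pow, constantCoeff_univE, one_pow]) constantCoeff_univF)
    (fun n k hk => Polynomial.coeff_eq_zero_of_natDegree_lt ((hdeg n).trans_lt hk)) (i + j + 1)
    (univPhi i * univPhi j) fun k hk => Polynomial.coeff_eq_zero_of_natDegree_lt
      (lt_of_le_of_lt (Polynomial.natDegree_mul_le.trans (add_le_add (hdeg i) (hdeg j))) hk)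
  -- Truncation preserves the expansion because it fixes every `φ_l` with `l < M`; it ensures that
  -- `D l` uses only variables present for `M`. The value `0` outside the range covers the pairings
  -- that must vanish.
  refine ⟨fun l => if l < i + j + 1 then truncVars M (D l) else 0, fun l => ?_, fun l hl => ?_, ?_⟩
  · dsimp only
    split_ifs
    · rw [truncVars_truncVars le_rfl]
    · rw [map_zero]
  · dsimp only
    rw [if_neg (by omega)]
  · have h2 := congrArg (Polynomial.map (truncVars M)) hD
    rw [Polynomial.map_mul, map_truncVars_univPhi (by omega),
      map_truncVars_univPhi (by omega)] at h2
    rw [h2, Polynomial.map_sum]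
    refine Finset.sum_congr rfl fun l hl => ?_
    have hl := Finset.mem_range.1 hl
    rw [Polynomial.map_mul, Polynomial.map_C, map_truncVars_univPhi (by omega)]
    dsimp only
    rw [if_pos hl]

/-- Pairing `∑ D_l φ_l` with `φ_{k-1}` selects `l + (k - 1) = N - 2`. -/
theorem flatTriple_eq {N i j k : ℕ} {D : ℕ → MvPolynomial ℕ ℚ} (hN : 3 ≤ N) (hk : 1 ≤ k)
    (hkN : k < N) (hj : i - 1 + (j - 1) + 1 < N)
    (hD0 : ∀ l, i - 1 + (j - 1) < l → D l = 0)
    (hD : univPhi (i - 1) * univPhi (j - 1)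
      = ∑ l ∈ Finset.range (i - 1 + (j - 1) + 1), Polynomial.C (D l) * univPhi l) :
    flatTriple N k i j = toFlat N (D (N - 1 - k)) := by
  have h1 := congrArg (Polynomial.map (toFlat N)) hD
  rw [Polynomial.map_mul, Polynomial.map_sum, map_toFlat_univPhi, map_toFlat_univPhi] at h1
  have h2 : Polynomial.X * (flatPhi N (k - 1) * flatPhi N (i - 1) * flatPhi N (j - 1))
      = ∑ l ∈ Finset.range (i - 1 + (j - 1) + 1),
        toFlat N (D l) • (Polynomial.X * (flatPhi N l * flatPhi N (k - 1))) := by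
    rw [mul_assoc, h1, Finset.mul_sum, Finset.mul_sum]
    refine Finset.sum_congr rfl fun l _ => ?_
    rw [Polynomial.map_mul, Polynomial.map_C, map_toFlat_univPhi, Polynomial.smul_eq_C_mul]
    ring
  have h3 : ∀ l ∈ Finset.range (i - 1 + (j - 1) + 1),
      (((toFlat N (D l)) • (Polynomial.X * (flatPhi N l * flatPhi N (k - 1))))
        %ₘ relFlat N).coeff (N - 2 + 1) = if N - 1 - k = l then toFlat N (D l) else 0 := by
    intro l hl
    have hl := Finset.mem_range.1 hl
    rw [Polynomial.smul_modByMonic, Polynomial.coeff_smul, relFlat,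
      coeff_flatPhi_mul_modByMonic hN (by omega) (by omega), smul_eq_mul]
    by_cases h : N - 1 - k = l
    · rw [if_pos h, if_pos (by omega), mul_one]
    · rw [if_neg h, if_neg (by omega), mul_zero]
  rw [flatTriple, h2, ← Polynomial.modByMonicHom_apply, map_sum, Polynomial.finsetSum_coeff]
  simp only [Polynomial.modByMonicHom_apply]
  rw [Finset.sum_congr rfl h3, Finset.sum_ite_eq]
  split_ifs with h
  · rfl
  · rw [hD0 _ (by rw [Finset.mem_range] at h; omega), map_zero]

variable {N : ℕ} {c : ℕ → ℕ → ℕ → MvPolynomial ℕ ℂ} {t : ℕ → MvPolynomial ℕ ℂ}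
  {F : MvPolynomial ℕ ℂ} {v₁ : MvPolynomial ℕ ℚ} {A B : ℕ → MvPolynomial ℕ ℚ}

theorem v₁_eq_vFlat (hd : IsDDecomposition N t F v₁ A B) (hN : 3 ≤ N)
    (hF : IsDPotentialWith N c t F) : v₁ = vFlat N 1 :=
  ratMap_injective (mul_right_cancel₀ (X_ne_zero N)
    (hd.pderiv_last_eq.symm.trans (pderiv_last hN hF)))

/-- This is `φ_{β-1}(0)`. The coefficient of `z^(β-1)` in `1/f` is unaffected by truncation at `N >
β - 1`, so the right side does not depend on `N`. -/
theorem toS_pderiv_vFlat_one {β : ℕ} (hβ : 1 ≤ β) (hβN : β < N) :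
    toS N (pderiv β (vFlat N 1)) = PowerSeries.coeff (β - 1) univE := by
  rw [pderiv_vFlat hβ hβN le_rfl (by omega), coeff_flatPhi, if_pos (by omega), flatE, ← map_pow,
    PowerSeries.coeff_map, toS_toFlat, Nat.sub_self, Nat.sub_zero,
    truncVars_coeff_univE_pow (by omega), mul_zero, zero_add, pow_one]

theorem setZero_ratMap_eq {p : MvPolynomial ℕ ℚ} (hp : p.vars ⊆ Finset.Icc 1 (N - 1)) :
    setZero N (ratMap p) = ratMap p := by
  refine setZero_eq_self ?_
  rw [pderiv_ratMap, pderiv_eq_zero_of_notMem_vars fun h => ?_, map_zero]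
  have := Finset.mem_Icc.1 (hp h)
  omega

theorem ratMap_A (hd : IsDDecomposition N t F v₁ A B) {γ : ℕ}
    (hγ : γ ∈ Finset.Icc 1 (N - 1)) : ratMap (A γ) = setZero N (pderiv γ F) := by
  have h := hd.pderiv_eq γ hγ
  rw [← ratMap] at h
  rw [h, map_add, map_mul, map_pow, setZero_X_self, setZero_ratMap_eq (hd.A_vars γ hγ)]
  ring

theorem pderiv_pderiv_A (hd : IsDDecomposition N t F v₁ A B) (hN : 3 ≤ N)
    (hF : IsDPotentialWith N c t F) {k i j : ℕ} (hk : k ∈ Finset.Icc 1 (N - 1))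
    (hi : i ∈ Finset.Icc 1 (N - 1)) (hj : j ∈ Finset.Icc 1 (N - 1)) :
    pderiv k (pderiv i (A j)) = setZero N (flatTriple N k i j) := by
  have hne : ∀ {a}, a ∈ Finset.Icc 1 (N - 1) → a ≠ N := by
    intro a ha
    rw [Finset.mem_Icc] at ha
    omega
  refine ratMap_injective ?_
  rw [← pderiv_ratMap, ← pderiv_ratMap, ratMap_A hd hj, pderiv_setZero (hne hi),
    pderiv_setZero (hne hk), setZero_third hN hF hk hi hj]

theorem constantCoeff_pderiv_A (hd : IsDDecomposition N t F v₁ A B) (hN : 3 ≤ N)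
    (hF : IsDPotentialWith N c t F) {i j : ℕ} (hi : i ∈ Finset.Icc 1 (N - 1))
    (hj : j ∈ Finset.Icc 1 (N - 1)) : constantCoeff (pderiv i (A j)) = 0 := by
  have hI := Finset.Icc_subset_Icc_right (a := 1) (Nat.sub_le N 1)
  refine (algebraMap ℚ ℂ).injective ?_
  rw [map_zero, ← constantCoeff_map, ← ratMap, ← pderiv_ratMap, ratMap_A hd hj,
    pderiv_setZero (by rw [Finset.mem_Icc] at hi; omega), constantCoeff_setZero,
    constantCoeff_pderiv_pderiv_potential hN hF (hI hi) (hI hj)]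

theorem pderiv_toS {p : MvPolynomial ℕ ℚ} (hp : p.vars ⊆ Finset.Icc 1 (N - 1)) (m : ℕ) :
    pderiv m (toS N p) = if 1 ≤ m ∧ m < N then toS N (pderiv (N - m) p) else 0 := by
  have h1 : ∀ q : MvPolynomial ℕ ℚ, toS N q = aeval (fun γ => X (N - γ)) q := by
    intro q; rw [toS, rename_eq_aeval]; rfl
  rw [h1, pderiv_aeval _ hp]
  split_ifs with hm
  · rw [Finset.sum_eq_single (N - m), show N - (N - m) = m by omega, pderiv_X_self, one_mul, h1]
    · intro a ha ham
      rw [Finset.mem_Icc] at ha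
      rw [pderiv_X_of_ne (by omega), zero_mul]
    · intro h
      rw [Finset.mem_Icc] at h
      omega
  · refine Finset.sum_eq_zero fun a ha => ?_
    rw [Finset.mem_Icc] at ha
    rw [pderiv_X_of_ne (by omega), zero_mul]

/-- Since `∂/∂s_m` is `∂/∂t_{N-m}`, the index selected in `flatTriple_eq` is `N - 1 - (N - m) = m -
1`, and `N` disappears. -/
theorem pderiv_toS_pderiv_A (hd : IsDDecomposition N t F v₁ A B) (hN : 3 ≤ N)
    (hF : IsDPotentialWith N c t F) {M i j : ℕ} {D : ℕ → MvPolynomial ℕ ℚ} (hi : 1 ≤ i)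
    (hj : 1 ≤ j) (hij : i + j < N) (hMN : M ≤ N) (hDM : ∀ l, truncVars M (D l) = D l)
    (hD0 : ∀ l, i - 1 + (j - 1) < l → D l = 0)
    (hD : univPhi (i - 1) * univPhi (j - 1)
      = ∑ l ∈ Finset.range (i - 1 + (j - 1) + 1), Polynomial.C (D l) * univPhi l) (m : ℕ) :
    pderiv m (toS N (pderiv i (A j))) = if m = 0 then 0 else D (m - 1) := by
  have hi' : i ∈ Finset.Icc 1 (N - 1) := by rw [Finset.mem_Icc]; omega
  have hj' : j ∈ Finset.Icc 1 (N - 1) := by rw [Finset.mem_Icc]; omega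
  rw [pderiv_toS (vars_pderiv_subset (hd.A_vars j hj') i)]
  by_cases hm : 1 ≤ m ∧ m < N
  · rw [if_pos hm, if_neg (by omega), pderiv_pderiv_A hd hN hF
      (by rw [Finset.mem_Icc]; omega) hi' hj',
      flatTriple_eq hN (by omega) (by omega) (by omega) hD0 hD, setZero_toFlat, toS_toFlat,
      show N - 1 - (N - m) = m - 1 by omega, ← hDM, truncVars_truncVars hMN]
  · rw [if_neg hm]
    split_ifs
    · rfl
    · rw [hD0 _ (by omega)]

variable {N' : ℕ} {c' : ℕ → ℕ → ℕ → MvPolynomial ℕ ℂ} {t' : ℕ → MvPolynomial ℕ ℂ}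
  {F' : MvPolynomial ℕ ℂ} {v₁' : MvPolynomial ℕ ℚ} {A' B' : ℕ → MvPolynomial ℕ ℚ}

theorem toS_pderiv_v₁_eq (hN : 3 ≤ N) (hN' : N < N') (hF : IsDPotentialWith N c t F)
    (hF' : IsDPotentialWith N' c' t' F') (hd : IsDDecomposition N t F v₁ A B)
    (hd' : IsDDecomposition N' t' F' v₁' A' B') {β : ℕ} (hβ : 1 ≤ β) (hβN : β < N) :
    toS N (pderiv β v₁) = toS N' (pderiv β v₁') := by
  rw [v₁_eq_vFlat hd hN hF, v₁_eq_vFlat hd' (by omega) hF',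
    toS_pderiv_vFlat_one hβ hβN, toS_pderiv_vFlat_one hβ (by omega)]

theorem toS_pderiv_A_eq (hN : 3 ≤ N) (hN' : N < N') (hF : IsDPotentialWith N c t F)
    (hF' : IsDPotentialWith N' c' t' F') (hd : IsDDecomposition N t F v₁ A B)
    (hd' : IsDDecomposition N' t' F' v₁' A' B') {α β : ℕ} (hα : 1 ≤ α) (hβ : 1 ≤ β)
    (h : α + β < N) : toS N (pderiv β (A α)) = toS N' (pderiv β (A' α)) := by
  -- Truncation is taken at the smaller of the two indices, so that one `D` computes the gradient on
  -- both sides; the constant terms vanish by quasi-homogeneity.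
  obtain ⟨D, hDM, hD0, hD⟩ := exists_univPhi_mul (M := N) (i := β - 1) (j := α - 1) (by omega)
  refine eq_of_pderiv_eq (fun m => ?_) ?_
  · rw [pderiv_toS_pderiv_A hd hN hF hβ hα (by omega) le_rfl hDM hD0 hD,
      pderiv_toS_pderiv_A hd' (by omega) hF' hβ hα (by omega) hN'.le hDM hD0 hD]
  · rw [toS, toS, constantCoeff_rename, constantCoeff_rename,
      constantCoeff_pderiv_A hd hN hF (Finset.mem_Icc.2 (by omega)) (Finset.mem_Icc.2 (by omega)),
      constantCoeff_pderiv_A hd' (by omega) hF' (Finset.mem_Icc.2 (by omega))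
        (Finset.mem_Icc.2 (by omega))]

end Stabilization

end DSingularity

theorem mainTheorem6 :
    (∀ N : ℕ, 4 ≤ N → ∀ (t : ℕ → MvPolynomial ℕ ℂ) (F : MvPolynomial ℕ ℂ), IsDPotential N t F →
      ∃ (v₁ : MvPolynomial ℕ ℚ) (A B : ℕ → MvPolynomial ℕ ℚ), IsDDecomposition N t F v₁ A B) ∧
    (∀ N₁ N₂ : ℕ, 4 ≤ N₁ → N₁ < N₂ →
      ∀ (t t' : ℕ → MvPolynomial ℕ ℂ) (F F' : MvPolynomial ℕ ℂ),
      IsDPotential N₁ t F → IsDPotential N₂ t' F' →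
      ∀ (v₁ v₁' : MvPolynomial ℕ ℚ) (A B A' B' : ℕ → MvPolynomial ℕ ℚ),
      IsDDecomposition N₁ t F v₁ A B → IsDDecomposition N₂ t' F' v₁' A' B' →
      (∀ β : ℕ, 1 ≤ β → β < N₁ →
        toS N₁ (pderiv β v₁) = toS N₂ (pderiv β v₁')) ∧
      (∀ α β : ℕ, 1 ≤ α → 1 ≤ β → α + β < N₁ →
        toS N₁ (pderiv β (A α)) = toS N₂ (pderiv β (A' α)))) := by
  refine ⟨fun N hN t F ⟨c, hF⟩ => DSingularity.exists_decomposition (by omega) hF, ?_⟩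
  intro N₁ N₂ hN₁ hN t t' F F' ⟨c, hF⟩ ⟨c', hF'⟩ v₁ v₁' A B A' B' hd hd'
  exact ⟨fun β hβ hβN => DSingularity.toS_pderiv_v₁_eq (by omega) hN hF hF' hd hd' hβ hβN,
    fun α β hα hβ h => DSingularity.toS_pderiv_A_eq (by omega) hN hF hF' hd hd' hα hβ h⟩
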